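/- Let $\Gamma$ be a countable set. Let $\mathrm{Hilb}_{\mathrm{fin}}$ be the category of nonzero finite-dimensional complex Hilbert spaces and (not necessarily surjective) linear isometries, with its monoidal structure given by the tensor product of Hilbert spaces and the unit $\mathbb{C}$. For a finite set $\Lambda \subset \Gamma$ and a nonzero finite-dimensional Hilbert space $\mathcal{H}$ put $\mathcal{H}_\Lambda = \bigotimes_{v\in\Lambda}\mathcal{H}$ and $\mathfrak{A}_\Lambda(\mathcal{H}) = \mathcal{B}(\mathcal{H}_\Lambda)$. For $\Lambda_1 \subset \Lambda_2$ embed $\mathfrak{A}_{\Lambda_1}(\mathcal{H})$ into $\mathfrak{A}_{\Lambda_2}(\mathcal{H})$ by $A \mapsto A \otimes \mathbb{1}$, and let $$\mathfrak{A}_\Gamma(\mathcal{H}) = \operatorname{colim}_{\Lambda}\, \mathfrak{A}_\Lambda(\mathcal{H})$$ be the quasi-local algebra, that is, the completion of the union of these C*-algebras over all finite $\Lambda\subset\Gamma$, with the canonical embeddings $\iota^{\mathcal{H}}_\Lambda \colon \mathfrak{A}_\Lambda(\mathcal{H}) \to \mathfrak{A}_\Gamma(\mathcal{H})$. For a linear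 isometry $f\colon \mathcal{H}\to\mathcal{K}$ put $f_\Lambda = \bigotimes_{v\in\Lambda} f$ and let $\mathfrak{A}_\Gamma(f) \colon \mathfrak{A}_\Gamma(\mathcal{K}) \to \mathfrak{A}_\Gamma(\mathcal{H})$ be the unital completely positive map with $\mathfrak{A}_\Gamma(f)(\iota^{\mathcal{K}}_\Lambda(A)) = \iota^{\mathcal{H}}_\Lambda(f_\Lambda^* A f_\Lambda)$ for all $\Lambda$ and all $A \in \mathfrak{A}_\Lambda(\mathcal{K})$. This defines a contravariant functor $\mathfrak{A}_\Gamma$ from $\mathrm{Hilb}_{\mathrm{fin}}$ to the category of unital C*-algebras and unital completely positive maps, which is monoidal for the (maximal) C*-tensor product with unit $\mathbb{C}$. **Proposition.** 1. For every $\mathcal{H}$ the C*-algebra $\mathfrak{A}_\Gamma(\mathcal{H})$ is nuclear: for every C*-algebra $B$, any two C*-norms on the algebraic tensor product of $\mathfrak{A}_\Gamma(\mathcal{H})$ and $B$ coincide. (So $\mathfrak{A}_\Gamma$ takes values in the full subcategory of nuclear algebras, where the C*-tensor product is unique.) 2. The functor $\mathfrak{A}_\Gamma$ has the structure of a strong monoidal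 functor $\mathrm{Hilb}_{\mathrm{fin}}^{\mathrm{op}} \to C^*\text{-}\mathrm{Alg}$: there are an isomorphism $\mathbb{C}\cong\mathfrak{A}_\Gamma(\mathbb{C})$ and isomorphisms $$\eta_{\mathcal{H}_1,\mathcal{H}_2}\colon \mathfrak{A}_\Gamma(\mathcal{H}_1)\otimes\mathfrak{A}_\Gamma(\mathcal{H}_2) \xrightarrow{\ \cong\ } \mathfrak{A}_\Gamma(\mathcal{H}_1\otimes\mathcal{H}_2),$$ natural in $\mathcal{H}_1$ and $\mathcal{H}_2$ with respect to linear isometries, which satisfy the associativity and unit coherence conditions. Moreover each $\eta_{\mathcal{H}_1,\mathcal{H}_2}$ is a $*$-isomorphism, and it is the canonical one, which identifies external with internal stacking site by site: for every finite $\Lambda\subset\Gamma$ and all $a_v\in\mathcal{B}(\mathcal{H}_1)$, $b_v\in\mathcal{B}(\mathcal{H}_2)$ $(v\in\Lambda)$, $$\eta_{\mathcal{H}_1,\mathcal{H}_2}\Big(\iota_\Lambda^{\mathcal{H}_1}\big(\textstyle\bigotimes_{v} a_v\big)\otimes\iota_\Lambda^{\mathcal{H}_2}\big(\bigotimes_{v}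 b_v\big)\Big) = \iota_\Lambda^{\mathcal{H}_1\otimes\mathcal{H}_2}\Big(\bigotimes_{v}(a_v\otimes b_v)\Big).$$ -/

import Mathlib

open scoped TensorProduct CStarAlgebra

noncomputable section
set_option linter.unusedSectionVars false

/-- A C⋆-seminorm on a complex ⋆-algebra. -/
structure CStarSeminorm (D : Type*) [NonUnitalRing D] [Star D] [Module ℂ D] extends
    Seminorm ℂ D where
  mul_le' : ∀ x y : D, toFun (x * y) ≤ toFun x * toFun y
  star_mul_self' : ∀ x : D, toFun (star x * x) = toFun x * toFun x

namespace CStarSeminorm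

instance {D : Type*} [NonUnitalRing D] [Star D] [Module ℂ D] :
    FunLike (CStarSeminorm D) D ℝ where
  coe p := p.toFun
  coe_injective p q h := by
    obtain ⟨p, _, _⟩ := p; obtain ⟨q, _, _⟩ := q
    have : p = q := DFunLike.coe_injective h
    subst this; rfl

instance {D : Type*} [NonUnitalRing D] [Star D] [Module ℂ D] :
    SeminormClass (CStarSeminorm D) ℂ D where
  map_add_le_add p := p.add_le'
  map_zero p := p.map_zero'
  map_neg_eq_map p := p.neg'
  map_smul_eq_mul p := p.smul'

theorem mul_le {D : Type*} [NonUnitalRing D] [Star D] [Module ℂ D] (p : CStarSeminorm D)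
    (x y : D) : p (x * y) ≤ p x * p y := p.mul_le' x y

theorem star_mul_self {D : Type*} [NonUnitalRing D] [Star D] [Module ℂ D] (p : CStarSeminorm D)
    (x : D) : p (star x * x) = p x * p x := p.star_mul_self' x

variable {D : Type*} [Ring D] [StarRing D] [Algebra ℂ D] [StarModule ℂ D] (p : CStarSeminorm D)

theorem map_star (x : D) : p (star x) = p x := by
  have key : ∀ x : D, p x ≤ p (star x) := by
    intro x
    rcases (apply_nonneg p x).eq_or_lt with h | h
    · rw [← h]; exact apply_nonneg p _
    · have := p.star_mul_self x ▸ p.mul_le (star x) x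
      exact le_of_mul_le_mul_right this h
  exact le_antisymm (by simpa using key (star x)) (key x)

/-- The algebra `D`, regarded as a seminormed algebra via `p`. -/
def Pre (_ : CStarSeminorm D) : Type _ := D

instance : SeminormedRing p.Pre where
  __ := p.toSeminorm.toAddGroupSeminorm.toSeminormedAddCommGroup
  __ := (inferInstanceAs (Ring D) : Ring p.Pre)
  norm_mul_le := p.mul_le

instance : StarRing p.Pre where
  star := (star : D → D)
  star_involutive := star_involutive (R := D)
  star_mul := star_mul (R := D)
  star_add := star_add (R := D)

instance : NormedAlgebra ℂ p.Pre where
  smul := (HSMul.hSMul : ℂ → D → D)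
  algebraMap := algebraMap ℂ D
  commutes' := Algebra.commutes (A := D)
  smul_def' := Algebra.smul_def (A := D)
  norm_smul_le c x := (map_smul_eq_mul p c (show D from x)).le

instance : StarModule ℂ p.Pre where
  star_smul c x := star_smul c (show D from x)

instance : NormedStarGroup p.Pre where
  norm_star_le x := (p.map_star x).le

/-- The C⋆-algebra obtained from `D` by (separation and) completion with respect to `p`. -/
def Completion : Type _ := UniformSpace.Completion p.Pre

instance : NormedRing p.Completion := inferInstanceAs (NormedRing (UniformSpace.Completion p.Pre))
instance : CompleteSpace p.Completion :=
  inferInstanceAs (CompleteSpace (UniformSpace.Completion p.Pre))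
instance : NormedAlgebra ℂ p.Completion where
  __ := (inferInstanceAs (Algebra ℂ (UniformSpace.Completion p.Pre)) : Algebra ℂ p.Completion)
  norm_smul_le c x := norm_smul_le c (show UniformSpace.Completion p.Pre from x)

/-- The canonical map from `D` to its completion. -/
def coe (x : D) : p.Completion := ((show p.Pre from x : p.Pre) : UniformSpace.Completion p.Pre)

theorem norm_coe (x : D) : ‖p.coe x‖ = p x := UniformSpace.Completion.norm_coe (E := p.Pre) x

theorem denseRange_coe : DenseRange p.coe := UniformSpace.Completion.denseRange_coe (α := p.Pre)

theorem isClosed_ind {P : p.Completion → Prop} (hc : IsClosed {x | P x}) (h : ∀ x, P (p.coe x))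
    (x : p.Completion) : P x :=
  UniformSpace.Completion.induction_on (α := p.Pre) x hc h

theorem coe_add (x y : D) : p.coe (x + y) = p.coe x + p.coe y :=
  UniformSpace.Completion.coe_add (α := p.Pre) x y
theorem coe_mul (x y : D) : p.coe (x * y) = p.coe x * p.coe y :=
  UniformSpace.Completion.coe_mul (α := p.Pre) x y
theorem coe_smul (c : ℂ) (x : D) : p.coe (c • x) = c • p.coe x :=
  UniformSpace.Completion.coe_smul (X := p.Pre) c x

instance : Star p.Completion :=
  ⟨UniformSpace.Completion.map (star : p.Pre → p.Pre)⟩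

theorem coe_star (x : D) : p.coe (star x) = star (p.coe x) :=
  (UniformSpace.Completion.map_coe (α := p.Pre) (β := p.Pre) star_isometry.uniformContinuous x).symm

theorem continuous_star' : Continuous (star : p.Completion → p.Completion) :=
  UniformSpace.Completion.continuous_map

instance : StarRing p.Completion where
  star_involutive x := by
    refine p.isClosed_ind (P := fun x => star (star x) = x)
      (isClosed_eq (p.continuous_star'.comp p.continuous_star') continuous_id) (fun x => ?_) x
    simp [← coe_star]
  star_mul x y := by
    refine p.isClosed_ind (P := fun x => star (x * y) = star y * star x)
      (isClosed_eq (p.continuous_star'.comp (continuous_id.mul continuous_const))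
        (continuous_const.mul p.continuous_star')) (fun x => ?_) x
    refine p.isClosed_ind (P := fun y => star (p.coe x * y) = star y * star (p.coe x))
      (isClosed_eq (p.continuous_star'.comp (continuous_const.mul continuous_id))
        (p.continuous_star'.mul continuous_const)) (fun y => ?_) y
    simp [← coe_star, ← coe_mul]
  star_add x y := by
    refine p.isClosed_ind (P := fun x => star (x + y) = star x + star y)
      (isClosed_eq (p.continuous_star'.comp (continuous_id.add continuous_const))
        (p.continuous_star'.add continuous_const)) (fun x => ?_) x
    refine p.isClosed_ind (P := fun y => star (p.coe x + y) = star (p.coe x) + star y)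
      (isClosed_eq (p.continuous_star'.comp (continuous_const.add continuous_id))
        (continuous_const.add p.continuous_star')) (fun y => ?_) y
    simp [← coe_star, ← coe_add]

instance : CStarAlgebra p.Completion where
  norm_mul_self_le x := by
    refine p.isClosed_ind (P := fun x => ‖x‖ * ‖x‖ ≤ ‖star x * x‖)
      (isClosed_le (by fun_prop) (continuous_norm.comp (p.continuous_star'.mul continuous_id)))
      (fun x => ?_) x
    rw [← coe_star, ← coe_mul, norm_coe, norm_coe, p.star_mul_self]
  star_smul c x := by
    refine p.isClosed_ind (P := fun x => star (c • x) = star c • star x)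
      (isClosed_eq (p.continuous_star'.comp (continuous_const_smul c))
        (p.continuous_star'.const_smul (star c))) (fun x => ?_) x
    simp [← coe_star, ← coe_smul, star_smul]

/-- The canonical map from `D` to its completion, as a unital ⋆-homomorphism. -/
def toCompletion : D →⋆ₐ[ℂ] p.Completion where
  toFun := p.coe
  map_one' := rfl
  map_mul' := p.coe_mul
  map_zero' := rfl
  map_add' := p.coe_add
  commutes' _ := rfl
  map_star' := p.coe_star

theorem norm_toCompletion (x : D) : ‖p.toCompletion x‖ = p x := p.norm_coe x
theorem denseRange_toCompletion : DenseRange p.toCompletion := p.denseRange_coe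

/-- The bounded extension to the completion of a linear map that is contractive for `p`. -/
def extend {B : Type*} [NormedAddCommGroup B] [NormedSpace ℂ B] [CompleteSpace B] (φ : D →ₗ[ℂ] B)
    (h : ∀ x, ‖φ x‖ ≤ p x) : p.Completion →L[ℂ] B :=
  (LinearMap.mkContinuous (E := p.Pre) (φ : D →ₗ[ℂ] B) 1 (fun x => (h x).trans (one_mul _).ge)).extend
    (UniformSpace.Completion.toComplL (𝕜 := ℂ) (E := p.Pre))

theorem extend_coe {B : Type*} [NormedAddCommGroup B] [NormedSpace ℂ B] [CompleteSpace B]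
    (φ : D →ₗ[ℂ] B) (h : ∀ x, ‖φ x‖ ≤ p x) (x : D) :
    p.extend φ h (p.toCompletion x) = φ x :=
  ContinuousLinearMap.extend_eq (E := p.Pre) _ UniformSpace.Completion.denseRange_coe
    (UniformSpace.Completion.isUniformInducing_coe _) x

/-- The C⋆-seminorm `x ↦ ‖π x‖` defined by a ⋆-homomorphism into a C⋆-algebra. -/
def ofStarAlgHom {B : Type*} [CStarAlgebra B] (π : D →⋆ₐ[ℂ] B) : CStarSeminorm D where
  toFun x := ‖π x‖
  map_zero' := by simp
  add_le' x y := by simpa using norm_add_le (π x) (π y)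
  neg' x := by simp
  smul' c x := by simp [norm_smul]
  mul_le' x y := by simpa using norm_mul_le (π x) (π y)
  star_mul_self' x := by simpa [StarHomClass.map_star] using CStarRing.norm_star_mul_self (x := π x)

/-- The extension to the completion of a ⋆-homomorphism that is contractive for `p`. -/
def extendHom {B : Type*} [CStarAlgebra B] (π : D →⋆ₐ[ℂ] B) (h : ∀ x, ‖π x‖ ≤ p x) :
    p.Completion →⋆ₐ[ℂ] B where
  toFun := p.extend π.toAlgHom.toLinearMap h
  map_one' := (p.extend_coe _ h 1).trans (map_one π)
  map_zero' := map_zero _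
  map_add' := map_add _
  commutes' c := (p.extend_coe _ h (algebraMap ℂ D c)).trans (AlgHomClass.commutes π c)
  map_mul' x y := by
    have hc := (p.extend π.toAlgHom.toLinearMap h).continuous
    refine p.isClosed_ind (P := fun x => p.extend π.toAlgHom.toLinearMap h (x * y) =
        p.extend π.toAlgHom.toLinearMap h x * p.extend π.toAlgHom.toLinearMap h y)
      (isClosed_eq (by fun_prop) (by fun_prop)) (fun x => ?_) x
    refine p.isClosed_ind (P := fun y => p.extend π.toAlgHom.toLinearMap h (p.coe x * y) =
        p.extend π.toAlgHom.toLinearMap h (p.coe x) * p.extend π.toAlgHom.toLinearMap h y)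
      (isClosed_eq (by fun_prop) (by fun_prop)) (fun y => ?_) y
    rw [← coe_mul]
    erw [p.extend_coe _ h, p.extend_coe _ h, p.extend_coe _ h]
    exact map_mul π x y
  map_star' x := by
    have hc := (p.extend π.toAlgHom.toLinearMap h).continuous
    refine p.isClosed_ind (P := fun x => p.extend π.toAlgHom.toLinearMap h (star x) =
        star (p.extend π.toAlgHom.toLinearMap h x))
      (isClosed_eq (hc.comp p.continuous_star') (continuous_star.comp hc)) (fun x => ?_) x
    rw [← coe_star]
    erw [p.extend_coe _ h, p.extend_coe _ h]
    exact StarHomClass.map_star π x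

theorem extendHom_coe {B : Type*} [CStarAlgebra B] (π : D →⋆ₐ[ℂ] B) (h : ∀ x, ‖π x‖ ≤ p x)
    (x : D) : p.extendHom π h (p.toCompletion x) = π x := p.extend_coe _ h x

end CStarSeminorm

section CompletelyPositive

attribute [local instance] CStarAlgebra.spectralOrder CStarAlgebra.spectralOrderedRing

/-- Unital completely positive linear maps between unital C⋆-algebras (each C⋆-algebra carries its
usual order, in which the positive elements are the self-adjoint elements with nonnegative
spectrum). -/
structure UCPMap (A B : Type*) [CStarAlgebra A] [CStarAlgebra B] extends A →CP B where
  map_one' : toFun 1 = 1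

namespace UCPMap

variable {A B C : Type*} [CStarAlgebra A] [CStarAlgebra B] [CStarAlgebra C]

instance : FunLike (UCPMap A B) A B where
  coe φ := φ.toFun
  coe_injective φ ψ h := by
    obtain ⟨φ, _⟩ := φ; obtain ⟨ψ, _⟩ := ψ
    have : φ = ψ := DFunLike.coe_injective h
    subst this; rfl

@[ext] theorem ext {φ ψ : UCPMap A B} (h : ∀ x, φ x = ψ x) : φ = ψ := DFunLike.ext _ _ h

instance : LinearMapClass (UCPMap A B) ℂ A B where
  map_add φ := φ.map_add'
  map_smulₛₗ φ := φ.map_smul'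

instance : OneHomClass (UCPMap A B) A B where
  map_one φ := φ.map_one'

instance : CompletelyPositiveMapClass (UCPMap A B) A B where
  map_cstarMatrix_nonneg' φ := φ.map_cstarMatrix_nonneg'

protected theorem continuous (φ : UCPMap A B) : Continuous φ :=
  map_continuous φ

/-- The identity. -/
def id (A : Type*) [CStarAlgebra A] : UCPMap A A where
  __ := (LinearMap.id : A →ₗ[ℂ] A)
  map_cstarMatrix_nonneg' _ M hM := by simpa using hM
  map_one' := rfl

/-- Composition. -/
def comp (ψ : UCPMap B C) (φ : UCPMap A B) : UCPMap A C where
  __ := ψ.toLinearMap ∘ₗ φ.toLinearMap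
  map_cstarMatrix_nonneg' n M hM :=
    ψ.map_cstarMatrix_nonneg' n _ (φ.map_cstarMatrix_nonneg' n M hM)
  map_one' := (congrArg ψ (map_one φ)).trans (map_one ψ)

/-- A unital ⋆-homomorphism is a unital completely positive map. -/
def ofStarAlgHom (π : A →⋆ₐ[ℂ] B) : UCPMap A B where
  __ := π.toAlgHom.toLinearMap
  map_cstarMatrix_nonneg' := CompletelyPositiveMapClass.map_cstarMatrix_nonneg' π
  map_one' := map_one π

@[simp] theorem id_apply (x : A) : UCPMap.id A x = x := rfl
@[simp] theorem comp_apply (ψ : UCPMap B C) (φ : UCPMap A B) (x : A) : ψ.comp φ x = ψ (φ x) := rfl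
@[simp] theorem ofStarAlgHom_apply (π : A →⋆ₐ[ℂ] B) (x : A) : ofStarAlgHom π x = π x := rfl

end UCPMap

/-- A linear map `φ` between complex ⋆-algebras such that every matrix `(φ (xᵢ⋆ xⱼ))ᵢⱼ` is a sum of
matrices of the form `(zᵢ⋆ zⱼ)ᵢⱼ`. -/
def GramPreserving {D E : Type*} [Ring D] [StarRing D] [Algebra ℂ D]
    [Ring E] [StarRing E] [Algebra ℂ E] (φ : D →ₗ[ℂ] E) : Prop :=
  ∀ (n : ℕ) (x : Fin n → D), ∃ (m : ℕ) (z : Fin m → Fin n → E),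
    ∀ i j, φ (star (x i) * x j) = ∑ k, star (z k i) * z k j

theorem CStarAlgebra.exists_star_mul_self {A : Type*} [NonUnitalCStarAlgebra A] [PartialOrder A]
    [StarOrderedRing A] {a : A} (ha : 0 ≤ a) : ∃ b, a = star b * b :=
  CStarAlgebra.nonneg_iff_eq_star_mul_self.mp ha

theorem CStarMatrix.sum_entry {A ι m n : Type*} [AddCommMonoid A] (s : Finset ι)
    (M : ι → CStarMatrix m n A) (i : m) (j : n) : (∑ k ∈ s, M k) i j = ∑ k ∈ s, M k i j := by
  classical
  induction s using Finset.induction_on with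
  | empty => simp [CStarMatrix.zero_apply]
  | insert a s ha ih => rw [Finset.sum_insert ha, Finset.sum_insert ha, CStarMatrix.add_apply, ih]

theorem CStarMatrix.gram_nonneg {A : Type*} [CStarAlgebra A] {n m : ℕ} (z : Fin m → Fin n → A) :
    (0 : CStarMatrix (Fin n) (Fin n) A) ≤
      CStarMatrix.ofMatrix (fun i j => ∑ k, star (z k i) * z k j) := by
  have : CStarMatrix.ofMatrix (fun i j => ∑ k, star (z k i) * z k j) =
      ∑ k, CStarMatrix.ofMatrix (fun i j => star (z k i) * z k j) := by
    ext i j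
    rw [CStarMatrix.sum_entry]
    rfl
  rw [this]
  refine Finset.sum_nonneg fun k _ => ?_
  rcases n with _ | n
  · refine le_of_eq ?_
    ext i
    exact i.elim0
  let N : CStarMatrix (Fin (n+1)) (Fin (n+1)) A :=
    CStarMatrix.ofMatrix (fun i j => if i = 0 then z k j else 0)
  have hN : CStarMatrix.ofMatrix (fun i j => star (z k i) * z k j) = star N * N := by
    ext i j
    rw [CStarMatrix.mul_apply, Finset.sum_eq_single 0]
    · simp [N, CStarMatrix.star_apply]
      rfl
    · intro l _ hl
      have : N l j = 0 := if_neg hl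
      rw [this, mul_zero]
    · simp
  rw [hN]
  exact star_mul_self_nonneg N

theorem UCPMap.gramPreserving {A B : Type*} [CStarAlgebra A] [CStarAlgebra B] (φ : UCPMap A B) :
    GramPreserving (φ : A →ₗ[ℂ] B) := by
  intro n x
  have h := φ.map_cstarMatrix_nonneg' n _
    (CStarMatrix.gram_nonneg (fun _ : Fin 1 => x))
  obtain ⟨N, hN⟩ := CStarAlgebra.exists_star_mul_self h
  refine ⟨n, fun k i => N k i, fun i j => ?_⟩
  have := congrFun (congrFun hN i) j
  rw [CStarMatrix.mul_apply] at this
  simp only [CStarMatrix.star_apply] at this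
  rw [← this]
  change _ = φ (∑ k : Fin 1, star (x i) * x j)
  simp

namespace CStarSeminorm

variable {D : Type*} [Ring D] [StarRing D] [Algebra ℂ D] [StarModule ℂ D] (p : CStarSeminorm D)

theorem extend_cp {B : Type*} [CStarAlgebra B] (φ : D →ₗ[ℂ] B) (h : ∀ x, ‖φ x‖ ≤ p x)
    (hg : GramPreserving φ) (n : ℕ) (M : CStarMatrix (Fin n) (Fin n) p.Completion) (hM : 0 ≤ M) :
    0 ≤ M.map (p.extend φ h) := by
  obtain ⟨N, rfl⟩ := CStarAlgebra.exists_star_mul_self hM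
  have hd : DenseRange (fun (x : Fin n → Fin n → D) =>
      (CStarMatrix.ofMatrix (fun i j => p.toCompletion (x i j)) :
        CStarMatrix (Fin n) (Fin n) p.Completion)) :=
    DenseRange.piMap (fun _ => DenseRange.piMap (fun _ => p.denseRange_toCompletion))
  have hmap : Continuous (fun M : CStarMatrix (Fin n) (Fin n) p.Completion =>
      M.map (p.extend φ h)) := by
    refine continuous_pi fun i => continuous_pi fun j => ?_
    exact (p.extend φ h).continuous.comp ((continuous_apply j).comp (continuous_apply i))
  have hcl : IsClosed {N : CStarMatrix (Fin n) (Fin n) p.Completion |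
      0 ≤ (star N * N).map (p.extend φ h)} :=
    CStarAlgebra.isClosed_nonneg.preimage
      (hmap.comp (continuous_star.mul continuous_id))
  refine hd.induction_on (p := fun N => 0 ≤ (star N * N).map (p.extend φ h)) N hcl fun x => ?_
  have : (star (CStarMatrix.ofMatrix (fun i j => p.toCompletion (x i j)) :
      CStarMatrix (Fin n) (Fin n) p.Completion) *
      CStarMatrix.ofMatrix (fun i j => p.toCompletion (x i j))).map (p.extend φ h) =
      ∑ k, CStarMatrix.ofMatrix (fun i j => φ (star (x k i) * x k j)) := by
    ext i j
    rw [CStarMatrix.sum_entry, CStarMatrix.map_apply, CStarMatrix.mul_apply, map_sum]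
    refine Finset.sum_congr rfl fun k _ => ?_
    rw [CStarMatrix.star_apply]
    refine Eq.trans ?_ (p.extend_coe φ h (star (x k i) * x k j))
    refine congrArg (p.extend φ h) ?_
    rw [map_mul, StarHomClass.map_star]
    rfl
  rw [this]
  refine Finset.sum_nonneg fun k _ => ?_
  obtain ⟨m, z, hz⟩ := hg n (x k)
  simp_rw [hz]
  exact CStarMatrix.gram_nonneg z

/-- The extension of a unital, completely positive, contractive map to the completion. -/
def extendUCP {B : Type*} [CStarAlgebra B] (φ : D →ₗ[ℂ] B) (h : ∀ x, ‖φ x‖ ≤ p x)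
    (hg : GramPreserving φ) (h1 : φ 1 = 1) : UCPMap p.Completion B where
  __ := (p.extend φ h).toLinearMap
  map_cstarMatrix_nonneg' := p.extend_cp φ h hg
  map_one' := (congrArg _ (map_one p.toCompletion)).symm.trans ((p.extend_coe φ h 1).trans h1)

theorem extendUCP_coe {B : Type*} [CStarAlgebra B] (φ : D →ₗ[ℂ] B) (h : ∀ x, ‖φ x‖ ≤ p x)
    (hg : GramPreserving φ) (h1 : φ 1 = 1) (x : D) :
    p.extendUCP φ h hg h1 (p.toCompletion x) = φ x := p.extend_coe φ h x

end CStarSeminorm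

end CompletelyPositive

section SumsOfSquares

variable (D : Type*) [Ring D] [StarRing D] [Algebra ℂ D] [StarModule ℂ D]

/-- The cone of finite sums of elements `s⋆ s`. -/
def sumsOfSquares : AddSubmonoid D := AddSubmonoid.closure (Set.range fun s : D => star s * s)

variable {D}

theorem sos_star_mul_self (s : D) : star s * s ∈ sumsOfSquares D :=
  AddSubmonoid.subset_closure ⟨s, rfl⟩

theorem sos_conj {x : D} (hx : x ∈ sumsOfSquares D) (y : D) :
    star y * x * y ∈ sumsOfSquares D := by
  induction hx using AddSubmonoid.closure_induction with
  | mem x hx =>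
    obtain ⟨s, rfl⟩ := hx
    have : star y * (star s * s) * y = star (s * y) * (s * y) := by rw [star_mul]; noncomm_ring
    simp only [this]
    exact sos_star_mul_self _
  | zero => simp
  | add a b _ _ ha hb =>
    rw [mul_add, add_mul]
    exact add_mem ha hb

theorem sos_smul {x : D} (hx : x ∈ sumsOfSquares D) {c : ℝ} (hc : 0 ≤ c) :
    (c : ℂ) • x ∈ sumsOfSquares D := by
  have := sos_conj hx (((√c : ℝ) : ℂ) • (1 : D))
  rw [star_smul, star_one, smul_mul_assoc, one_mul, smul_mul_smul_comm, mul_one] at this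
  rw [RCLike.star_def, Complex.conj_ofReal, ← Complex.ofReal_mul, Real.mul_self_sqrt hc] at this
  exact this

/-- The positive reals `t` such that `t² - x⋆ x` is a sum of squares. -/
def sosBounds (x : D) : Set ℝ :=
  {t | 0 < t ∧ ((t * t : ℝ) : ℂ) • (1 : D) - star x * x ∈ sumsOfSquares D}

theorem sosBounds_star {x : D} {t : ℝ} (ht : t ∈ sosBounds x) : t ∈ sosBounds (star x) := by
  obtain ⟨h0, h⟩ := ht
  refine ⟨h0, ?_⟩
  have h1 := sos_conj h (star x)
  have h2 := sos_star_mul_self (((t * t : ℝ) : ℂ) • (1 : D) - x * star x)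
  have h3 := sos_smul (add_mem h1 h2) (c := (t * t)⁻¹) (by positivity)
  convert h3 using 1
  have ht : (t : ℂ) ≠ 0 := by exact_mod_cast h0.ne'
  simp only [star_sub, star_smul, star_one, star_mul, star_star, Complex.ofReal_mul,
    RCLike.star_def, Complex.conj_ofReal, sub_mul, mul_sub, smul_mul_assoc, one_mul,
    mul_smul_comm, mul_one, smul_sub, smul_add, smul_smul, Complex.ofReal_inv, mul_assoc]
  have e : ((t : ℂ) * t)⁻¹ * (t * t) = 1 := inv_mul_cancel₀ (mul_ne_zero ht ht)
  have e2 : ((t : ℂ) * t)⁻¹ * (t * (t * (t * t))) = t * t := by field_simp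
  simp only [e, e2, one_smul]
  abel

theorem sosBounds_mul {x y : D} {t s : ℝ} (ht : t ∈ sosBounds x) (hs : s ∈ sosBounds y) :
    t * s ∈ sosBounds (x * y) := by
  refine ⟨mul_pos ht.1 hs.1, ?_⟩
  have h := add_mem (sos_conj ht.2 y) (sos_smul hs.2 (c := t * t) (mul_self_nonneg t))
  convert h using 1
  simp only [star_mul, Complex.ofReal_mul, sub_mul, mul_sub, smul_mul_assoc,
    mul_smul_comm, mul_one, smul_sub, smul_smul, mul_assoc]
  have e : (t : ℂ) * (s * (t * s)) = t * (t * (s * s)) := by ring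
  rw [e]
  abel

theorem sosBounds_add {x y : D} {t s : ℝ} (ht : t ∈ sosBounds x) (hs : s ∈ sosBounds y) :
    t + s ∈ sosBounds (x + y) := by
  obtain ⟨ht0, ht⟩ := ht
  obtain ⟨hs0, hs⟩ := hs
  refine ⟨add_pos ht0 hs0, ?_⟩
  have h := add_mem (add_mem (sos_smul ht (c := (t + s) / t) (by positivity))
    (sos_smul hs (c := (t + s) / s) (by positivity)))
    (sos_smul (sos_star_mul_self ((s : ℂ) • x - (t : ℂ) • y)) (c := (t * s)⁻¹) (by positivity))
  convert h using 1
  have ht : (t : ℂ) ≠ 0 := by exact_mod_cast ht0.ne'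
  have hs : (s : ℂ) ≠ 0 := by exact_mod_cast hs0.ne'
  simp only [star_sub, star_smul, star_add, Complex.ofReal_mul, Complex.ofReal_add,
    Complex.ofReal_div, RCLike.star_def, Complex.conj_ofReal, sub_mul, mul_sub, smul_mul_assoc,
    mul_smul_comm, smul_sub, smul_smul, Complex.ofReal_inv, add_mul, mul_add]
  match_scalars <;> field_simp <;> ring

theorem sosBounds_smul {x : D} {t : ℝ} (ht : t ∈ sosBounds x) {c : ℂ} (hc : c ≠ 0) :
    ‖c‖ * t ∈ sosBounds (c • x) := by
  refine ⟨mul_pos (norm_pos_iff.mpr hc) ht.1, ?_⟩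
  have h := sos_smul ht.2 (c := ‖c‖ * ‖c‖) (by positivity)
  convert h using 1
  have : star c * c = (‖c‖ : ℂ) * ‖c‖ := by
    rw [RCLike.star_def, Complex.conj_mul', sq]
  rw [star_smul, smul_mul_smul_comm, this, smul_sub, smul_smul]
  push_cast
  congr 2
  ring

theorem sosBounds_of_star_mul_self {x : D} {s : ℝ} (hs : s ∈ sosBounds (star x * x)) :
    √s ∈ sosBounds x := by
  obtain ⟨h0, h⟩ := hs
  refine ⟨Real.sqrt_pos.mpr h0, ?_⟩
  have h2 := sos_smul (add_mem h (sos_star_mul_self ((s : ℂ) • (1 : D) - star x * x)))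
    (c := (2 * s)⁻¹) (by positivity)
  rw [Real.mul_self_sqrt h0.le]
  convert h2 using 1
  have ht : (s : ℂ) ≠ 0 := by exact_mod_cast h0.ne'
  simp only [star_sub, star_smul, star_one, star_mul, star_star, Complex.ofReal_mul,
    RCLike.star_def, Complex.conj_ofReal, sub_mul, mul_sub, smul_mul_assoc, one_mul,
    mul_smul_comm, mul_one, smul_sub, smul_add, smul_smul, Complex.ofReal_inv, mul_assoc]
  match_scalars <;> simp <;> field_simp <;> ring

/-- If every element is bounded, then `x ↦ inf {t > 0 | t² - x⋆ x is a sum of squares}` is a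
C⋆-seminorm. -/
def sosSeminorm (hb : ∀ x : D, (sosBounds x).Nonempty) : CStarSeminorm D := by
  have hbdd : ∀ x : D, BddBelow (sosBounds x) := fun x => ⟨0, fun t ht => ht.1.le⟩
  have h0 : ∀ x : D, 0 ≤ sInf (sosBounds x) := fun x => Real.sInf_nonneg fun t ht => ht.1.le
  have hz : sInf (sosBounds (0 : D)) = 0 := by
    refine le_antisymm (le_of_forall_pos_le_add fun ε hε => ?_) (h0 _)
    rw [zero_add]
    refine csInf_le (hbdd _) ⟨hε, ?_⟩
    simpa using sos_smul (sos_star_mul_self (1 : D)) (c := ε * ε) (by positivity)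
  have le_of : ∀ (x : D) (a : ℝ), (∀ t ∈ sosBounds x, a ≤ t) → a ≤ sInf (sosBounds x) :=
    fun x a h => le_csInf (hb x) h
  exact
  { Seminorm.ofSMulLE (𝕜 := ℂ) (fun x => sInf (sosBounds x)) hz
      (fun x y => by
        rw [← sub_le_iff_le_add]
        refine le_of _ _ fun s hs => ?_
        rw [sub_le_comm]
        refine le_of _ _ fun t ht => ?_
        rw [sub_le_iff_le_add']
        exact csInf_le (hbdd _) (sosBounds_add hs ht))
      (fun c x => by
        rcases eq_or_ne c 0 with rfl | hc
        · simp [hz]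
        · rw [← div_le_iff₀' (norm_pos_iff.mpr hc)]
          refine le_of _ _ fun t ht => ?_
          rw [div_le_iff₀' (norm_pos_iff.mpr hc)]
          exact csInf_le (hbdd _) (sosBounds_smul ht hc)) with
    mul_le' := fun x y => by
      change sInf _ ≤ sInf _ * sInf _
      have key : ∀ t ∈ sosBounds x, sInf (sosBounds (x * y)) ≤ t * sInf (sosBounds y) := by
        intro t ht
        rw [← div_le_iff₀' ht.1]
        refine le_of _ _ fun s hs => ?_
        rw [div_le_iff₀' ht.1]
        exact csInf_le (hbdd _) (sosBounds_mul ht hs)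
      rcases (h0 y).eq_or_lt with hy | hy
      · obtain ⟨t, ht⟩ := hb x
        simpa [← hy] using key t ht
      · rw [← div_le_iff₀ hy]
        refine le_of _ _ fun t ht => ?_
        rw [div_le_iff₀ hy]
        exact key t ht
    star_mul_self' := fun x => by
      change sInf _ = sInf _ * sInf _
      apply le_antisymm
      · refine (Real.sqrt_le_left (h0 x)).mp ?_ |>.trans_eq (sq _)
        refine le_of _ _ fun t ht => Real.sqrt_le_iff.mpr ⟨ht.1.le, ?_⟩
        rw [sq]
        exact csInf_le (hbdd _) (sosBounds_mul (sosBounds_star ht) ht)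
      · refine le_of _ _ fun s hs => ?_
        have := csInf_le (hbdd _) (sosBounds_of_star_mul_self hs)
        exact (mul_self_le_mul_self (h0 x) this).trans_eq (Real.mul_self_sqrt hs.1.le) }

theorem sosSeminorm_le_iff (hb : ∀ x : D, (sosBounds x).Nonempty) {x : D} {a : ℝ}
    (h : ∀ t ∈ sosBounds x, a ≤ t) : a ≤ sosSeminorm hb x := le_csInf (hb x) h

end SumsOfSquares

section Gram

variable {D E F : Type*} [Ring D] [StarRing D] [Algebra ℂ D] [StarModule ℂ D]
  [Ring E] [StarRing E] [Algebra ℂ E] [StarModule ℂ E]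
  [Ring F] [StarRing F] [Algebra ℂ F] [StarModule ℂ F]

theorem GramPreserving.fintype {φ : D →ₗ[ℂ] E} (hφ : GramPreserving φ) {ι : Type*} [Fintype ι]
    (x : ι → D) : ∃ (m : ℕ) (z : Fin m → ι → E),
      ∀ i j, φ (star (x i) * x j) = ∑ k, star (z k i) * z k j := by
  obtain ⟨m, z, hz⟩ := hφ _ (fun k => x ((Fintype.equivFin ι).symm k))
  refine ⟨m, fun k i => z k (Fintype.equivFin ι i), fun i j => ?_⟩
  simpa using hz (Fintype.equivFin ι i) (Fintype.equivFin ι j)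

theorem GramPreserving.starAlgHom_comp {φ : D →ₗ[ℂ] E} (hφ : GramPreserving φ) (π : E →⋆ₐ[ℂ] F) :
    GramPreserving (π.toAlgHom.toLinearMap ∘ₗ φ) := by
  intro n x
  obtain ⟨m, z, hz⟩ := hφ n x
  refine ⟨m, fun k i => π (z k i), fun i j => ?_⟩
  change π (φ _) = _
  simp [hz, StarHomClass.map_star]

theorem GramPreserving.tensor {D' E' : Type*} [Ring D'] [StarRing D'] [Algebra ℂ D']
    [StarModule ℂ D'] [Ring E'] [StarRing E'] [Algebra ℂ E'] [StarModule ℂ E']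
    {φ : D →ₗ[ℂ] E} {ψ : D' →ₗ[ℂ] E'} (hφ : GramPreserving φ) (hψ : GramPreserving ψ) :
    GramPreserving (TensorProduct.map φ ψ) := by
  intro n x
  have hx : ∀ i, ∃ (m : ℕ) (a : Fin m → D) (b : Fin m → D'), x i = ∑ r, a r ⊗ₜ[ℂ] b r :=
    fun i => TensorProduct.exists_sum_tmul_eq (x i)
  choose m a b hab using hx
  obtain ⟨p, c, hc⟩ := hφ.fintype (fun α : Σ i, Fin (m i) => a α.1 α.2)
  obtain ⟨q, d, hd⟩ := hψ.fintype (fun α : Σ i, Fin (m i) => b α.1 α.2)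
  refine ⟨p * q, fun k i => ∑ r, c (finProdFinEquiv.symm k).1 ⟨i, r⟩ ⊗ₜ[ℂ]
    d (finProdFinEquiv.symm k).2 ⟨i, r⟩, fun i j => ?_⟩
  rw [← finProdFinEquiv.sum_comp]
  simp only [Equiv.symm_apply_apply]
  rw [hab i, hab j]
  simp only [star_sum, Finset.sum_mul_sum, map_sum, TensorProduct.star_tmul,
    Algebra.TensorProduct.tmul_mul_tmul, TensorProduct.map_tmul]
  rw [Finset.sum_comm]
  have hc' := fun r s => hc ⟨i, r⟩ ⟨j, s⟩
  have hd' := fun r s => hd ⟨i, r⟩ ⟨j, s⟩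
  dsimp only at hc' hd'
  simp only [hc', hd', TensorProduct.sum_tmul, TensorProduct.tmul_sum]
  rw [Fintype.sum_prod_type, Finset.sum_comm]
  have e : ∀ (g : Fin (m j) → Fin q → Fin p → E ⊗[ℂ] E'),
      ∑ s, ∑ l, ∑ k, g s l k = ∑ k, ∑ l, ∑ s, g s l k := fun g => by
    rw [Finset.sum_comm_cycle]
    exact Finset.sum_congr rfl fun k _ => Finset.sum_comm
  simp only [e]
  rw [Finset.sum_comm_cycle, Finset.sum_comm_cycle]

open scoped ComplexOrder in
theorem GramPreserving.norm_le {B : Type*} [CStarAlgebra B] {θ : D →ₗ[ℂ] B}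
    (hθ : GramPreserving θ) (h1 : θ 1 = 1) {x : D} {t : ℝ} (ht : t ∈ sosBounds x) : ‖θ x‖ ≤ t := by
  let _ := CStarAlgebra.spectralOrder B
  have _ := CStarAlgebra.spectralOrderedRing B
  have hpos : ∀ y ∈ sumsOfSquares D, 0 ≤ θ y := by
    intro y hy
    induction hy using AddSubmonoid.closure_induction with
    | mem x hx =>
      obtain ⟨s, rfl⟩ := hx
      obtain ⟨m, z, hz⟩ := hθ 1 (fun _ => s)
      rw [show θ (star s * s) = _ from hz 0 0]
      exact Finset.sum_nonneg fun k _ => star_mul_self_nonneg _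
    | zero => simp
    | add a b _ _ ha hb => rw [map_add]; exact add_nonneg ha hb
  obtain ⟨m, z, hz⟩ := hθ 2 ![1, x]
  have h00 : (1 : B) = ∑ k, star (z k 0) * z k 0 := by simpa [h1] using hz 0 0
  have h01 : θ x = ∑ k, star (z k 0) * z k 1 := by simpa using hz 0 1
  have h10 : star (θ x) = ∑ k, star (z k 1) * z k 0 := by simp [h01, star_sum]
  have h11 : θ (star x * x) = ∑ k, star (z k 1) * z k 1 := by simpa using hz 1 1
  have ks : star (θ x) * θ x ≤ θ (star x * x) := by
    rw [← sub_nonneg]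
    have : θ (star x * x) - star (θ x) * θ x =
        ∑ k, star (z k 1 - z k 0 * θ x) * (z k 1 - z k 0 * θ x) := by
      have e : ∀ k, star (z k 1 - z k 0 * θ x) * (z k 1 - z k 0 * θ x) =
          star (z k 1) * z k 1 - star (z k 1) * z k 0 * θ x - star (θ x) * (star (z k 0) * z k 1)
          + star (θ x) * (star (z k 0) * z k 0) * θ x := by
        intro k
        rw [star_sub, star_mul]
        noncomm_ring
      simp only [e, Finset.sum_add_distrib, Finset.sum_sub_distrib, ← Finset.sum_mul,
        ← Finset.mul_sum, ← h00, ← h01, ← h10, ← h11]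
      noncomm_ring
    rw [this]
    exact Finset.sum_nonneg fun k _ => star_mul_self_nonneg _
  have h2 := hpos _ ht.2
  rw [map_sub, map_smul, h1, sub_nonneg] at h2
  have h3 := ks.trans h2
  have h4 : ‖star (θ x) * θ x‖ ≤ t * t := by
    rw [CStarAlgebra.norm_le_iff_le_algebraMap _ (mul_self_nonneg t) (star_mul_self_nonneg _)]
    refine h3.trans_eq ?_
    rw [Algebra.algebraMap_eq_smul_one]
    exact (Complex.coe_smul _ _)
  rw [CStarRing.norm_star_mul_self] at h4
  exact abs_le_of_sq_le_sq' (by nlinarith [norm_nonneg (θ x)]) ht.1.le |>.2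

end Gram

section MaxTensor

variable (A B : Type*) [CStarAlgebra A] [CStarAlgebra B]

/-- `a ↦ a ⊗ 1`. -/
def tensorInl : A →⋆ₐ[ℂ] A ⊗[ℂ] B where
  __ := (Algebra.TensorProduct.includeLeft : A →ₐ[ℂ] A ⊗[ℂ] B)
  map_star' a := by simp

/-- `b ↦ 1 ⊗ b`. -/
def tensorInr : B →⋆ₐ[ℂ] A ⊗[ℂ] B where
  __ := (Algebra.TensorProduct.includeRight : B →ₐ[ℂ] A ⊗[ℂ] B)
  map_star' a := by simp

variable {A B}

theorem CStarSeminorm.tmul_le (p : CStarSeminorm (A ⊗[ℂ] B)) (a : A) (b : B) :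
    p (a ⊗ₜ b) ≤ ‖a‖ * ‖b‖ := by
  have h : a ⊗ₜ[ℂ] b = tensorInl A B a * tensorInr A B b := by
    change _ = (a ⊗ₜ[ℂ] (1 : B)) * ((1 : A) ⊗ₜ[ℂ] b)
    simp
  rw [h, ← p.norm_toCompletion, map_mul]
  refine (norm_mul_le _ _).trans ?_
  gcongr
  · exact NonUnitalStarAlgHom.norm_apply_le (p.toCompletion.comp (tensorInl A B)) a
  · exact NonUnitalStarAlgHom.norm_apply_le (p.toCompletion.comp (tensorInr A B)) b

theorem CStarSeminorm.bddAbove (x : A ⊗[ℂ] B) :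
    BddAbove (Set.range fun p : CStarSeminorm (A ⊗[ℂ] B) => p x) := by
  induction x using TensorProduct.induction_on with
  | zero => exact ⟨0, by rintro _ ⟨p, rfl⟩; simp⟩
  | tmul a b => exact ⟨‖a‖ * ‖b‖, by rintro _ ⟨p, rfl⟩; exact p.tmul_le a b⟩
  | add x y hx hy =>
    obtain ⟨s, hs⟩ := hx
    obtain ⟨t, ht⟩ := hy
    refine ⟨s + t, ?_⟩
    rintro _ ⟨p, rfl⟩
    exact (map_add_le_add p x y).trans (add_le_add (hs ⟨p, rfl⟩) (ht ⟨p, rfl⟩))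

instance {D : Type*} [NonUnitalRing D] [Star D] [Module ℂ D] : Inhabited (CStarSeminorm D) :=
  ⟨{ (0 : Seminorm ℂ D) with
      mul_le' := fun _ _ => (mul_zero (0 : ℝ)).ge
      star_mul_self' := fun _ => (mul_zero (0 : ℝ)).symm }⟩

variable (A B)

/-- The maximal C⋆-seminorm on the algebraic tensor product of two C⋆-algebras. -/
def maxSeminorm : CStarSeminorm (A ⊗[ℂ] B) where
  toFun x := ⨆ p : CStarSeminorm (A ⊗[ℂ] B), p x
  map_zero' := by simp
  add_le' x y := ciSup_le fun p => (map_add_le_add p x y).trans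
    (add_le_add (le_ciSup (CStarSeminorm.bddAbove x) p) (le_ciSup (CStarSeminorm.bddAbove y) p))
  neg' x := by simp
  smul' c x := by simp [map_smul_eq_mul, Real.mul_iSup_of_nonneg]
  mul_le' x y := ciSup_le fun p => (p.mul_le x y).trans
    (mul_le_mul (le_ciSup (CStarSeminorm.bddAbove x) p) (le_ciSup (CStarSeminorm.bddAbove y) p)
      (apply_nonneg p y) (Real.iSup_nonneg fun p => apply_nonneg p x))
  star_mul_self' x := by
    have h0 : 0 ≤ ⨆ p : CStarSeminorm (A ⊗[ℂ] B), p x := Real.iSup_nonneg fun p => apply_nonneg p x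
    apply le_antisymm
    · refine ciSup_le fun p => ?_
      rw [p.star_mul_self]
      have := le_ciSup (CStarSeminorm.bddAbove x) p
      exact mul_self_le_mul_self (apply_nonneg p x) this
    · have hs : ⨆ p : CStarSeminorm (A ⊗[ℂ] B), p x ≤
          √(⨆ p : CStarSeminorm (A ⊗[ℂ] B), p (star x * x)) := by
        refine ciSup_le fun p => Real.le_sqrt_of_sq_le ?_
        rw [sq, ← p.star_mul_self]
        exact le_ciSup (CStarSeminorm.bddAbove (star x * x)) p
      exact (mul_self_le_mul_self h0 hs).trans_eq (Real.mul_self_sqrt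
        (Real.iSup_nonneg fun p => apply_nonneg p _))

variable {A B}

theorem CStarSeminorm.le_max (p : CStarSeminorm (A ⊗[ℂ] B)) (x : A ⊗[ℂ] B) :
    p x ≤ maxSeminorm A B x := le_ciSup (CStarSeminorm.bddAbove x) p

theorem CStarAlgebra.exists_norm_sq_sub {C : Type*} [CStarAlgebra C] (c : C) : ∃ d : C,
    ((‖c‖ * ‖c‖ : ℝ) : ℂ) • (1 : C) - star c * c = star d * d := by
  let _ := CStarAlgebra.spectralOrder C
  have _ := CStarAlgebra.spectralOrderedRing C
  apply CStarAlgebra.exists_star_mul_self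
  rw [sub_nonneg]
  have := CStarAlgebra.star_mul_le_algebraMap_norm_sq (a := c)
  rw [Algebra.algebraMap_eq_smul_one, sq] at this
  exact this.trans_eq (Complex.coe_smul _ _).symm

theorem sosBounds_tmul_nonempty (x : A ⊗[ℂ] B) : (sosBounds x).Nonempty := by
  induction x using TensorProduct.induction_on with
  | zero =>
    refine ⟨1, one_pos, ?_⟩
    simpa using sos_star_mul_self (1 : A ⊗[ℂ] B)
  | tmul a b =>
    obtain ⟨c, hc⟩ := CStarAlgebra.exists_norm_sq_sub a
    obtain ⟨d, hd⟩ := CStarAlgebra.exists_norm_sq_sub b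
    refine ⟨‖a‖ * ‖b‖ + 1, by positivity, ?_⟩
    have h1 := sos_smul (sos_star_mul_self (c ⊗ₜ[ℂ] (1 : B))) (c := ‖b‖ * ‖b‖) (by positivity)
    have h2 := sos_star_mul_self (a ⊗ₜ[ℂ] d)
    have h3 := sos_smul (sos_star_mul_self (1 : A ⊗[ℂ] B)) (c := 2 * (‖a‖ * ‖b‖) + 1)
      (by positivity)
    have e1 : star (c ⊗ₜ[ℂ] (1 : B)) * c ⊗ₜ[ℂ] (1 : B) =
        ((‖a‖ * ‖a‖ : ℝ) : ℂ) • (1 : A ⊗[ℂ] B) - (star a * a) ⊗ₜ[ℂ] (1 : B) := by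
      rw [TensorProduct.star_tmul, Algebra.TensorProduct.tmul_mul_tmul, star_one, mul_one, ← hc,
        TensorProduct.sub_tmul, ← TensorProduct.smul_tmul', Algebra.TensorProduct.one_def]
    have e2 : star (a ⊗ₜ[ℂ] d) * a ⊗ₜ[ℂ] d = ((‖b‖ * ‖b‖ : ℝ) : ℂ) •
        (star a * a) ⊗ₜ[ℂ] (1 : B) - star (a ⊗ₜ[ℂ] b) * a ⊗ₜ[ℂ] b := by
      rw [TensorProduct.star_tmul, Algebra.TensorProduct.tmul_mul_tmul, ← hd,
        TensorProduct.tmul_sub, TensorProduct.tmul_smul, TensorProduct.star_tmul,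
        Algebra.TensorProduct.tmul_mul_tmul]
    rw [e1] at h1
    rw [e2] at h2
    rw [star_one, one_mul] at h3
    convert add_mem (add_mem h1 h2) h3 using 1
    push_cast
    module
  | add x y hx hy =>
    obtain ⟨s, hs⟩ := hx
    obtain ⟨t, ht⟩ := hy
    exact ⟨s + t, sosBounds_add hs ht⟩

variable (A B) in
/-- The (maximal) C⋆-tensor product: the completion of the algebraic tensor product in its largest
C⋆-seminorm. If one of the factors is nuclear, this is the only C⋆-tensor product. -/
def MaxTensor : Type _ := (maxSeminorm A B).Completion

instance : CStarAlgebra (MaxTensor A B) :=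
  inferInstanceAs (CStarAlgebra (maxSeminorm A B).Completion)

namespace MaxTensor

/-- The canonical map from the algebraic tensor product. -/
def ι : A ⊗[ℂ] B →⋆ₐ[ℂ] MaxTensor A B := (maxSeminorm A B).toCompletion

/-- The elementary tensors. -/
def tmul (a : A) (b : B) : MaxTensor A B := ι (a ⊗ₜ b)

variable {A' B' C E : Type*} [CStarAlgebra A'] [CStarAlgebra B'] [CStarAlgebra C] [CStarAlgebra E]

theorem tmul_eq (a : A) (b : B) : tmul a b = tmul a 1 * tmul 1 b := by
  have : a ⊗ₜ[ℂ] b = (a ⊗ₜ[ℂ] (1 : B)) * ((1 : A) ⊗ₜ[ℂ] b) := by simp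
  rw [tmul, this, map_mul]
  rfl

theorem continuous_tmul_left (b : B) : Continuous fun a : A => tmul a b := by
  rw [funext fun a : A => tmul_eq a b]
  have : Continuous fun a : A => tmul a (1 : B) :=
    map_continuous (ι.comp (tensorInl A B))
  fun_prop

theorem continuous_tmul_right (a : A) : Continuous fun b : B => tmul a b := by
  rw [funext fun b : B => tmul_eq a b]
  have : Continuous fun b : B => tmul (1 : A) b :=
    map_continuous (ι.comp (tensorInr A B))
  fun_prop

theorem ext_of_continuous {f g : MaxTensor A B →ₗ[ℂ] C} (hf : Continuous f) (hg : Continuous g)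
    (h : ∀ a b, f (tmul a b) = g (tmul a b)) : f = g := by
  have hd : f ∘ₗ ι.toAlgHom.toLinearMap = g ∘ₗ ι.toAlgHom.toLinearMap :=
    TensorProduct.ext' h
  exact DFunLike.coe_injective ((maxSeminorm A B).denseRange_toCompletion.equalizer hf hg
    (congrArg DFunLike.coe hd))

theorem ucp_ext {φ ψ : UCPMap (MaxTensor A B) C} (h : ∀ a b, φ (tmul a b) = ψ (tmul a b)) :
    φ = ψ := by
  have := ext_of_continuous (f := (φ : MaxTensor A B →ₗ[ℂ] C)) (g := (ψ : MaxTensor A B →ₗ[ℂ] C))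
    φ.continuous ψ.continuous h
  exact UCPMap.ext fun x => LinearMap.congr_fun this x

theorem ucp_ext₃ {φ ψ : UCPMap (MaxTensor (MaxTensor A B) C) E}
    (h : ∀ a b c, φ (tmul (tmul a b) c) = ψ (tmul (tmul a b) c)) : φ = ψ := by
  have hlin : ∀ c : C, ∃ l : MaxTensor A B →ₗ[ℂ] MaxTensor (MaxTensor A B) C,
      ∀ x, l x = tmul x c := fun c =>
    ⟨ι.toAlgHom.toLinearMap ∘ₗ (TensorProduct.mk ℂ _ _).flip c, fun _ => rfl⟩
  refine ucp_ext fun x c => ?_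
  obtain ⟨l, hl⟩ := hlin c
  have hcl : Continuous l := by
    rw [show (l : MaxTensor A B → _) = fun x => tmul x c from funext hl]
    exact continuous_tmul_left c
  have := ext_of_continuous (f := (φ : _ →ₗ[ℂ] E) ∘ₗ l) (g := (ψ : _ →ₗ[ℂ] E) ∘ₗ l)
    (φ.continuous.comp hcl) (ψ.continuous.comp hcl) (fun a b => by simpa [hl] using h a b c)
  simpa [hl] using LinearMap.congr_fun this x

theorem gram_map (φ : UCPMap A A') (ψ : UCPMap B B') :
    GramPreserving ((ι (A := A') (B := B')).toAlgHom.toLinearMap ∘ₗ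
      TensorProduct.map (φ : A →ₗ[ℂ] A') (ψ : B →ₗ[ℂ] B')) :=
  (φ.gramPreserving.tensor ψ.gramPreserving).starAlgHom_comp ι

theorem map_one_aux (φ : UCPMap A A') (ψ : UCPMap B B') :
    ((ι (A := A') (B := B')).toAlgHom.toLinearMap ∘ₗ
      TensorProduct.map (φ : A →ₗ[ℂ] A') (ψ : B →ₗ[ℂ] B')) 1 = 1 := by
  change ι (φ 1 ⊗ₜ[ℂ] ψ 1) = 1
  rw [map_one φ, map_one ψ]
  exact map_one ι

/-- The tensor product of two unital completely positive maps. -/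
def map (φ : UCPMap A A') (ψ : UCPMap B B') : UCPMap (MaxTensor A B) (MaxTensor A' B') :=
  (maxSeminorm A B).extendUCP _ (fun x =>
    (sosSeminorm_le_iff sosBounds_tmul_nonempty fun _ ht =>
      (gram_map φ ψ).norm_le (map_one_aux φ ψ) ht).trans (CStarSeminorm.le_max _ x))
    (gram_map φ ψ) (map_one_aux φ ψ)

@[simp] theorem map_tmul (φ : UCPMap A A') (ψ : UCPMap B B') (a : A) (b : B) :
    map φ ψ (tmul a b) = tmul (φ a) (ψ b) := CStarSeminorm.extend_coe _ _ _ _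

/-- Two commuting ⋆-homomorphisms into a C⋆-algebra induce one on the tensor product. -/
def lift (π : A →⋆ₐ[ℂ] C) (ρ : B →⋆ₐ[ℂ] C) (h : ∀ a b, Commute (π a) (ρ b)) :
    MaxTensor A B →⋆ₐ[ℂ] C :=
  let θ : A ⊗[ℂ] B →⋆ₐ[ℂ] C :=
    { Algebra.TensorProduct.lift π.toAlgHom ρ.toAlgHom h with
      map_star' := fun x => by
        induction x using TensorProduct.induction_on with
        | zero => simp
        | tmul a b =>
          have := (h (star a) (star b)).eq
          simpa [StarHomClass.map_star] using this
        | add x y hx hy => simp_all }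
  (maxSeminorm A B).extendHom θ fun x => (CStarSeminorm.ofStarAlgHom θ).le_max x

@[simp] theorem lift_tmul (π : A →⋆ₐ[ℂ] C) (ρ : B →⋆ₐ[ℂ] C) (h : ∀ a b, Commute (π a) (ρ b))
    (a : A) (b : B) : lift π ρ h (tmul a b) = π a * ρ b := CStarSeminorm.extendHom_coe _ _ _ _

end MaxTensor
end MaxTensor

namespace MaxTensor

variable {A B C : Type*} [CStarAlgebra A] [CStarAlgebra B] [CStarAlgebra C]

theorem commute_inl_inr (a : A) (b : B) :
    Commute (ι.comp (tensorInl A B) a) (ι.comp (tensorInr A B) b) := by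
  change ι (a ⊗ₜ[ℂ] (1 : B)) * ι ((1 : A) ⊗ₜ[ℂ] b) = ι ((1 : A) ⊗ₜ[ℂ] b) * ι (a ⊗ₜ[ℂ] (1 : B))
  rw [← map_mul, ← map_mul]
  simp

variable (A B) in
/-- `a ↦ a ⊗ 1`. -/
def inl : A →⋆ₐ[ℂ] MaxTensor A B := ι.comp (tensorInl A B)

variable (A B) in
/-- `b ↦ 1 ⊗ b`. -/
def inr : B →⋆ₐ[ℂ] MaxTensor A B := ι.comp (tensorInr A B)

theorem inl_apply (a : A) : inl A B a = tmul a 1 := rfl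
theorem inr_apply (b : B) : inr A B b = tmul 1 b := rfl

theorem tmul_mul_tmul (a a' : A) (b b' : B) :
    tmul a b * tmul a' b' = tmul (a * a') (b * b') := by
  simp only [tmul, ← map_mul, Algebra.TensorProduct.tmul_mul_tmul]

theorem commute_of_tmul {C : Type*} [CStarAlgebra C] (π : MaxTensor A B →⋆ₐ[ℂ] C) (c : C)
    (h : ∀ a b, Commute (π (tmul a b)) c) (x : MaxTensor A B) : Commute (π x) c := by
  have := ext_of_continuous
    (f := (LinearMap.mulRight ℂ c) ∘ₗ π.toAlgHom.toLinearMap)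
    (g := (LinearMap.mulLeft ℂ c) ∘ₗ π.toAlgHom.toLinearMap)
    ((map_continuous π).mul continuous_const) (continuous_const.mul (map_continuous π)) h
  exact LinearMap.congr_fun this x

variable (A B C) in
/-- The associator. -/
def assocHom : MaxTensor (MaxTensor A B) C →⋆ₐ[ℂ] MaxTensor A (MaxTensor B C) :=
  lift (lift (inl _ _) ((inr _ _).comp (inl _ _)) fun a b => by
      change tmul a 1 * tmul 1 _ = tmul 1 _ * tmul a 1
      simp [tmul_mul_tmul])
    ((inr _ _).comp (inr _ _)) fun x c => by
      refine commute_of_tmul _ _ (fun a b => ?_) x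
      rw [lift_tmul]
      change tmul a 1 * tmul 1 (tmul b 1) * tmul 1 (tmul 1 c) =
        tmul 1 (tmul 1 c) * (tmul a 1 * tmul 1 (tmul b 1))
      simp [tmul_mul_tmul]

variable (A B C) in
/-- The inverse of the associator. -/
def assocInv : MaxTensor A (MaxTensor B C) →⋆ₐ[ℂ] MaxTensor (MaxTensor A B) C :=
  lift ((inl _ _).comp (inl _ _)) (lift ((inl _ _).comp (inr _ _)) (inr _ _) fun b c => by
      change tmul _ 1 * tmul 1 c = tmul 1 c * tmul _ 1
      simp [tmul_mul_tmul])
    fun a x => by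
      refine (commute_of_tmul _ _ (fun b c => ?_) x).symm
      rw [lift_tmul]
      change tmul (tmul 1 b) 1 * tmul 1 c * tmul (tmul a 1) 1 =
        tmul (tmul a 1) 1 * (tmul (tmul 1 b) 1 * tmul 1 c)
      simp [tmul_mul_tmul]

@[simp] theorem assocHom_tmul (a : A) (b : B) (c : C) :
    assocHom A B C (tmul (tmul a b) c) = tmul a (tmul b c) := by
  rw [assocHom, lift_tmul, lift_tmul]
  change tmul a 1 * tmul 1 (tmul b 1) * tmul 1 (tmul 1 c) = _
  simp [tmul_mul_tmul]

@[simp] theorem assocInv_tmul (a : A) (b : B) (c : C) :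
    assocInv A B C (tmul a (tmul b c)) = tmul (tmul a b) c := by
  rw [assocInv, lift_tmul, lift_tmul]
  change tmul (tmul a 1) 1 * (tmul (tmul 1 b) 1 * tmul 1 c) = _
  simp [tmul_mul_tmul]

theorem ucp_ext₃' {E : Type*} [CStarAlgebra E] {φ ψ : UCPMap (MaxTensor A (MaxTensor B C)) E}
    (h : ∀ a b c, φ (tmul a (tmul b c)) = ψ (tmul a (tmul b c))) : φ = ψ := by
  have hlin : ∀ a : A, ∃ l : MaxTensor B C →ₗ[ℂ] MaxTensor A (MaxTensor B C),
      ∀ x, l x = tmul a x := fun a =>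
    ⟨ι.toAlgHom.toLinearMap ∘ₗ TensorProduct.mk ℂ _ _ a, fun _ => rfl⟩
  refine ucp_ext fun a x => ?_
  obtain ⟨l, hl⟩ := hlin a
  have hcl : Continuous l := by
    rw [show (l : MaxTensor B C → _) = fun x => tmul a x from funext hl]
    exact continuous_tmul_right a
  have := ext_of_continuous (f := (φ : _ →ₗ[ℂ] E) ∘ₗ l) (g := (ψ : _ →ₗ[ℂ] E) ∘ₗ l)
    (φ.continuous.comp hcl) (ψ.continuous.comp hcl) (fun b c => by simpa [hl] using h a b c)
  simpa [hl] using LinearMap.congr_fun this x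

theorem ucp_ext₄ {E F : Type*} [CStarAlgebra E] [CStarAlgebra F]
    {φ ψ : UCPMap (MaxTensor (MaxTensor (MaxTensor A B) C) F) E}
    (h : ∀ a b c d, φ (tmul (tmul (tmul a b) c) d) = ψ (tmul (tmul (tmul a b) c) d)) :
    φ = ψ := by
  refine ucp_ext₃ fun x c d => ?_
  have hcont : Continuous fun x : MaxTensor A B => tmul (tmul x c) d :=
    (continuous_tmul_left d).comp (continuous_tmul_left c)
  let l : MaxTensor A B →ₗ[ℂ] MaxTensor (MaxTensor (MaxTensor A B) C) F :=
    (ι.toAlgHom.toLinearMap ∘ₗ (TensorProduct.mk ℂ _ _).flip d) ∘ₗ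
    (ι.toAlgHom.toLinearMap ∘ₗ (TensorProduct.mk ℂ _ _).flip c)
  have := ext_of_continuous (f := (φ : _ →ₗ[ℂ] E) ∘ₗ l) (g := (ψ : _ →ₗ[ℂ] E) ∘ₗ l)
    (φ.continuous.comp hcont) (ψ.continuous.comp hcont) (fun a b => h a b c d)
  exact LinearMap.congr_fun this x

/-- The scalars, as a subalgebra. -/
def unitHom (A : Type*) [CStarAlgebra A] : ℂ →⋆ₐ[ℂ] A where
  __ := Algebra.ofId ℂ A
  map_star' c := by
    change algebraMap ℂ A (star c) = star (algebraMap ℂ A c)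
    exact algebraMap_star_comm c

theorem unitHom_apply (c : ℂ) : unitHom A c = c • (1 : A) := Algebra.algebraMap_eq_smul_one c

variable (A) in
/-- The left unitor. -/
def lidHom : MaxTensor ℂ A →⋆ₐ[ℂ] A :=
  lift (unitHom A) (StarAlgHom.id ℂ A) fun c a => by
    rw [unitHom_apply]; exact (Commute.one_left _).smul_left c

variable (A) in
/-- The right unitor. -/
def ridHom : MaxTensor A ℂ →⋆ₐ[ℂ] A :=
  lift (StarAlgHom.id ℂ A) (unitHom A) fun a c => by
    rw [unitHom_apply]; exact (Commute.one_right _).smul_right c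

@[simp] theorem lidHom_tmul (c : ℂ) (a : A) : lidHom A (tmul c a) = c • a := by
  rw [lidHom, lift_tmul, unitHom_apply]; simp

@[simp] theorem ridHom_tmul (a : A) (c : ℂ) : ridHom A (tmul a c) = c • a := by
  rw [ridHom, lift_tmul, unitHom_apply]; simp

theorem tmul_smul (c : ℂ) (a : A) (b : B) : tmul a (c • b) = c • tmul a b := by
  simp [tmul]

theorem smul_tmul (c : ℂ) (a : A) (b : B) : tmul (c • a) b = c • tmul a b := by
  simp only [tmul, ← TensorProduct.smul_tmul', map_smul]

end MaxTensor

namespace MaxTensor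

theorem assoc_naturality {A B C A' B' C' : Type*} [CStarAlgebra A] [CStarAlgebra B]
    [CStarAlgebra C] [CStarAlgebra A'] [CStarAlgebra B'] [CStarAlgebra C']
    (f : UCPMap A A') (g : UCPMap B B') (h : UCPMap C C') :
    (UCPMap.ofStarAlgHom (assocHom A' B' C')).comp (map (map f g) h) =
      (map f (map g h)).comp (UCPMap.ofStarAlgHom (assocHom A B C)) :=
  ucp_ext₃ fun a b c => by simp

theorem assoc_pentagon (A B C D : Type*) [CStarAlgebra A] [CStarAlgebra B]
    [CStarAlgebra C] [CStarAlgebra D] :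
    ((map (UCPMap.id A) (UCPMap.ofStarAlgHom (assocHom B C D))).comp
      (UCPMap.ofStarAlgHom (assocHom A (MaxTensor B C) D))).comp
      (map (UCPMap.ofStarAlgHom (assocHom A B C)) (UCPMap.id D)) =
    (UCPMap.ofStarAlgHom (assocHom A B (MaxTensor C D))).comp
      (UCPMap.ofStarAlgHom (assocHom (MaxTensor A B) C D)) :=
  ucp_ext₄ fun a b c d => by simp

theorem lid_naturality {A B : Type*} [CStarAlgebra A] [CStarAlgebra B] (f : UCPMap A B) :
    (UCPMap.ofStarAlgHom (lidHom B)).comp (map (UCPMap.id ℂ) f) =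
      f.comp (UCPMap.ofStarAlgHom (lidHom A)) :=
  ucp_ext fun c a => by simp

theorem rid_naturality {A B : Type*} [CStarAlgebra A] [CStarAlgebra B] (f : UCPMap A B) :
    (UCPMap.ofStarAlgHom (ridHom B)).comp (map f (UCPMap.id ℂ)) =
      f.comp (UCPMap.ofStarAlgHom (ridHom A)) :=
  ucp_ext fun a c => by simp

theorem assoc_triangle (A B : Type*) [CStarAlgebra A] [CStarAlgebra B] :
    (map (UCPMap.id A) (UCPMap.ofStarAlgHom (lidHom B))).comp
      (UCPMap.ofStarAlgHom (assocHom A ℂ B)) =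
      map (UCPMap.ofStarAlgHom (ridHom A)) (UCPMap.id B) :=
  ucp_ext₃ fun a c b => by simp [tmul_smul, smul_tmul]

end MaxTensor

open CategoryTheory in
/-- The category of unital C⋆-algebras and unital completely positive maps. -/
structure CStarUCP where
  /-- the underlying type -/
  carrier : Type
  [str : CStarAlgebra carrier]

namespace CStarUCP

open CategoryTheory

attribute [instance] CStarUCP.str

instance : CoeSort CStarUCP Type := ⟨CStarUCP.carrier⟩

instance : Category CStarUCP where
  Hom A B := UCPMap A B
  id A := UCPMap.id A
  comp f g := g.comp f

instance {A B : CStarUCP} : FunLike (A ⟶ B) A B := inferInstanceAs (FunLike (UCPMap A B) A B)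

@[simp] theorem comp_apply {A B C : CStarUCP} (f : A ⟶ B) (g : B ⟶ C) (x : A) :
    (f ≫ g) x = g (f x) := rfl

@[simp] theorem id_apply {A : CStarUCP} (x : A) : (𝟙 A : A ⟶ A) x = x := rfl

/-- A ⋆-isomorphism is an isomorphism of the category. -/
def isoOfStarAlgHom {A B : CStarUCP} (f : A →⋆ₐ[ℂ] B) (g : B →⋆ₐ[ℂ] A)
    (h₁ : (UCPMap.ofStarAlgHom g).comp (UCPMap.ofStarAlgHom f) = UCPMap.id A)
    (h₂ : (UCPMap.ofStarAlgHom f).comp (UCPMap.ofStarAlgHom g) = UCPMap.id B) : A ≅ B where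
  hom := UCPMap.ofStarAlgHom f
  inv := UCPMap.ofStarAlgHom g
  hom_inv_id := h₁
  inv_hom_id := h₂

open MaxTensor

instance : MonoidalCategoryStruct CStarUCP where
  tensorObj A B := ⟨MaxTensor A B⟩
  tensorHom f g := MaxTensor.map f g
  whiskerLeft A _ _ g := MaxTensor.map (UCPMap.id A) g
  whiskerRight f B := MaxTensor.map f (UCPMap.id B)
  tensorUnit := ⟨ℂ⟩
  associator A B C := isoOfStarAlgHom (A := ⟨_⟩) (B := ⟨_⟩) (assocHom A B C) (assocInv A B C)
    (ucp_ext₃ fun a b c => by simp) (ucp_ext₃' fun a b c => by simp)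
  leftUnitor A := isoOfStarAlgHom (A := ⟨_⟩) (lidHom A) (inr ℂ A)
    (ucp_ext fun c a => by simp [inr_apply, ← smul_tmul])
    (UCPMap.ext fun a => by simp [inr_apply])
  rightUnitor A := isoOfStarAlgHom (A := ⟨_⟩) (ridHom A) (inl A ℂ)
    (ucp_ext fun a c => by simp [inl_apply, ← tmul_smul])
    (UCPMap.ext fun a => by simp [inl_apply])

instance : MonoidalCategory CStarUCP := MonoidalCategory.ofTensorHom
  (id_tensorHom_id := fun A B => ucp_ext fun a b => map_tmul _ _ a b)
  (id_tensorHom := fun _ _ _ _ => rfl)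
  (tensorHom_id := fun _ _ => rfl)
  (tensorHom_comp_tensorHom := fun f₁ f₂ g₁ g₂ => ucp_ext fun a b => by
    change map _ _ (map _ _ (tmul a b)) = map _ _ (tmul a b)
    rw [map_tmul, map_tmul, map_tmul]
    rfl)
  (associator_naturality := fun f₁ f₂ f₃ => assoc_naturality f₁ f₂ f₃)
  (leftUnitor_naturality := fun f => lid_naturality f)
  (rightUnitor_naturality := fun f => rid_naturality f)
  (pentagon := fun A B C D => assoc_pentagon A B C D)
  (triangle := fun A B => assoc_triangle A B)

end CStarUCP

/-- A C⋆-algebra `A` is nuclear if for every C⋆-algebra `B` there is at most one C⋆-norm on the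
algebraic tensor product of `A` and `B`. -/
def IsNuclear.{v, u} (A : Type u) [CStarAlgebra A] : Prop :=
  ∀ (B : Type v) [NonUnitalCStarAlgebra B] (p q : CStarSeminorm (A ⊗[ℂ] B)),
    (∀ x, p x = 0 → x = 0) → (∀ x, q x = 0 → x = 0) → p = q

/-- The category of nonzero finite-dimensional complex Hilbert spaces and linear isometries. -/
structure HilbFin where
  /-- the underlying space -/
  carrier : Type
  [normed : NormedAddCommGroup carrier]
  [inner : InnerProductSpace ℂ carrier]
  [finite : FiniteDimensional ℂ carrier]
  [nonzero : Nontrivial carrier]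

namespace HilbFin

open CategoryTheory

attribute [instance] HilbFin.normed HilbFin.inner HilbFin.finite HilbFin.nonzero

instance : CoeSort HilbFin Type := ⟨HilbFin.carrier⟩

instance : Category HilbFin where
  Hom H K := H →ₗᵢ[ℂ] K
  id H := LinearIsometry.id
  comp f g := g.comp f

/-- Isometric isomorphisms are isomorphisms of the category. -/
def isoOfEquiv {H K : HilbFin} (e : H ≃ₗᵢ[ℂ] K) : H ≅ K where
  hom := e.toLinearIsometry
  inv := e.symm.toLinearIsometry
  hom_inv_id := LinearIsometry.ext fun x => e.symm_apply_apply x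
  inv_hom_id := LinearIsometry.ext fun x => e.apply_symm_apply x

theorem nontrivial_tensor (H K : HilbFin) : Nontrivial (H ⊗[ℂ] K) := by
  obtain ⟨x, hx⟩ := exists_ne (0 : H)
  obtain ⟨y, hy⟩ := exists_ne (0 : K)
  refine ⟨x ⊗ₜ y, 0, fun h => ?_⟩
  have := TensorProduct.norm_tmul (𝕜 := ℂ) x y
  rw [h, norm_zero] at this
  simp_all

instance : MonoidalCategoryStruct HilbFin where
  tensorObj H K := { carrier := H ⊗[ℂ] K, nonzero := nontrivial_tensor H K }
  tensorHom f g := TensorProduct.mapIsometry f g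
  whiskerLeft _ _ _ g := TensorProduct.mapIsometry LinearIsometry.id g
  whiskerRight f _ := TensorProduct.mapIsometry f LinearIsometry.id
  tensorUnit := { carrier := ℂ }
  associator H K L := isoOfEquiv (H := ⟨_⟩) (K := ⟨_⟩) (TensorProduct.assocIsometry ℂ H K L)
  leftUnitor H := isoOfEquiv (H := ⟨_⟩) (TensorProduct.lidIsometry ℂ H)
  rightUnitor H := isoOfEquiv (H := ⟨_⟩) (TensorProduct.ridIsometry ℂ H)

section aux

variable {H K L M H' K' L' : Type*} [NormedAddCommGroup H] [InnerProductSpace ℂ H]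
  [NormedAddCommGroup K] [InnerProductSpace ℂ K] [NormedAddCommGroup L] [InnerProductSpace ℂ L]
  [NormedAddCommGroup M] [InnerProductSpace ℂ M]
  [NormedAddCommGroup H'] [InnerProductSpace ℂ H'] [NormedAddCommGroup K']
  [InnerProductSpace ℂ K'] [NormedAddCommGroup L'] [InnerProductSpace ℂ L']

theorem isometry_ext {f g : H →ₗᵢ[ℂ] K} (h : f.toLinearMap = g.toLinearMap) : f = g :=
  LinearIsometry.toLinearMap_injective h

theorem map_comp_map (f : H →ₗᵢ[ℂ] H') (g : K →ₗᵢ[ℂ] K') (f' : H' →ₗᵢ[ℂ] L)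
    (g' : K' →ₗᵢ[ℂ] M) :
    (TensorProduct.mapIsometry f' g').comp (TensorProduct.mapIsometry f g) =
      TensorProduct.mapIsometry (f'.comp f) (g'.comp g) :=
  isometry_ext (TensorProduct.ext' fun _ _ => rfl)

theorem assoc_naturality (f : H →ₗᵢ[ℂ] H') (g : K →ₗᵢ[ℂ] K') (h : L →ₗᵢ[ℂ] L') :
    (TensorProduct.assocIsometry ℂ H' K' L').toLinearIsometry.comp
        (TensorProduct.mapIsometry (TensorProduct.mapIsometry f g) h) =
      (TensorProduct.mapIsometry f (TensorProduct.mapIsometry g h)).comp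
        (TensorProduct.assocIsometry ℂ H K L).toLinearIsometry :=
  isometry_ext (TensorProduct.ext_threefold fun _ _ _ => rfl)

theorem lid_naturality (f : H →ₗᵢ[ℂ] K) :
    (TensorProduct.lidIsometry ℂ K).toLinearIsometry.comp
        (TensorProduct.mapIsometry LinearIsometry.id f) =
      f.comp (TensorProduct.lidIsometry ℂ H).toLinearIsometry :=
  isometry_ext (TensorProduct.ext' fun c x => (f.map_smul c x).symm)

theorem rid_naturality (f : H →ₗᵢ[ℂ] K) :
    (TensorProduct.ridIsometry ℂ K).toLinearIsometry.comp
        (TensorProduct.mapIsometry f LinearIsometry.id) =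
      f.comp (TensorProduct.ridIsometry ℂ H).toLinearIsometry :=
  isometry_ext (TensorProduct.ext' fun x c => (f.map_smul c x).symm)

variable (H K L M) in
theorem assoc_pentagon :
    ((TensorProduct.mapIsometry LinearIsometry.id
        (TensorProduct.assocIsometry ℂ K L M).toLinearIsometry).comp
      (TensorProduct.assocIsometry ℂ H (K ⊗[ℂ] L) M).toLinearIsometry).comp
      (TensorProduct.mapIsometry (TensorProduct.assocIsometry ℂ H K L).toLinearIsometry
        LinearIsometry.id) =
      (TensorProduct.assocIsometry ℂ H K (L ⊗[ℂ] M)).toLinearIsometry.comp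
        (TensorProduct.assocIsometry ℂ (H ⊗[ℂ] K) L M).toLinearIsometry :=
  isometry_ext (TensorProduct.ext_fourfold fun _ _ _ _ => rfl)

variable (H K) in
theorem assoc_triangle :
    (TensorProduct.mapIsometry LinearIsometry.id
        (TensorProduct.lidIsometry ℂ K).toLinearIsometry).comp
      (TensorProduct.assocIsometry ℂ H ℂ K).toLinearIsometry =
      TensorProduct.mapIsometry (TensorProduct.ridIsometry ℂ H).toLinearIsometry
        LinearIsometry.id :=
  isometry_ext (TensorProduct.ext_threefold fun x c y => (TensorProduct.smul_tmul c x y).symm)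

end aux

section axioms

open MonoidalCategoryStruct

theorem triangle' (H K : HilbFin) :
    (associator H (tensorUnit HilbFin) K).hom ≫ tensorHom (𝟙 H) (leftUnitor K).hom =
      tensorHom (rightUnitor H).hom (𝟙 K) :=
  assoc_triangle H K

theorem pentagon' (H K L M : HilbFin) :
    tensorHom (associator H K L).hom (𝟙 M) ≫ (associator H (tensorObj K L) M).hom ≫
        tensorHom (𝟙 H) (associator K L M).hom =
      (associator (tensorObj H K) L M).hom ≫ (associator H K (tensorObj L M)).hom :=
  assoc_pentagon H K L M

theorem naturality' {H K L H' K' L' : HilbFin} (f : H ⟶ H') (g : K ⟶ K') (h : L ⟶ L') :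
    tensorHom (tensorHom f g) h ≫ (associator H' K' L').hom =
      (associator H K L).hom ≫ tensorHom f (tensorHom g h) :=
  assoc_naturality (H := H) (K := K) (L := L) (H' := H') (K' := K') (L' := L') f g h

theorem id_tensor_id (H K : HilbFin) : tensorHom (𝟙 H) (𝟙 K) = 𝟙 (tensorObj H K) :=
  TensorProduct.mapIsometry_id_id

theorem comp' {H K L H' K' L' : HilbFin} (f : H ⟶ K) (f' : H' ⟶ K') (g : K ⟶ L) (g' : K' ⟶ L') :
    tensorHom f f' ≫ tensorHom g g' = tensorHom (f ≫ g) (f' ≫ g') :=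
  map_comp_map (H := H) (H' := K) (L := L) (K := H') (K' := K') (M := L') f f' g g'

theorem lid' {H K : HilbFin} (f : H ⟶ K) :
    tensorHom (𝟙 (tensorUnit HilbFin)) f ≫ (leftUnitor K).hom = (leftUnitor H).hom ≫ f :=
  lid_naturality (H := H) (K := K) f

theorem rid' {H K : HilbFin} (f : H ⟶ K) :
    tensorHom f (𝟙 (tensorUnit HilbFin)) ≫ (rightUnitor K).hom = (rightUnitor H).hom ≫ f :=
  rid_naturality (H := H) (K := K) f

end axioms

instance : MonoidalCategory HilbFin := MonoidalCategory.ofTensorHom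
  (id_tensorHom_id := id_tensor_id)
  (id_tensorHom := fun _ _ _ _ => rfl)
  (tensorHom_id := fun _ _ => rfl)
  (tensorHom_comp_tensorHom := comp')
  (associator_naturality := naturality')
  (leftUnitor_naturality := lid')
  (rightUnitor_naturality := rid')
  (pentagon := pentagon')
  (triangle := triangle')

end HilbFin

/-- The tensor product of copies of the space `H`, one for each element of `ι`; for finite `ι`, it
carries the inner product with `⟪⨂ x, ⨂ y⟫ = ∏ᵢ ⟪xᵢ, yᵢ⟫`. -/
def ManyBody (ι H : Type*) [NormedAddCommGroup H] [InnerProductSpace ℂ H] : Type _ :=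
  ⨂[ℂ] _ : ι, H

namespace ManyBody

section Basic

variable (ι : Type*) (H : Type*) [NormedAddCommGroup H] [InnerProductSpace ℂ H]

instance : AddCommGroup (ManyBody ι H) := inferInstanceAs (AddCommGroup (⨂[ℂ] _ : ι, H))
instance : Module ℂ (ManyBody ι H) := inferInstanceAs (Module ℂ (⨂[ℂ] _ : ι, H))

variable {ι H}

/-- The elementary tensors. -/
def tprod (x : ι → H) : ManyBody ι H := PiTensorProduct.tprod ℂ x

theorem linearMap_ext {V : Type*} [AddCommGroup V] [Module ℂ V] {f g : ManyBody ι H →ₗ[ℂ] V}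
    (h : ∀ x, f (tprod x) = g (tprod x)) : f = g :=
  PiTensorProduct.ext (R := ℂ) (s := fun _ : ι => H) (MultilinearMap.ext h)

end Basic

section Inner

variable (ι : Type*) [Fintype ι] (H : Type*) [NormedAddCommGroup H] [InnerProductSpace ℂ H]
  [FiniteDimensional ℂ H]

/-- The basis of elementary tensors of vectors of a fixed orthonormal basis of `H`. -/
def basis : Module.Basis (ι → Fin (Module.finrank ℂ H)) ℂ (ManyBody ι H) :=
  Basis.piTensorProduct fun _ : ι => (stdOrthonormalBasis ℂ H).toBasis

instance : FiniteDimensional ℂ (ManyBody ι H) := (basis ι H).finiteDimensional_of_finite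

open Classical in
/-- The inner product of many-body states (see `ManyBody.inner_tprod`). -/
abbrev innerCore : InnerProductSpace.Core ℂ (ManyBody ι H) where
  inner x y := ∑ k, star ((basis ι H).repr x k) * (basis ι H).repr y k
  conj_inner_symm x y := by simp [mul_comm]
  re_inner_nonneg x := by
    rw [map_sum]
    refine Finset.sum_nonneg fun k _ => ?_
    simp [Complex.conj_mul', ← Complex.ofReal_pow]
  add_left x y z := by simp [add_mul, Finset.sum_add_distrib]
  smul_left x y r := by simp [Finset.mul_sum, mul_assoc]
  definite x hx := by
    have h0 : ∑ k, ‖(basis ι H).repr x k‖ ^ 2 = 0 := by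
      have : ((∑ k, ‖(basis ι H).repr x k‖ ^ 2 : ℝ) : ℂ) = 0 := by
        rw [← hx]
        simp [Complex.conj_mul']
      exact_mod_cast this
    rw [Finset.sum_eq_zero_iff_of_nonneg fun _ _ => by positivity] at h0
    apply (basis ι H).repr.injective
    ext k
    simpa using h0 k (Finset.mem_univ k)

instance : NormedAddCommGroup (ManyBody ι H) :=
  @InnerProductSpace.Core.toNormedAddCommGroup ℂ _ _ _ _ (innerCore ι H)

instance : InnerProductSpace ℂ (ManyBody ι H) := .ofCore _

variable {ι H}

theorem inner_tprod (x y : ι → H) :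
    inner ℂ (tprod x) (tprod y) = ∏ i, inner ℂ (x i) (y i) := by
  classical
  change ∑ k, star ((basis ι H).repr (tprod x) k) * (basis ι H).repr (tprod y) k = _
  have h : ∀ (x : ι → H) k, (basis ι H).repr (tprod x) k =
      ∏ i, (stdOrthonormalBasis ℂ H).repr (x i) (k i) := fun x k =>
    (Basis.piTensorProduct_repr_tprod_apply _ x k).trans (by simp)
  simp only [h, star_prod, ← Finset.prod_mul_distrib]
  refine (Fintype.prod_sum fun (i : ι) j => star ((stdOrthonormalBasis ℂ H).repr (x i) j) *
    (stdOrthonormalBasis ℂ H).repr (y i) j).symm.trans ?_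
  refine Finset.prod_congr rfl fun i _ => ?_
  rw [← (stdOrthonormalBasis ℂ H).sum_inner_mul_inner]
  refine Finset.sum_congr rfl fun j _ => ?_
  simp [OrthonormalBasis.repr_apply_apply]

theorem ext_inner {x y : ManyBody ι H} (h : ∀ z, inner ℂ (tprod z) x = inner ℂ (tprod z) y) :
    x = y := by
  have : innerₛₗ ℂ (x - y) = 0 := linearMap_ext fun z => by
    rw [innerₛₗ_apply_apply, ← inner_conj_symm, inner_sub_right, h z, sub_self]
    simp
  have := LinearMap.congr_fun this (x - y)
  rw [innerₛₗ_apply_apply, LinearMap.zero_apply, inner_self_eq_zero] at this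
  exact sub_eq_zero.mp this

end Inner

section Map

variable {ι : Type*} [Fintype ι] {H K L : Type*} [NormedAddCommGroup H] [InnerProductSpace ℂ H]
  [FiniteDimensional ℂ H] [NormedAddCommGroup K] [InnerProductSpace ℂ K] [FiniteDimensional ℂ K]
  [NormedAddCommGroup L] [InnerProductSpace ℂ L] [FiniteDimensional ℂ L]

instance : CompleteSpace (ManyBody ι H) := FiniteDimensional.complete ℂ _

/-- The operator `⨂ᵢ aᵢ`. -/
def map (a : ι → (H →L[ℂ] K)) : ManyBody ι H →L[ℂ] ManyBody ι K :=
  LinearMap.toContinuousLinearMap (E := ManyBody ι H) (F' := ManyBody ι K)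
    (PiTensorProduct.map (R := ℂ) (s := fun _ : ι => H) (t := fun _ : ι => K)
      fun i => (a i).toLinearMap)

@[simp] theorem map_tprod (a : ι → (H →L[ℂ] K)) (x : ι → H) :
    map a (tprod x) = tprod fun i => a i (x i) :=
  PiTensorProduct.map_tprod (R := ℂ) (s := fun _ : ι => H) (t := fun _ : ι => K) _ x

theorem clm_ext {V : Type*} [NormedAddCommGroup V] [NormedSpace ℂ V] {f g : ManyBody ι H →L[ℂ] V}
    (h : ∀ x, f (tprod x) = g (tprod x)) : f = g :=
  ContinuousLinearMap.coe_injective (linearMap_ext h)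

theorem map_comp (a : ι → (H →L[ℂ] K)) (b : ι → (K →L[ℂ] L)) :
    (map b).comp (map a) = map fun i => (b i).comp (a i) := clm_ext fun x => by simp

theorem map_id : map (fun _ : ι => ContinuousLinearMap.id ℂ H) = ContinuousLinearMap.id ℂ _ :=
  clm_ext fun x => by simp

open ContinuousLinearMap in
theorem adjoint_map (a : ι → (H →L[ℂ] K)) :
    adjoint (map a) = map fun i => adjoint (a i) :=
  clm_ext fun y => ext_inner fun x => by
    rw [adjoint_inner_right, map_tprod, map_tprod, inner_tprod, inner_tprod]
    simp only [adjoint_inner_right]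

end Map
end ManyBody

namespace ManyBody

section Split

variable {ι κ τ : Type*} [Fintype ι] [Fintype κ] [Fintype τ] {H K : Type*} [NormedAddCommGroup H]
  [InnerProductSpace ℂ H] [FiniteDimensional ℂ H] [NormedAddCommGroup K] [InnerProductSpace ℂ K]
  [FiniteDimensional ℂ K]

/-- The identification of `H_ι ⊗ H_κ` with `H_τ`, when `τ` is the disjoint union of `ι` and `κ`,
as a linear equivalence. -/
def splitLin (e : ι ⊕ κ ≃ τ) : ManyBody ι H ⊗[ℂ] ManyBody κ H ≃ₗ[ℂ] ManyBody τ H :=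
  (PiTensorProduct.tmulEquiv ℂ H : (⨂[ℂ] _ : ι, H) ⊗[ℂ] (⨂[ℂ] _ : κ, H) ≃ₗ[ℂ] _).trans
    (PiTensorProduct.reindex ℂ (fun _ : ι ⊕ κ => H) e)

theorem splitLin_tprod (e : ι ⊕ κ ≃ τ) (x : ι → H) (y : κ → H) :
    splitLin e (tprod x ⊗ₜ tprod y) = tprod fun t => Sum.elim x y (e.symm t) := by
  refine (congrArg (PiTensorProduct.reindex ℂ (fun _ : ι ⊕ κ => H) e)
    (PiTensorProduct.tmulEquiv_apply ℂ H x y)).trans ?_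
  exact PiTensorProduct.reindex_tprod e _

theorem tensor_ext {V : Type*} [AddCommGroup V] [Module ℂ V]
    {f g : ManyBody ι H ⊗[ℂ] ManyBody κ K →ₗ[ℂ] V}
    (h : ∀ x y, f (tprod x ⊗ₜ tprod y) = g (tprod x ⊗ₜ tprod y)) : f = g :=
  TensorProduct.ext (linearMap_ext fun x => linearMap_ext fun y => h x y)

theorem inner_splitLin (e : ι ⊕ κ ≃ τ) (u v : ManyBody ι H ⊗[ℂ] ManyBody κ H) :
    inner ℂ (splitLin e u) (splitLin e v) = inner ℂ u v := by
  have hv : ∀ x y, (innerₛₗ ℂ (splitLin e (tprod x ⊗ₜ[ℂ] tprod y))) ∘ₗ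
      (splitLin (H := H) e).toLinearMap = innerₛₗ ℂ (tprod x ⊗ₜ[ℂ] tprod y) := fun x y =>
    tensor_ext fun x' y' => by
      simp only [LinearMap.comp_apply, innerₛₗ_apply_apply, LinearEquiv.coe_coe, splitLin_tprod,
        inner_tprod, TensorProduct.inner_tmul]
      rw [← e.prod_comp, Fintype.prod_sum_type]
      simp
  have hu : ∀ v, (innerₛₗ ℂ (splitLin e v)) ∘ₗ
      (splitLin (H := H) e).toLinearMap = innerₛₗ ℂ v := fun v =>
    tensor_ext fun x y => by
      have := LinearMap.congr_fun (hv x y) v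
      simp only [LinearMap.comp_apply, innerₛₗ_apply_apply, LinearEquiv.coe_coe] at this ⊢
      rw [← inner_conj_symm, this, inner_conj_symm]
  exact LinearMap.congr_fun (hu u) v

/-- The identification of `H_ι ⊗ H_κ` with `H_τ`, when `τ` is the disjoint union of `ι` and `κ`. -/
def split (e : ι ⊕ κ ≃ τ) : ManyBody ι H ⊗[ℂ] ManyBody κ H ≃ₗᵢ[ℂ] ManyBody τ H :=
  LinearEquiv.isometryOfInner (E := ManyBody ι H ⊗[ℂ] ManyBody κ H) (E' := ManyBody τ H)
    (splitLin e) (inner_splitLin e)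

theorem split_tprod (e : ι ⊕ κ ≃ τ) (x : ι → H) (y : κ → H) :
    split e (tprod x ⊗ₜ tprod y) = tprod fun t => Sum.elim x y (e.symm t) := splitLin_tprod e x y

theorem split_symm_tprod (e : ι ⊕ κ ≃ τ) (x : τ → H) :
    (split e).symm (tprod x) = (tprod fun i => x (e (.inl i))) ⊗ₜ tprod fun i => x (e (.inr i)) := by
  rw [LinearIsometryEquiv.symm_apply_eq, split_tprod]
  congr 1
  funext t
  obtain ⟨s, rfl⟩ := e.surjective t
  rcases s with s | s <;> simp

variable (κ) in
/-- `A ↦ A ⊗ 1`. -/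
def rTensorHom : (ManyBody ι H →L[ℂ] ManyBody ι H) →⋆ₐ[ℂ]
    (ManyBody ι H ⊗[ℂ] ManyBody κ H →L[ℂ] ManyBody ι H ⊗[ℂ] ManyBody κ H) where
  toFun A := A.rTensor (ManyBody κ H)
  map_one' := ContinuousLinearMap.rTensor_one _
  map_mul' A B := ContinuousLinearMap.rTensor_mul ..
  map_zero' := ContinuousLinearMap.rTensor_zero _
  map_add' A B := ContinuousLinearMap.rTensor_add ..
  commutes' c := by
    rw [Algebra.algebraMap_eq_smul_one, Algebra.algebraMap_eq_smul_one,
      ContinuousLinearMap.rTensor_smul, ContinuousLinearMap.rTensor_one]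
  map_star' A := (ContinuousLinearMap.adjoint_rTensor ..).symm

/-- The embedding `A ↦ A ⊗ 1` of the operators on `H_ι` into those on `H_τ`, when `τ` is the
disjoint union of `ι` and `κ`. -/
def embed (e : ι ⊕ κ ≃ τ) :
    (ManyBody ι H →L[ℂ] ManyBody ι H) →⋆ₐ[ℂ] (ManyBody τ H →L[ℂ] ManyBody τ H) :=
  ((split (H := H) e).conjStarAlgEquiv : _ →⋆ₐ[ℂ] _).comp (rTensorHom κ)

theorem embed_apply_tprod (e : ι ⊕ κ ≃ τ) (A : ManyBody ι H →L[ℂ] ManyBody ι H) (x : τ → H) :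
    embed e A (tprod x) =
      split e (A (tprod fun i => x (e (.inl i))) ⊗ₜ tprod fun i => x (e (.inr i))) := by
  change split e (A.rTensor (ManyBody κ H) ((split e).symm (tprod x))) = _
  rw [split_symm_tprod]
  rfl

theorem norm_split (e : ι ⊕ κ ≃ τ) (u : ManyBody ι H) (v : ManyBody κ H) :
    ‖split e (u ⊗ₜ v)‖ = ‖u‖ * ‖v‖ := by
  rw [LinearIsometryEquiv.norm_map, TensorProduct.norm_tmul]

theorem norm_tprod (x : ι → H) : ‖tprod x‖ = ∏ i, ‖x i‖ := by
  have h : ‖tprod x‖ ^ 2 = (∏ i, ‖x i‖) ^ 2 := by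
    have := inner_tprod x x
    simp only [inner_self_eq_norm_sq_to_K] at this
    rw [← Finset.prod_pow]
    exact_mod_cast this
  exact (pow_left_inj₀ (norm_nonneg _) (by positivity) two_ne_zero).mp h

theorem embed_injective [Nontrivial H] (e : ι ⊕ κ ≃ τ) :
    Function.Injective (embed (H := H) e) := by
  refine (injective_iff_map_eq_zero _).mpr fun A hA => clm_ext fun x => ?_
  obtain ⟨y, hy⟩ := exists_ne (0 : H)
  have h := embed_apply_tprod e A (fun t => Sum.elim x (fun _ => y) (e.symm t))
  simp only [hA, zero_apply, Equiv.symm_apply_apply, Sum.elim_inl,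
    Sum.elim_inr] at h
  have h2 := norm_split e (A (tprod x)) (tprod fun _ => y)
  rw [← h, norm_zero, norm_tprod] at h2
  have h3 : ∏ _i : κ, ‖y‖ ≠ 0 := Finset.prod_ne_zero_iff.mpr fun _ _ => norm_ne_zero_iff.mpr hy
  have := (mul_eq_zero.mp h2.symm).resolve_right h3
  simpa using this

theorem norm_embed [Nontrivial H] (e : ι ⊕ κ ≃ τ) (A : ManyBody ι H →L[ℂ] ManyBody ι H) :
    ‖embed e A‖ = ‖A‖ := NonUnitalStarAlgHom.norm_map _ (embed_injective e) A

theorem map_split (e : ι ⊕ κ ≃ τ) (a : H →L[ℂ] K) (u : ManyBody ι H) (v : ManyBody κ H) :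
    map (fun _ => a) (split e (u ⊗ₜ v)) =
      split e (map (fun _ => a) u ⊗ₜ map (fun _ => a) v) := by
  have : (map fun _ : τ => a).toLinearMap ∘ₗ (split (H := H) e).toLinearEquiv.toLinearMap =
      (split (H := K) e).toLinearEquiv.toLinearMap ∘ₗ TensorProduct.map (map fun _ : ι => a).toLinearMap
        (map fun _ : κ => a).toLinearMap := tensor_ext fun x y => by
    change map (fun _ => a) (split e (tprod x ⊗ₜ tprod y)) =
      split e (map (fun _ => a) (tprod x) ⊗ₜ map (fun _ => a) (tprod y))
    rw [map_tprod, map_tprod, split_tprod, split_tprod, map_tprod]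
    congr 1
    funext t
    rcases e.symm t with s | s <;> rfl
  exact LinearMap.congr_fun this (u ⊗ₜ v)

theorem embed_id [IsEmpty κ] (e : ι ⊕ κ ≃ ι) (he : ∀ i, e (.inl i) = i)
    (A : ManyBody ι H →L[ℂ] ManyBody ι H) : embed e A = A := by
  refine clm_ext fun x => ?_
  rw [embed_apply_tprod]
  simp only [he]
  let l : ManyBody ι H →ₗ[ℂ] ManyBody ι H := (split (H := H) e).toLinearEquiv.toLinearMap ∘ₗ
    (TensorProduct.mk ℂ _ _).flip (tprod fun i => x (e (.inr i)))
  have : l = LinearMap.id := linearMap_ext fun y => by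
    refine (split_tprod e y _).trans (congrArg tprod (funext fun t => ?_))
    obtain ⟨s, rfl⟩ := e.surjective t
    rcases s with s | s
    · have : e.symm s = .inl s := by rw [Equiv.symm_apply_eq, he]
      simp [he, this]
    · exact isEmptyElim s
  exact LinearMap.congr_fun this (A (tprod x))

theorem embed_embed {κ' κ'' σ : Type*} [Fintype κ'] [Fintype κ''] [Fintype σ] (e : ι ⊕ κ ≃ τ)
    (e' : τ ⊕ κ' ≃ σ) (e'' : ι ⊕ κ'' ≃ σ) (h : ∀ i, e' (.inl (e (.inl i))) = e'' (.inl i))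
    (A : ManyBody ι H →L[ℂ] ManyBody ι H) : embed e' (embed e A) = embed e'' A := by
  refine clm_ext fun x => ?_
  rw [embed_apply_tprod, embed_apply_tprod, embed_apply_tprod]
  simp only [h]
  let l : ManyBody ι H →ₗ[ℂ] ManyBody σ H := (split (H := H) e').toLinearEquiv.toLinearMap ∘ₗ
    (TensorProduct.mk ℂ _ _).flip (tprod fun i => x (e' (.inr i))) ∘ₗ
    (split (H := H) e).toLinearEquiv.toLinearMap ∘ₗ
    (TensorProduct.mk ℂ _ _).flip (tprod fun i => x (e' (.inl (e (.inr i)))))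
  let l' : ManyBody ι H →ₗ[ℂ] ManyBody σ H := (split (H := H) e'').toLinearEquiv.toLinearMap ∘ₗ
    (TensorProduct.mk ℂ _ _).flip (tprod fun i => x (e'' (.inr i)))
  have : l = l' := linearMap_ext fun y => by
    change split e' (split e (tprod y ⊗ₜ tprod _) ⊗ₜ tprod _) = split e'' (tprod y ⊗ₜ tprod _)
    rw [split_tprod, split_tprod, split_tprod]
    refine congrArg tprod (funext fun t => ?_)
    obtain ⟨s, rfl⟩ := e''.surjective t
    rcases s with s | s
    · have h1 : e'.symm (e'' (.inl s)) = .inl (e (.inl s)) := by rw [Equiv.symm_apply_eq, h]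
      simp [h1]
    · obtain ⟨r, hr⟩ := e'.surjective (e'' (.inr s))
      rcases r with r | r
      · obtain ⟨q, rfl⟩ := e.surjective r
        rcases q with q | q
        · rw [h] at hr
          simpa using e''.injective hr
        · have h1 : e'.symm (e'' (.inr s)) = .inl (e (.inr q)) := by
            rw [Equiv.symm_apply_eq, hr]
          simp [h1, hr]
      · have h1 : e'.symm (e'' (.inr s)) = .inr r := by rw [Equiv.symm_apply_eq, hr]
        simp [h1, hr]
  exact LinearMap.congr_fun this (A (tprod fun i => x (e'' (.inl i))))

open ContinuousLinearMap in
/-- `A ↦ f_ι⋆ A f_ι`, where `f_ι = ⨂ f`. -/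
def compress (ι : Type*) [Fintype ι] (f : H →ₗᵢ[ℂ] K) :
    (ManyBody ι K →L[ℂ] ManyBody ι K) →ₗ[ℂ] (ManyBody ι H →L[ℂ] ManyBody ι H) where
  toFun A := adjoint (map fun _ => f.toContinuousLinearMap) ∘L A ∘L
    map fun _ => f.toContinuousLinearMap
  map_add' A B := by ext; simp
  map_smul' c A := by ext; simp

open ContinuousLinearMap in
theorem compress_apply (f : H →ₗᵢ[ℂ] K) (A : ManyBody ι K →L[ℂ] ManyBody ι K)
    (x : ManyBody ι H) : compress ι f A x = map (fun _ => adjoint f.toContinuousLinearMap)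
      (A (map (fun _ => f.toContinuousLinearMap) x)) := by
  rw [← adjoint_map]
  rfl

open ContinuousLinearMap in
theorem adjoint_isometry (f : H →ₗᵢ[ℂ] K) (x : H) :
    adjoint f.toContinuousLinearMap (f x) = x :=
  ext_inner_left ℂ fun y => by
    rw [adjoint_inner_right]
    exact f.inner_map_map y x

theorem compress_embed (f : H →ₗᵢ[ℂ] K) (e : ι ⊕ κ ≃ τ) (A : ManyBody ι K →L[ℂ] ManyBody ι K) :
    compress τ f (embed e A) = embed e (compress ι f A) := by
  refine clm_ext fun x => ?_
  rw [compress_apply, embed_apply_tprod, map_tprod, embed_apply_tprod, map_split, compress_apply,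
    map_tprod, map_tprod]
  simp [adjoint_isometry]

theorem compress_one (f : H →ₗᵢ[ℂ] K) : compress ι f 1 = 1 := by
  refine clm_ext fun x => ?_
  rw [compress_apply, map_tprod]
  simp [adjoint_isometry]

open ContinuousLinearMap in
theorem compress_id : compress ι (LinearIsometry.id : H →ₗᵢ[ℂ] H) = LinearMap.id := by
  have h : adjoint (LinearIsometry.id : H →ₗᵢ[ℂ] H).toContinuousLinearMap =
      ContinuousLinearMap.id ℂ H := ContinuousLinearMap.ext fun x => adjoint_isometry _ x
  have h' : (LinearIsometry.id : H →ₗᵢ[ℂ] H).toContinuousLinearMap =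
      ContinuousLinearMap.id ℂ H := rfl
  refine LinearMap.ext fun A => ContinuousLinearMap.ext fun x => ?_
  rw [compress_apply, h, h', map_id]
  rfl

open ContinuousLinearMap in
theorem compress_comp {L : Type*} [NormedAddCommGroup L] [InnerProductSpace ℂ L]
    [FiniteDimensional ℂ L] (f : H →ₗᵢ[ℂ] K) (g : K →ₗᵢ[ℂ] L) :
    compress ι (g.comp f) = compress ι f ∘ₗ compress ι g := by
  have h : (g.comp f).toContinuousLinearMap =
    g.toContinuousLinearMap ∘L f.toContinuousLinearMap := rfl
  refine LinearMap.ext fun A => ContinuousLinearMap.ext fun x => ?_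
  rw [compress_apply, LinearMap.comp_apply, compress_apply, compress_apply, h, adjoint_comp,
    ← map_comp, ← map_comp]
  rfl

end Split
end ManyBody

section Compression

variable {E F : Type*} [NormedAddCommGroup E] [InnerProductSpace ℂ E] [FiniteDimensional ℂ E]
  [NormedAddCommGroup F] [InnerProductSpace ℂ F] [FiniteDimensional ℂ F]

open ContinuousLinearMap in
theorem exists_sum_adjoint_comp [Nontrivial F] : ∃ (m : ℕ) (w : Fin m → (E →L[ℂ] F)),
    ∑ k, (adjoint (w k)) ∘L (w k) = ContinuousLinearMap.id ℂ E := by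
  obtain ⟨h, hh⟩ := exists_norm_eq F zero_le_one
  let b := stdOrthonormalBasis ℂ E
  refine ⟨_, fun k => (innerSL ℂ (b k)).smulRight h, ?_⟩
  refine ContinuousLinearMap.ext fun x => ext_inner_left ℂ fun y => ?_
  rw [_root_.sum_apply, inner_sum]
  simp only [ContinuousLinearMap.coe_comp, Function.comp_apply, adjoint_inner_right, smulRight_apply,
    innerSL_apply_apply, inner_smul_left, inner_smul_right, inner_self_eq_norm_sq_to_K, hh]
  simp [← b.sum_inner_mul_inner y x, mul_comm]

end Compression

namespace ManyBody

variable {ι : Type*} [Fintype ι] {H K : Type*} [NormedAddCommGroup H]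
  [InnerProductSpace ℂ H] [FiniteDimensional ℂ H] [NormedAddCommGroup K] [InnerProductSpace ℂ K]
  [FiniteDimensional ℂ K]

instance [Nontrivial H] : Nontrivial (ManyBody ι H) := by
  obtain ⟨y, hy⟩ := exists_ne (0 : H)
  refine ⟨tprod fun _ => y, 0, fun h => ?_⟩
  have h2 := norm_tprod fun _ : ι => y
  rw [h, norm_zero] at h2
  exact (Finset.prod_ne_zero_iff.mpr fun (_ : ι) _ => norm_ne_zero_iff.mpr hy) h2.symm

open ContinuousLinearMap in
theorem gram_compress [Nontrivial H] (f : H →ₗᵢ[ℂ] K) : GramPreserving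
    (D := ManyBody ι K →L[ℂ] ManyBody ι K) (E := ManyBody ι H →L[ℂ] ManyBody ι H)
    (compress ι f) := by
  intro n a
  obtain ⟨m, w, hw⟩ := exists_sum_adjoint_comp (E := ManyBody ι K) (F := ManyBody ι H)
  let V : ManyBody ι H →L[ℂ] ManyBody ι K := map fun _ => f.toContinuousLinearMap
  refine ⟨m, fun k i => (w k) ∘L (a i) ∘L V, fun i j => ?_⟩
  refine ContinuousLinearMap.ext fun x => ?_
  have h1 : ∀ y, y = ∑ k, adjoint (w k) (w k y) := fun y => by
    have := DFunLike.congr_fun hw y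
    simpa [_root_.sum_apply] using this.symm
  change adjoint V (adjoint (a i) (a j (V x))) = _
  rw [_root_.sum_apply]
  rw [h1 (a j (V x)), map_sum, map_sum]
  refine Finset.sum_congr rfl fun k _ => ?_
  simp only [star_eq_adjoint, adjoint_comp]
  rfl

open ContinuousLinearMap in
theorem norm_compress_le (f : H →ₗᵢ[ℂ] K) (A : ManyBody ι K →L[ℂ] ManyBody ι K) :
    ‖compress ι f A‖ ≤ ‖A‖ := by
  let V : ManyBody ι H →L[ℂ] ManyBody ι K := map fun _ => f.toContinuousLinearMap
  have hV : ‖V‖ ≤ 1 := by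
    have h : adjoint V ∘L V = 1 := compress_one f
    have h2 := norm_adjoint_comp_self V
    rw [h] at h2
    have h3 : ‖(1 : ManyBody ι H →L[ℂ] ManyBody ι H)‖ ≤ 1 := norm_id_le
    nlinarith [norm_nonneg V]
  have hV' : ‖adjoint V‖ ≤ 1 := by rwa [LinearIsometryEquiv.norm_map]
  calc ‖compress ι f A‖ = ‖adjoint V ∘L A ∘L V‖ := rfl
    _ ≤ ‖adjoint V‖ * (‖A‖ * ‖V‖) := (opNorm_comp_le _ _).trans
        (mul_le_mul_of_nonneg_left (opNorm_comp_le _ _) (norm_nonneg _))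
    _ ≤ 1 * (‖A‖ * 1) := by gcongr
    _ = ‖A‖ := by ring

end ManyBody

section QuasiLocal

variable {Γ : Type*}

open Classical in
/-- A finite set is the disjoint union of a subset and its complement. -/
def finsetSplit {s t : Finset Γ} (h : s ≤ t) : s ⊕ {v : t // (v : Γ) ∉ s} ≃ t where
  toFun := Sum.elim (fun v => ⟨v, h v.2⟩) Subtype.val
  invFun v := if hv : (v : Γ) ∈ s then .inl ⟨v, hv⟩ else .inr ⟨v, hv⟩
  left_inv v := by
    rcases v with v | v
    · simp
    · simp [v.2]
  right_inv v := by
    by_cases hv : (v : Γ) ∈ s <;> simp [hv]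

@[simp] theorem finsetSplit_inl {s t : Finset Γ} (h : s ≤ t) (v : s) :
    finsetSplit h (.inl v) = ⟨v, h v.2⟩ := rfl

instance (s : Finset Γ) : IsEmpty {v : s // (v : Γ) ∉ s} := ⟨fun v => v.2 v.1.2⟩

variable (H : Type*) [NormedAddCommGroup H] [InnerProductSpace ℂ H]
  [FiniteDimensional ℂ H]

/-- The algebra of observables localised in `Λ`. -/
abbrev LocalAlgebra (Λ : Finset Γ) : Type _ := ManyBody Λ H →L[ℂ] ManyBody Λ H

open Classical in
/-- The inclusion `A ↦ A ⊗ 1`. -/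
def LocalAlgebra.incl {Λ₁ Λ₂ : Finset Γ} (h : Λ₁ ≤ Λ₂) :
    LocalAlgebra H Λ₁ →⋆ₐ[ℂ] LocalAlgebra H Λ₂ :=
  ManyBody.embed (finsetSplit h)

open Classical in
instance : DirectedSystem (fun Λ : Finset Γ => LocalAlgebra H Λ)
    (fun _ _ h => LocalAlgebra.incl H h) where
  map_self _ A := ManyBody.embed_id _ (fun _ => rfl) A
  map_map _ _ _ _ _ A := ManyBody.embed_embed _ _ _ (fun _ => rfl) A

variable (Γ) in
/-- The ⋆-algebra of local observables: the union of the algebras `LocalAlgebra H Λ`. -/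
def LocalObs : Type _ :=
  DirectLimit (fun Λ : Finset Γ => LocalAlgebra H Λ) (fun _ _ h => LocalAlgebra.incl H h)

instance : Ring (LocalObs Γ H) := inferInstanceAs (Ring
  (DirectLimit (fun Λ : Finset Γ => LocalAlgebra H Λ) (fun _ _ h => LocalAlgebra.incl H h)))

instance : StarRing (LocalObs Γ H) := inferInstanceAs (StarRing
  (DirectLimit (fun Λ : Finset Γ => LocalAlgebra H Λ) (fun _ _ h => LocalAlgebra.incl H h)))

instance : Algebra ℂ (LocalObs Γ H) := inferInstanceAs (Algebra ℂ
  (DirectLimit (fun Λ : Finset Γ => LocalAlgebra H Λ) (fun _ _ h => LocalAlgebra.incl H h)))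

instance : StarModule ℂ (LocalObs Γ H) := inferInstanceAs (StarModule ℂ
  (DirectLimit (fun Λ : Finset Γ => LocalAlgebra H Λ) (fun _ _ h => LocalAlgebra.incl H h)))

variable {H} in
/-- The inclusion of `LocalAlgebra H Λ`. -/
def LocalObs.of (Λ : Finset Γ) : LocalAlgebra H Λ →⋆ₐ[ℂ] LocalObs Γ H where
  __ := DirectLimit.Algebra.of (R := ℂ) (fun Λ : Finset Γ => LocalAlgebra H Λ)
    (fun _ _ h => LocalAlgebra.incl H h) Λ
  map_star' _ := (DirectLimit.star_def ..).symm

variable {H}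

theorem LocalObs.of_incl {Λ Λ' : Finset Γ} (h : Λ ≤ Λ') (A : LocalAlgebra H Λ) :
    LocalObs.of Λ' (LocalAlgebra.incl H h A) = LocalObs.of Λ A :=
  DirectLimit.Algebra.of_f h A

theorem LocalObs.exists_of (x : LocalObs Γ H) :
    ∃ (Λ : Finset Γ) (A : LocalAlgebra H Λ), LocalObs.of Λ A = x := by
  obtain ⟨Λ, A, h⟩ := DirectLimit.exists_eq_mk _ x
  exact ⟨Λ, A, h.symm⟩

theorem LocalObs.exists_of_fin {n : ℕ} (x : Fin n → LocalObs Γ H) :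
    ∃ (Λ : Finset Γ) (A : Fin n → LocalAlgebra H Λ), ∀ i, LocalObs.of Λ (A i) = x i := by
  classical
  choose Λ A hA using fun i => LocalObs.exists_of (x i)
  have h : ∀ i, Λ i ≤ Finset.univ.sup Λ := fun i => Finset.le_sup (Finset.mem_univ i)
  exact ⟨_, fun i => LocalAlgebra.incl H (h i) (A i), fun i => by rw [LocalObs.of_incl, hA]⟩

variable [Nontrivial H]

theorem LocalAlgebra.norm_incl {Λ₁ Λ₂ : Finset Γ} (h : Λ₁ ≤ Λ₂) (A : LocalAlgebra H Λ₁) :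
    ‖LocalAlgebra.incl H h A‖ = ‖A‖ := by
  classical
  exact ManyBody.norm_embed _ A

/-- The norm of a local observable. -/
def LocalObs.norm (x : LocalObs Γ H) : ℝ :=
  DirectLimit.lift (fun _ _ h => LocalAlgebra.incl H h) (fun Λ (A : LocalAlgebra H Λ) => ‖A‖)
    (fun _ _ h A => (LocalAlgebra.norm_incl h A).symm) x

theorem LocalObs.norm_of (Λ : Finset Γ) (A : LocalAlgebra H Λ) :
    LocalObs.norm (LocalObs.of Λ A) = ‖A‖ := rfl

variable (Γ H) in
/-- The norm of local observables, as a C⋆-seminorm. -/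
def localNorm : CStarSeminorm (LocalObs Γ H) where
  toFun := LocalObs.norm
  map_zero' := by rw [← map_zero (LocalObs.of ∅), LocalObs.norm_of, norm_zero]
  add_le' x y := by
    obtain ⟨Λ, A, h⟩ := LocalObs.exists_of_fin ![x, y]
    rw [← show _ = x from h 0, ← show _ = y from h 1, ← map_add, LocalObs.norm_of, LocalObs.norm_of,
      LocalObs.norm_of]
    exact norm_add_le (A 0) (A 1)
  neg' x := by
    obtain ⟨Λ, A, rfl⟩ := LocalObs.exists_of x
    rw [← map_neg, LocalObs.norm_of, LocalObs.norm_of]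
    exact norm_neg A
  smul' c x := by
    obtain ⟨Λ, A, rfl⟩ := LocalObs.exists_of x
    rw [← map_smul, LocalObs.norm_of, LocalObs.norm_of]
    exact norm_smul c A
  mul_le' x y := by
    obtain ⟨Λ, A, h⟩ := LocalObs.exists_of_fin ![x, y]
    rw [← show _ = x from h 0, ← show _ = y from h 1, ← map_mul, LocalObs.norm_of, LocalObs.norm_of,
      LocalObs.norm_of]
    exact norm_mul_le (A 0) (A 1)
  star_mul_self' x := by
    obtain ⟨Λ, A, rfl⟩ := LocalObs.exists_of x
    rw [← StarHomClass.map_star, ← map_mul, LocalObs.norm_of, LocalObs.norm_of]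
    exact CStarRing.norm_star_mul_self (x := A)

variable (Γ H) in
/-- The quasi-local algebra: the completion of the algebra of local observables, that is, the
colimit of the C⋆-algebras `LocalAlgebra H Λ` over the finite subsets `Λ` of `Γ` (including the
empty set, with `LocalAlgebra H ∅ = ℂ`). -/
def QuasiLocal : Type _ := (localNorm Γ H).Completion

instance : CStarAlgebra (QuasiLocal Γ H) :=
  inferInstanceAs (CStarAlgebra (localNorm Γ H).Completion)

/-- The inclusion of `LocalAlgebra H Λ` into the quasi-local algebra. -/
def QuasiLocal.of (Λ : Finset Γ) : LocalAlgebra H Λ →⋆ₐ[ℂ] QuasiLocal Γ H :=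
  (localNorm Γ H).toCompletion.comp (LocalObs.of Λ)

theorem QuasiLocal.of_incl {Λ Λ' : Finset Γ} (h : Λ ≤ Λ') (A : LocalAlgebra H Λ) :
    QuasiLocal.of Λ' (LocalAlgebra.incl H h A) = QuasiLocal.of Λ A :=
  congrArg (localNorm Γ H).toCompletion (LocalObs.of_incl h A)

theorem QuasiLocal.norm_of (Λ : Finset Γ) (A : LocalAlgebra H Λ) : ‖QuasiLocal.of Λ A‖ = ‖A‖ :=
  (localNorm Γ H).norm_toCompletion _

variable {K : Type*} [NormedAddCommGroup K] [InnerProductSpace ℂ K] [FiniteDimensional ℂ K]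
  [Nontrivial K]

theorem compress_incl (f : H →ₗᵢ[ℂ] K) {Λ Λ' : Finset Γ} (h : Λ ≤ Λ') (A : LocalAlgebra K Λ) :
    ManyBody.compress Λ' f (LocalAlgebra.incl K h A) =
      LocalAlgebra.incl H h (ManyBody.compress Λ f A) := by
  classical
  exact ManyBody.compress_embed f _ A

variable (Γ) in
/-- The map induced on local observables by the maps `A ↦ f_Λ⋆ A f_Λ`. -/
def localPullback (f : H →ₗᵢ[ℂ] K) : LocalObs Γ K →ₗ[ℂ] QuasiLocal Γ H :=
  DirectLimit.Module.lift ℂ (Finset Γ) (fun Λ => LocalAlgebra K Λ)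
    (fun _ _ h => LocalAlgebra.incl K h)
    (fun Λ => (QuasiLocal.of Λ).toAlgHom.toLinearMap ∘ₗ ManyBody.compress Λ f)
    (fun _ _ h A => (congrArg (QuasiLocal.of _) (compress_incl f h A)).trans
      (QuasiLocal.of_incl h _))

theorem localPullback_of (f : H →ₗᵢ[ℂ] K) (Λ : Finset Γ) (A : LocalAlgebra K Λ) :
    localPullback Γ f (LocalObs.of Λ A) = QuasiLocal.of Λ (ManyBody.compress Λ f A) := rfl

theorem norm_localPullback_le (f : H →ₗᵢ[ℂ] K) (x : LocalObs Γ K) :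
    ‖localPullback Γ f x‖ ≤ localNorm Γ K x := by
  obtain ⟨Λ, A, rfl⟩ := LocalObs.exists_of x
  rw [localPullback_of, QuasiLocal.norm_of]
  exact ManyBody.norm_compress_le f A

theorem gram_localPullback (f : H →ₗᵢ[ℂ] K) : GramPreserving (localPullback Γ f) := by
  intro n x
  obtain ⟨Λ, A, h⟩ := LocalObs.exists_of_fin x
  obtain ⟨m, z, hz⟩ := ManyBody.gram_compress (ι := Λ) f n A
  refine ⟨m, fun k i => QuasiLocal.of Λ (z k i), fun i j => ?_⟩
  rw [← h i, ← h j, ← StarHomClass.map_star, ← map_mul, localPullback_of, hz, map_sum]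
  simp only [map_mul, StarHomClass.map_star]

theorem localPullback_one (f : H →ₗᵢ[ℂ] K) : localPullback Γ f 1 = 1 := by
  rw [← map_one (LocalObs.of ∅), localPullback_of, ManyBody.compress_one, map_one]

variable (Γ) in
/-- The unital completely positive map `𝔄(K) → 𝔄(H)` induced by an isometry `f : H → K`; it is the
bounded linear map that restricts to `A ↦ f_Λ⋆ A f_Λ` on `LocalAlgebra K Λ`. -/
def QuasiLocal.pullback (f : H →ₗᵢ[ℂ] K) : UCPMap (QuasiLocal Γ K) (QuasiLocal Γ H) :=
  (localNorm Γ K).extendUCP (localPullback Γ f) (norm_localPullback_le f) (gram_localPullback f)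
    (localPullback_one f)

@[simp] theorem QuasiLocal.pullback_of (f : H →ₗᵢ[ℂ] K) (Λ : Finset Γ) (A : LocalAlgebra K Λ) :
    QuasiLocal.pullback Γ f (QuasiLocal.of Λ A) = QuasiLocal.of Λ (ManyBody.compress Λ f A) :=
  CStarSeminorm.extendUCP_coe _ _ _ _ _ _

theorem QuasiLocal.ucp_ext {B : Type*} [CStarAlgebra B] {φ ψ : UCPMap (QuasiLocal Γ H) B}
    (h : ∀ (Λ : Finset Γ) (A : LocalAlgebra H Λ), φ (of Λ A) = ψ (of Λ A)) : φ = ψ := by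
  refine DFunLike.coe_injective ((localNorm Γ H).denseRange_toCompletion.equalizer φ.continuous
    ψ.continuous (funext fun x => ?_))
  obtain ⟨Λ, A, rfl⟩ := LocalObs.exists_of x
  exact h Λ A

end QuasiLocal

open CategoryTheory Opposite in
/-- The functor which sends `H` to its quasi-local algebra and an isometry `f` to the map which is
`A ↦ f_Λ⋆ A f_Λ` on the observables localised in a finite set `Λ`. -/
def quasiLocal (Γ : Type) : HilbFinᵒᵖ ⥤ CStarUCP where
  obj H := ⟨QuasiLocal Γ H.unop⟩
  map f := QuasiLocal.pullback Γ f.unop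
  map_id H := QuasiLocal.ucp_ext fun Λ A => (QuasiLocal.pullback_of ..).trans
    (congrArg (QuasiLocal.of Λ) (LinearMap.congr_fun ManyBody.compress_id A))
  map_comp f g := QuasiLocal.ucp_ext fun Λ A => by
    change QuasiLocal.pullback Γ _ _ = QuasiLocal.pullback Γ g.unop (QuasiLocal.pullback Γ f.unop _)
    rw [QuasiLocal.pullback_of, QuasiLocal.pullback_of, QuasiLocal.pullback_of]
    exact congrArg (QuasiLocal.of Λ) (LinearMap.congr_fun (ManyBody.compress_comp g.unop f.unop) A)

end

universe v

/-!
**Strong monoidality.** For finite-dimensional spaces the shuffle `H_Λ ⊗ K_Λ ≃ (H ⊗ K)_Λ` of tensor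
factors is unitary (`ManyBody.shuffle`), and conjugation by it turns
`B(H_Λ) ⊗ B(K_Λ) ≃ B(H_Λ ⊗ K_Λ)` into a ⋆-isomorphism onto `B((H ⊗ K)_Λ)` (`ManyBody.stack`). It is
compatible with the inclusions `A ↦ A ⊗ 1` (`ManyBody.stackOp_embed`), with compression along
isometries (`ManyBody.stackOp_compress`), and with the associator and the unitors
(`ManyBody.stackOp_assoc`, `ManyBody.stackOp_lid`, `ManyBody.stackOp_rid`).

In the limit over `Λ` the commuting images of the two factors give `QuasiLocal.stackHom` from the
maximal tensor product `𝔄(H) ⊗ 𝔄(K)` to `𝔄(H ⊗ K)`. Its inverse `QuasiLocal.unstackHom` is defined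
on each local algebra `𝔄_Λ(H ⊗ K)`, which is the algebraic tensor product of `𝔄_Λ(H)` and `𝔄_Λ(K)`;
being a ⋆-homomorphism on a C⋆-algebra it is contractive there, and extends to the completion. No
comparison of the maximal norm with other norms is needed. Naturality and coherence are equalities
of unital completely positive maps, which need to be checked only on elementary tensors of
observables localised in a common finite set (`QuasiLocal.ucp_ext₂`, `QuasiLocal.ucp_ext₃`).

**Nuclearity.** A C⋆-algebra has only one C⋆-norm, even among those not known to be continuous
(`CStarSeminorm.apply_eq_norm`). The tensor product of a local algebra with a C⋆-algebra `B` is an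
algebra of matrices over `B`, hence a C⋆-algebra, so it has only one C⋆-norm
(`CStarSeminorm.eq_of_matrix`). A C⋆-norm `p` on `𝔄(H) ⊗ B` satisfies
`p (a ⊗ b) ≤ 2 * ‖a‖ * p (1 ⊗ b)` (`CStarSeminorm.apply_tmul_le`), so these subalgebras are dense in
any such norm, and any two such norms coincide (`QuasiLocal.isNuclear`).
-/

noncomputable section
set_option linter.unusedSectionVars false

/-! ### The unitary between stacked tensor powers -/

namespace ManyBody

section Shuffle

variable {ι κ τ : Type*} [Fintype ι] [Fintype κ] [Fintype τ] {H K H' K' L : Type*}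
  [NormedAddCommGroup H] [InnerProductSpace ℂ H] [FiniteDimensional ℂ H]
  [NormedAddCommGroup K] [InnerProductSpace ℂ K] [FiniteDimensional ℂ K]
  [NormedAddCommGroup H'] [InnerProductSpace ℂ H'] [FiniteDimensional ℂ H']
  [NormedAddCommGroup K'] [InnerProductSpace ℂ K'] [FiniteDimensional ℂ K']
  [NormedAddCommGroup L] [InnerProductSpace ℂ L] [FiniteDimensional ℂ L]

/-- The linear map `H_ι ⊗ K_ι → (H ⊗ K)_ι` with `(⨂ xᵢ) ⊗ (⨂ yᵢ) ↦ ⨂ (xᵢ ⊗ yᵢ)`. -/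
def shuffleLin : ManyBody ι H ⊗[ℂ] ManyBody ι K →ₗ[ℂ] ManyBody ι (H ⊗[ℂ] K) :=
  TensorProduct.lift (M := ManyBody ι H) (N := ManyBody ι K)
    (PiTensorProduct.map₂ (R := ℂ) (s := fun _ : ι => H) (t := fun _ : ι => K)
      (t' := fun _ : ι => H ⊗[ℂ] K) fun _ => TensorProduct.mk ℂ H K)

theorem shuffleLin_tprod (x : ι → H) (y : ι → K) :
    shuffleLin (tprod x ⊗ₜ tprod y) = tprod fun i => x i ⊗ₜ[ℂ] y i :=
  PiTensorProduct.map₂_tprod_tprod (R := ℂ) (s := fun _ : ι => H) (t := fun _ : ι => K)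
    (t' := fun _ : ι => H ⊗[ℂ] K) _ x y

/-- Both sides are sesquilinear, so it suffices to compare them on product vectors. -/
theorem inner_shuffleLin (u v : ManyBody ι H ⊗[ℂ] ManyBody ι K) :
    inner ℂ (shuffleLin u) (shuffleLin v) = inner ℂ u v := by
  have hv : ∀ x y, innerₛₗ ℂ (shuffleLin (tprod x ⊗ₜ[ℂ] tprod y)) ∘ₗ
      shuffleLin (ι := ι) (H := H) (K := K) = innerₛₗ ℂ (tprod x ⊗ₜ[ℂ] tprod y) := fun x y =>
    tensor_ext fun x' y' => by
      simp only [LinearMap.comp_apply, innerₛₗ_apply_apply, shuffleLin_tprod,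
        inner_tprod, TensorProduct.inner_tmul, Finset.prod_mul_distrib]
  have hu : ∀ v, innerₛₗ ℂ (shuffleLin v) ∘ₗ
      shuffleLin (ι := ι) (H := H) (K := K) = innerₛₗ ℂ v := fun v =>
    tensor_ext fun x y => by
      have := LinearMap.congr_fun (hv x y) v
      simp only [LinearMap.comp_apply, innerₛₗ_apply_apply] at this ⊢
      rw [← inner_conj_symm, this, inner_conj_symm]
  exact LinearMap.congr_fun (hu u) v

open Classical in
theorem finrank_eq (ι H : Type*) [Fintype ι] [NormedAddCommGroup H] [InnerProductSpace ℂ H]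
    [FiniteDimensional ℂ H] :
    Module.finrank ℂ (ManyBody ι H) = Module.finrank ℂ H ^ Fintype.card ι := by
  rw [Module.finrank_eq_card_basis (basis ι H)]
  simp

/-- The unitary `H_ι ⊗ K_ι ≃ (H ⊗ K)_ι` with `(⨂ xᵢ) ⊗ (⨂ yᵢ) ↦ ⨂ (xᵢ ⊗ yᵢ)`. -/
def shuffle : ManyBody ι H ⊗[ℂ] ManyBody ι K ≃ₗᵢ[ℂ] ManyBody ι (H ⊗[ℂ] K) :=
  LinearIsometry.toLinearIsometryEquiv (LinearMap.isometryOfInner shuffleLin inner_shuffleLin) (by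
    rw [Module.finrank_tensorProduct, finrank_eq, finrank_eq, finrank_eq,
      Module.finrank_tensorProduct, mul_pow])

@[simp] theorem shuffle_tprod (x : ι → H) (y : ι → K) :
    shuffle (tprod x ⊗ₜ tprod y) = tprod fun i => x i ⊗ₜ[ℂ] y i := shuffleLin_tprod x y

/-- Operators on `(H ⊗ K)_ι` are determined by their values on the vectors `⨂ (xᵢ ⊗ yᵢ)`. -/
theorem clm_ext_shuffle {V : Type*} [NormedAddCommGroup V] [NormedSpace ℂ V]
    {f g : ManyBody ι (H ⊗[ℂ] K) →L[ℂ] V}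
    (h : ∀ x y, f (shuffle (tprod x ⊗ₜ tprod y)) = g (shuffle (tprod x ⊗ₜ tprod y))) : f = g := by
  have : f.toLinearMap ∘ₗ (shuffle (ι := ι) (H := H) (K := K)).toLinearEquiv.toLinearMap =
      g.toLinearMap ∘ₗ (shuffle (ι := ι) (H := H) (K := K)).toLinearEquiv.toLinearMap :=
    tensor_ext h
  ext x
  obtain ⟨u, rfl⟩ := shuffle.surjective x
  exact LinearMap.congr_fun this u

theorem map_shuffle (a : ι → (H →L[ℂ] H')) (b : ι → (K →L[ℂ] K'))
    (u : ManyBody ι H ⊗[ℂ] ManyBody ι K) :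
    map (fun i => TensorProduct.mapL (a i) (b i)) (shuffle u) =
      shuffle (TensorProduct.mapL (map a) (map b) u) := by
  have : (map fun i => TensorProduct.mapL (a i) (b i)).toLinearMap ∘ₗ
        (shuffle (ι := ι) (H := H) (K := K)).toLinearEquiv.toLinearMap =
      (shuffle (ι := ι) (H := H') (K := K')).toLinearEquiv.toLinearMap ∘ₗ
        (TensorProduct.mapL (map a) (map b)).toLinearMap := tensor_ext fun x y => by
    change map _ (shuffle (tprod x ⊗ₜ tprod y)) =
      shuffle (TensorProduct.mapL (map a) (map b) (tprod x ⊗ₜ tprod y))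
    rw [TensorProduct.mapL_tmul]
    simp
  exact LinearMap.congr_fun this u

/-- Shuffling commutes with splitting the set of sites; hence stacking operators commutes with the
inclusions `A ↦ A ⊗ 1`. -/
theorem shuffle_split (e : ι ⊕ κ ≃ τ) (u : ManyBody ι H) (u' : ManyBody κ H)
    (v : ManyBody ι K) (v' : ManyBody κ K) :
    shuffle (split e (u ⊗ₜ u') ⊗ₜ split e (v ⊗ₜ v')) =
      split e (shuffle (u ⊗ₜ v) ⊗ₜ shuffle (u' ⊗ₜ v')) := by
  have : shuffleLin (ι := τ) (H := H) (K := K) ∘ₗ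
        TensorProduct.map (splitLin (H := H) e).toLinearMap (splitLin (H := K) e).toLinearMap ∘ₗ
        (TensorProduct.tensorTensorTensorComm ℂ (ManyBody ι H) (ManyBody ι K) (ManyBody κ H)
          (ManyBody κ K)).toLinearMap =
      (splitLin (H := H ⊗[ℂ] K) e).toLinearMap ∘ₗ TensorProduct.map
        (shuffleLin (ι := ι) (H := H) (K := K)) (shuffleLin (ι := κ) (H := H) (K := K)) := by
    refine TensorProduct.ext (tensor_ext fun x y => tensor_ext fun x' y' => ?_)
    change shuffle (split e (tprod x ⊗ₜ tprod x') ⊗ₜ split e (tprod y ⊗ₜ tprod y')) =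
      split e (shuffle (tprod x ⊗ₜ tprod y) ⊗ₜ shuffle (tprod x' ⊗ₜ tprod y'))
    simp only [split_tprod, shuffle_tprod]
    refine congrArg tprod (funext fun t => ?_)
    rcases e.symm t with s | s <;> rfl
  exact LinearMap.congr_fun this ((u ⊗ₜ v) ⊗ₜ (u' ⊗ₜ v'))

theorem embed_apply_split (e : ι ⊕ κ ≃ τ) (A : ManyBody ι H →L[ℂ] ManyBody ι H)
    (u : ManyBody ι H) (v : ManyBody κ H) :
    embed e A (split e (u ⊗ₜ v)) = split e (A u ⊗ₜ v) := by
  change split e (A.rTensor (ManyBody κ H) ((split e).symm (split e (u ⊗ₜ v)))) = _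
  rw [LinearIsometryEquiv.symm_apply_apply]
  rfl

/-! ### Stacking operators -/

/-- `tensorOpHom`, as a homomorphism of algebras. -/
def tensorOpAlgHom (E F : Type*) [NormedAddCommGroup E] [InnerProductSpace ℂ E]
    [FiniteDimensional ℂ E] [NormedAddCommGroup F] [InnerProductSpace ℂ F]
    [FiniteDimensional ℂ F] :
    (E →L[ℂ] E) ⊗[ℂ] (F →L[ℂ] F) →ₐ[ℂ] (E ⊗[ℂ] F →L[ℂ] E ⊗[ℂ] F) :=
  Algebra.TensorProduct.algHomOfLinearMapTensorProduct
    (TensorProduct.lift (LinearMap.mk₂ ℂ TensorProduct.mapL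
      (fun _ _ _ => TensorProduct.mapL_add_left _ _ _)
      (fun _ _ _ => TensorProduct.mapL_smul_left _ _ _)
      (fun _ _ _ => TensorProduct.mapL_add_right _ _ _)
      (fun _ _ _ => TensorProduct.mapL_smul_right _ _ _)))
    (fun _ _ _ _ => TensorProduct.mapL_mul _ _ _ _)
    TensorProduct.mapL_id_id

theorem tensorOpAlgHom_star (E F : Type*) [NormedAddCommGroup E] [InnerProductSpace ℂ E]
    [FiniteDimensional ℂ E] [NormedAddCommGroup F] [InnerProductSpace ℂ F]
    [FiniteDimensional ℂ F]
    (x : (E →L[ℂ] E) ⊗[ℂ] (F →L[ℂ] F)) :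
    tensorOpAlgHom E F (star x) = ContinuousLinearMap.adjoint (tensorOpAlgHom E F x) := by
  induction x using TensorProduct.induction_on with
  | zero => rw [star_zero, map_zero, map_zero]
  | tmul A B => exact (TensorProduct.adjoint_mapL A B).symm
  | add x y hx hy => rw [star_add, map_add, map_add, map_add, hx, hy]

/-- The ⋆-homomorphism `A ⊗ B ↦ A ⊗ B` from the algebraic tensor product of the algebras of
operators on two spaces to the operators on the tensor product of the spaces. -/
def tensorOpHom (E F : Type*) [NormedAddCommGroup E] [InnerProductSpace ℂ E]
    [FiniteDimensional ℂ E] [NormedAddCommGroup F] [InnerProductSpace ℂ F]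
    [FiniteDimensional ℂ F] :
    (E →L[ℂ] E) ⊗[ℂ] (F →L[ℂ] F) →⋆ₐ[ℂ] (E ⊗[ℂ] F →L[ℂ] E ⊗[ℂ] F) where
  __ := tensorOpAlgHom E F
  map_star' := tensorOpAlgHom_star E F

/-- Here finite dimension is used: `End E ⊗ End F → End (E ⊗ F)` is bijective. -/
theorem tensorOpHom_bijective (E F : Type*) [NormedAddCommGroup E] [InnerProductSpace ℂ E]
    [FiniteDimensional ℂ E] [NormedAddCommGroup F] [InnerProductSpace ℂ F]
    [FiniteDimensional ℂ F] : Function.Bijective (tensorOpHom E F) := by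
  let e₁ := (TensorProduct.congr
    (LinearMap.toContinuousLinearMap (𝕜 := ℂ) (E := E) (F' := E)).symm
    (LinearMap.toContinuousLinearMap (𝕜 := ℂ) (E := F) (F' := F)).symm).trans
    ((homTensorHomEquiv ℂ E F E F).trans
      (LinearMap.toContinuousLinearMap (𝕜 := ℂ) (E := E ⊗[ℂ] F) (F' := E ⊗[ℂ] F)))
  have : (tensorOpHom E F).toAlgHom.toLinearMap = e₁.toLinearMap := by
    refine TensorProduct.ext' fun A B => ?_
    change TensorProduct.mapL A B = e₁ (A ⊗ₜ B)
    ext z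
    simp [e₁, homTensorHomEquiv_apply]
  have h : ⇑(tensorOpHom E F) = e₁ := congrArg DFunLike.coe this
  rw [h]
  exact e₁.bijective

/-- The identification of `B(H_ι) ⊗ B(K_ι)` with `B((H ⊗ K)_ι)`. -/
def stack : (ManyBody ι H →L[ℂ] ManyBody ι H) ⊗[ℂ] (ManyBody ι K →L[ℂ] ManyBody ι K) ≃⋆ₐ[ℂ]
    (ManyBody ι (H ⊗[ℂ] K) →L[ℂ] ManyBody ι (H ⊗[ℂ] K)) :=
  (StarAlgEquiv.ofBijective (tensorOpHom (ManyBody ι H) (ManyBody ι K))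
    (tensorOpHom_bijective _ _)).trans shuffle.conjStarAlgEquiv

/-- The operator on `(H ⊗ K)_ι` which corresponds to `A ⊗ B` on `H_ι ⊗ K_ι`. -/
def stackOp (A : ManyBody ι H →L[ℂ] ManyBody ι H) (B : ManyBody ι K →L[ℂ] ManyBody ι K) :
    ManyBody ι (H ⊗[ℂ] K) →L[ℂ] ManyBody ι (H ⊗[ℂ] K) :=
  stack (A ⊗ₜ B)

@[simp] theorem stackOp_shuffle (A : ManyBody ι H →L[ℂ] ManyBody ι H)
    (B : ManyBody ι K →L[ℂ] ManyBody ι K) (u : ManyBody ι H) (v : ManyBody ι K) :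
    stackOp A B (shuffle (u ⊗ₜ v)) = shuffle (A u ⊗ₜ B v) := by
  change shuffle (TensorProduct.mapL A B (shuffle.symm (shuffle (u ⊗ₜ v)))) = _
  rw [LinearIsometryEquiv.symm_apply_apply]
  rfl

theorem stackOp_map (a : ι → (H →L[ℂ] H)) (b : ι → (K →L[ℂ] K)) :
    stackOp (map a) (map b) = map fun i => TensorProduct.mapL (a i) (b i) :=
  clm_ext_shuffle fun x y => by rw [stackOp_shuffle, map_shuffle]; rfl

theorem stackOp_embed (e : ι ⊕ κ ≃ τ) (A : ManyBody ι H →L[ℂ] ManyBody ι H)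
    (B : ManyBody ι K →L[ℂ] ManyBody ι K) :
    stackOp (embed e A) (embed e B) = embed e (stackOp A B) :=
  clm_ext_shuffle fun x y => by
    have hx := split_symm_tprod e x
    have hy := split_symm_tprod e y
    rw [LinearIsometryEquiv.symm_apply_eq] at hx hy
    rw [stackOp_shuffle, hx, hy, embed_apply_split, embed_apply_split, shuffle_split, shuffle_split,
      embed_apply_split, stackOp_shuffle]

theorem stackOp_compress (f : H →ₗᵢ[ℂ] H') (g : K →ₗᵢ[ℂ] K')
    (A : ManyBody ι H' →L[ℂ] ManyBody ι H') (B : ManyBody ι K' →L[ℂ] ManyBody ι K') :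
    compress ι (TensorProduct.mapIsometry f g) (stackOp A B) =
      stackOp (compress ι f A) (compress ι g B) :=
  clm_ext_shuffle fun x y => by
    rw [compress_apply, stackOp_shuffle, TensorProduct.toContinuousLinearMap_mapIsometry,
      TensorProduct.adjoint_mapL, map_shuffle, TensorProduct.mapL_tmul, stackOp_shuffle,
      map_shuffle, TensorProduct.mapL_tmul, compress_apply, compress_apply]

/-- Compression along a unitary is conjugation: its value on `A` is the operator that the unitary
intertwines with `A`. -/
theorem compress_equiv (e : H ≃ₗᵢ[ℂ] K) (A : ManyBody ι K →L[ℂ] ManyBody ι K)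
    (B : ManyBody ι H →L[ℂ] ManyBody ι H)
    (h : ∀ x : ManyBody ι H, A (map (fun _ => e.toLinearIsometry.toContinuousLinearMap) x) =
      map (fun _ => e.toLinearIsometry.toContinuousLinearMap) (B x)) :
    compress ι e.toLinearIsometry A = B := by
  refine ContinuousLinearMap.ext fun x => ?_
  rw [compress_apply, h, ← ContinuousLinearMap.comp_apply, map_comp]
  have : ∀ i : ι, (ContinuousLinearMap.adjoint e.toLinearIsometry.toContinuousLinearMap).comp
      e.toLinearIsometry.toContinuousLinearMap = ContinuousLinearMap.id ℂ H :=
    fun _ => ContinuousLinearMap.ext fun x => adjoint_isometry e.toLinearIsometry x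
  rw [funext this, map_id]
  rfl

theorem map_assoc_symm_shuffle (u : ManyBody ι H) (v : ManyBody ι K) (w : ManyBody ι L) :
    map (fun _ => (TensorProduct.assocIsometry ℂ H K L).symm.toLinearIsometry.toContinuousLinearMap)
      (shuffle (u ⊗ₜ shuffle (v ⊗ₜ w))) = shuffle (shuffle (u ⊗ₜ v) ⊗ₜ w) := by
  let m := map (ι := ι) fun _ =>
    (TensorProduct.assocIsometry ℂ H K L).symm.toLinearIsometry.toContinuousLinearMap
  have : m.toLinearMap ∘ₗ shuffleLin ∘ₗ TensorProduct.map LinearMap.id shuffleLin ∘ₗ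
        (TensorProduct.assoc ℂ (ManyBody ι H) (ManyBody ι K) (ManyBody ι L)).toLinearMap =
      shuffleLin ∘ₗ TensorProduct.map shuffleLin LinearMap.id := by
    refine TensorProduct.ext (tensor_ext fun x y => linearMap_ext fun z => ?_)
    change m (shuffle (tprod x ⊗ₜ shuffle (tprod y ⊗ₜ tprod z))) =
      shuffle (shuffle (tprod x ⊗ₜ tprod y) ⊗ₜ tprod z)
    simp only [shuffle_tprod, m, map_tprod]
    rfl
  exact LinearMap.congr_fun this ((u ⊗ₜ v) ⊗ₜ w)

theorem linearMap_ext_shuffle {V : Type*} [AddCommGroup V] [Module ℂ V]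
    {f g : ManyBody ι (H ⊗[ℂ] K) →ₗ[ℂ] V}
    (h : ∀ u v, f (shuffle (u ⊗ₜ v)) = g (shuffle (u ⊗ₜ v))) : f = g := by
  have : f ∘ₗ shuffleLin = g ∘ₗ shuffleLin := TensorProduct.ext' h
  refine LinearMap.ext fun x => ?_
  obtain ⟨u, rfl⟩ := shuffle.surjective x
  exact LinearMap.congr_fun this u

theorem linearMap_ext_shuffle₃ {V : Type*} [AddCommGroup V] [Module ℂ V]
    {f g : ManyBody ι (H ⊗[ℂ] (K ⊗[ℂ] L)) →ₗ[ℂ] V}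
    (h : ∀ u v w, f (shuffle (u ⊗ₜ shuffle (v ⊗ₜ w))) = g (shuffle (u ⊗ₜ shuffle (v ⊗ₜ w)))) :
    f = g :=
  linearMap_ext_shuffle fun u x => by
    have : f ∘ₗ shuffleLin ∘ₗ TensorProduct.mk ℂ _ _ u =
        g ∘ₗ shuffleLin ∘ₗ TensorProduct.mk ℂ _ _ u := linearMap_ext_shuffle (h u)
    exact LinearMap.congr_fun this x

theorem stackOp_assoc (A : ManyBody ι H →L[ℂ] ManyBody ι H) (B : ManyBody ι K →L[ℂ] ManyBody ι K)
    (C : ManyBody ι L →L[ℂ] ManyBody ι L) :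
    compress ι (TensorProduct.assocIsometry ℂ H K L).symm.toLinearIsometry
      (stackOp (stackOp A B) C) = stackOp A (stackOp B C) := by
  have hX : ∀ u v w, stackOp (stackOp A B) C (shuffle (shuffle (u ⊗ₜ v) ⊗ₜ w)) =
      shuffle (shuffle (A u ⊗ₜ B v) ⊗ₜ C w) := fun u v w => by
    rw [stackOp_shuffle, stackOp_shuffle]
  have hY : ∀ u v w, stackOp A (stackOp B C) (shuffle (u ⊗ₜ shuffle (v ⊗ₜ w))) =
      shuffle (A u ⊗ₜ shuffle (B v ⊗ₜ C w)) := fun u v w => by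
    rw [stackOp_shuffle, stackOp_shuffle]
  -- only the values on shuffled product vectors matter from here on
  generalize stackOp (stackOp A B) C = X at hX ⊢
  generalize stackOp A (stackOp B C) = Y at hY ⊢
  refine compress_equiv _ _ _ fun x => ?_
  let m := map (ι := ι) fun _ =>
    (TensorProduct.assocIsometry ℂ H K L).symm.toLinearIsometry.toContinuousLinearMap
  have h : X.toLinearMap ∘ₗ m.toLinearMap = m.toLinearMap ∘ₗ Y.toLinearMap :=
    linearMap_ext_shuffle₃ fun u v w => by
      change X (m _) = m (Y _)
      rw [hY, map_assoc_symm_shuffle, map_assoc_symm_shuffle, hX]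
  exact LinearMap.congr_fun h x

end Shuffle
end ManyBody

/-! ### Stacking with the trivial system -/

namespace ManyBody

section Unit

variable {ι : Type*} [Fintype ι] {H : Type*}
  [NormedAddCommGroup H] [InnerProductSpace ℂ H] [FiniteDimensional ℂ H]

theorem map_lid_symm (v : ManyBody ι H) :
    map (fun _ => (TensorProduct.lidIsometry ℂ H).symm.toLinearIsometry.toContinuousLinearMap) v =
      shuffle (tprod (fun _ => (1 : ℂ)) ⊗ₜ v) := by
  let m := map (ι := ι) fun _ =>
    (TensorProduct.lidIsometry ℂ H).symm.toLinearIsometry.toContinuousLinearMap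
  have : m.toLinearMap = shuffleLin ∘ₗ TensorProduct.mk ℂ (ManyBody ι ℂ) (ManyBody ι H)
      (tprod fun _ => (1 : ℂ)) := linearMap_ext fun x => by
    change m (tprod x) = shuffle (tprod (fun _ => (1 : ℂ)) ⊗ₜ tprod x)
    rw [shuffle_tprod]
    exact map_tprod _ _
  exact LinearMap.congr_fun this v

theorem map_rid_symm (v : ManyBody ι H) :
    map (fun _ => (TensorProduct.ridIsometry ℂ H).symm.toLinearIsometry.toContinuousLinearMap) v =
      shuffle (v ⊗ₜ tprod (fun _ => (1 : ℂ))) := by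
  let m := map (ι := ι) fun _ =>
    (TensorProduct.ridIsometry ℂ H).symm.toLinearIsometry.toContinuousLinearMap
  have : m.toLinearMap = shuffleLin ∘ₗ (TensorProduct.mk ℂ (ManyBody ι H) (ManyBody ι ℂ)).flip
      (tprod fun _ => (1 : ℂ)) := linearMap_ext fun x => by
    change m (tprod x) = shuffle (tprod x ⊗ₜ tprod (fun _ => (1 : ℂ)))
    rw [shuffle_tprod]
    exact map_tprod _ _
  exact LinearMap.congr_fun this v

theorem stackOp_lid (A : ManyBody ι H →L[ℂ] ManyBody ι H) :
    compress ι (TensorProduct.lidIsometry ℂ H).symm.toLinearIsometry (stackOp 1 A) = A :=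
  compress_equiv _ _ _ fun x => by
    rw [map_lid_symm, map_lid_symm, stackOp_shuffle]
    rfl

theorem stackOp_rid (A : ManyBody ι H →L[ℂ] ManyBody ι H) :
    compress ι (TensorProduct.ridIsometry ℂ H).symm.toLinearIsometry (stackOp A 1) = A :=
  compress_equiv _ _ _ fun x => by
    rw [map_rid_symm, map_rid_symm, stackOp_shuffle]
    rfl

/-- The operators on a tensor power of `ℂ` are scalars. -/
theorem exists_eq_algebraMap (A : ManyBody ι ℂ →L[ℂ] ManyBody ι ℂ) :
    ∃ c : ℂ, algebraMap ℂ (ManyBody ι ℂ →L[ℂ] ManyBody ι ℂ) c = A := by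
  have h : Module.finrank ℂ (ManyBody ι ℂ) = 1 := by rw [finrank_eq]; simp
  obtain ⟨v, hv, hs⟩ := finrank_eq_one_iff'.mp h
  obtain ⟨c, hc⟩ := hs (A v)
  refine ⟨c, ContinuousLinearMap.ext fun w => ?_⟩
  obtain ⟨d, rfl⟩ := hs w
  rw [map_smul, map_smul, ← hc, Algebra.algebraMap_eq_smul_one]
  rfl

end Unit
end ManyBody

/-! ### Maps out of quasi-local algebras -/

section QuasiLocalLift

variable {Γ : Type*} {H K L : Type*}
  [NormedAddCommGroup H] [InnerProductSpace ℂ H] [FiniteDimensional ℂ H] [Nontrivial H]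
  [NormedAddCommGroup K] [InnerProductSpace ℂ K] [FiniteDimensional ℂ K] [Nontrivial K]
  [NormedAddCommGroup L] [InnerProductSpace ℂ L] [FiniteDimensional ℂ L] [Nontrivial L]
  {C : Type*} [CStarAlgebra C]

/-- The ⋆-homomorphism on local observables defined by a compatible family of ⋆-homomorphisms. -/
def LocalObs.lift (φ : ∀ Λ : Finset Γ, LocalAlgebra H Λ →⋆ₐ[ℂ] C)
    (h : ∀ (Λ Λ' : Finset Γ) (hΛ : Λ ≤ Λ') (A : LocalAlgebra H Λ),
      φ Λ' (LocalAlgebra.incl H hΛ A) = φ Λ A) : LocalObs Γ H →⋆ₐ[ℂ] C where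
  __ := DirectLimit.Algebra.lift (R := ℂ) (fun Λ : Finset Γ => LocalAlgebra H Λ)
    (fun _ _ h => LocalAlgebra.incl H h) C
    (fun Λ => (φ Λ).toAlgHom) h
  map_star' x := by
    obtain ⟨Λ, A, rfl⟩ := LocalObs.exists_of x
    rw [← StarHomClass.map_star]
    exact map_star (φ Λ) A

theorem LocalObs.lift_of (φ : ∀ Λ : Finset Γ, LocalAlgebra H Λ →⋆ₐ[ℂ] C)
    (h : ∀ (Λ Λ' : Finset Γ) (hΛ : Λ ≤ Λ') (A : LocalAlgebra H Λ),
      φ Λ' (LocalAlgebra.incl H hΛ A) = φ Λ A) (Λ : Finset Γ) (A : LocalAlgebra H Λ) :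
    LocalObs.lift φ h (LocalObs.of Λ A) = φ Λ A := rfl

/-- The ⋆-homomorphism on the quasi-local algebra defined by a compatible family of
⋆-homomorphisms on the local algebras; each of these is automatically contractive. -/
def QuasiLocal.lift (φ : ∀ Λ : Finset Γ, LocalAlgebra H Λ →⋆ₐ[ℂ] C)
    (h : ∀ (Λ Λ' : Finset Γ) (hΛ : Λ ≤ Λ') (A : LocalAlgebra H Λ),
      φ Λ' (LocalAlgebra.incl H hΛ A) = φ Λ A) : QuasiLocal Γ H →⋆ₐ[ℂ] C :=
  (localNorm Γ H).extendHom (LocalObs.lift φ h) fun x => by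
    obtain ⟨Λ, A, rfl⟩ := LocalObs.exists_of x
    exact NonUnitalStarAlgHom.norm_apply_le (φ Λ) A

@[simp] theorem QuasiLocal.lift_of (φ : ∀ Λ : Finset Γ, LocalAlgebra H Λ →⋆ₐ[ℂ] C)
    (h : ∀ (Λ Λ' : Finset Γ) (hΛ : Λ ≤ Λ') (A : LocalAlgebra H Λ),
      φ Λ' (LocalAlgebra.incl H hΛ A) = φ Λ A) (Λ : Finset Γ) (A : LocalAlgebra H Λ) :
    QuasiLocal.lift φ h (QuasiLocal.of Λ A) = φ Λ A :=
  (localNorm Γ H).extendHom_coe _ _ _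

/-- A property of quasi-local observables which is closed holds if it holds for local ones. -/
theorem QuasiLocal.induction {P : QuasiLocal Γ H → Prop} (hc : IsClosed {x | P x})
    (h : ∀ (Λ : Finset Γ) (A : LocalAlgebra H Λ), P (QuasiLocal.of Λ A)) (x : QuasiLocal Γ H) :
    P x :=
  (localNorm Γ H).isClosed_ind hc (fun x => by
    obtain ⟨Λ, A, rfl⟩ := LocalObs.exists_of x
    exact h Λ A) x

open MaxTensor

/-- Unital completely positive maps on `𝔄(H) ⊗ 𝔄(K)` are determined by their values on pairs of
observables localised in the same finite set. -/
theorem QuasiLocal.ucp_ext₂ {φ ψ : UCPMap (MaxTensor (QuasiLocal Γ H) (QuasiLocal Γ K)) C}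
    (h : ∀ (Λ : Finset Γ) (A : LocalAlgebra H Λ) (B : LocalAlgebra K Λ),
      φ (tmul (of Λ A) (of Λ B)) = ψ (tmul (of Λ A) (of Λ B))) : φ = ψ := by
  classical
  refine MaxTensor.ucp_ext fun a b => ?_
  refine QuasiLocal.induction (P := fun a => φ (tmul a b) = ψ (tmul a b))
    (isClosed_eq (φ.continuous.comp (continuous_tmul_left b))
      (ψ.continuous.comp (continuous_tmul_left b))) (fun Λ A => ?_) a
  refine QuasiLocal.induction (P := fun b => φ (tmul (of Λ A) b) = ψ (tmul (of Λ A) b))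
    (isClosed_eq (φ.continuous.comp (continuous_tmul_right _))
      (ψ.continuous.comp (continuous_tmul_right _))) (fun Λ' B => ?_) b
  rw [← of_incl (Finset.subset_union_left : Λ ⊆ Λ ∪ Λ') A,
    ← of_incl (Finset.subset_union_right : Λ' ⊆ Λ ∪ Λ') B]
  exact h _ _ _

/-- Unital completely positive maps on `(𝔄(H) ⊗ 𝔄(K)) ⊗ 𝔄(L)` are determined by their values on
triples of observables localised in the same finite set. -/
theorem QuasiLocal.ucp_ext₃
    {φ ψ : UCPMap (MaxTensor (MaxTensor (QuasiLocal Γ H) (QuasiLocal Γ K)) (QuasiLocal Γ L)) C}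
    (h : ∀ (Λ : Finset Γ) (X : LocalAlgebra H Λ) (Y : LocalAlgebra K Λ) (Z : LocalAlgebra L Λ),
      φ (tmul (tmul (of Λ X) (of Λ Y)) (of Λ Z)) =
        ψ (tmul (tmul (of Λ X) (of Λ Y)) (of Λ Z))) : φ = ψ := by
  classical
  refine MaxTensor.ucp_ext₃ fun a b c => ?_
  refine QuasiLocal.induction (P := fun a => φ (tmul (tmul a b) c) = ψ (tmul (tmul a b) c))
    (isClosed_eq
      (φ.continuous.comp ((continuous_tmul_left c).comp (continuous_tmul_left b)))
      (ψ.continuous.comp ((continuous_tmul_left c).comp (continuous_tmul_left b))))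
    (fun Λ₁ X => ?_) a
  refine QuasiLocal.induction
    (P := fun b => φ (tmul (tmul (of Λ₁ X) b) c) = ψ (tmul (tmul (of Λ₁ X) b) c))
    (isClosed_eq
      (φ.continuous.comp ((continuous_tmul_left c).comp (continuous_tmul_right _)))
      (ψ.continuous.comp ((continuous_tmul_left c).comp (continuous_tmul_right _))))
    (fun Λ₂ Y => ?_) b
  refine QuasiLocal.induction (P := fun c => φ (tmul (tmul (of Λ₁ X) (of Λ₂ Y)) c) =
      ψ (tmul (tmul (of Λ₁ X) (of Λ₂ Y)) c))
    (isClosed_eq (φ.continuous.comp (continuous_tmul_right _))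
      (ψ.continuous.comp (continuous_tmul_right _))) (fun Λ₃ Z => ?_) c
  have h₁ : Λ₁ ≤ Λ₁ ∪ Λ₂ ∪ Λ₃ := Finset.subset_union_left.trans Finset.subset_union_left
  have h₂ : Λ₂ ≤ Λ₁ ∪ Λ₂ ∪ Λ₃ := Finset.subset_union_right.trans Finset.subset_union_left
  have h₃ : Λ₃ ≤ Λ₁ ∪ Λ₂ ∪ Λ₃ := Finset.subset_union_right
  rw [← of_incl h₁ X, ← of_incl h₂ Y, ← of_incl h₃ Z]
  exact h _ _ _ _

end QuasiLocalLift

/-! ### C⋆-algebras that are algebraic tensor products -/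

section TensorDecomposition

variable {A B C D : Type*} [CStarAlgebra A] [CStarAlgebra B] [CStarAlgebra C] [CStarAlgebra D]

/-- If the algebraic tensor product of `A` and `B` is already a C⋆-algebra `C`, then commuting
⋆-homomorphisms of `A` and `B` define one of `C`. -/
def tensorDesc (s : A ⊗[ℂ] B ≃⋆ₐ[ℂ] C) (π : A →⋆ₐ[ℂ] D) (ρ : B →⋆ₐ[ℂ] D)
    (h : ∀ a b, Commute (π a) (ρ b)) : C →⋆ₐ[ℂ] D :=
  ((MaxTensor.lift π ρ h).comp MaxTensor.ι).comp s.symm.toStarAlgHom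

theorem tensorDesc_apply (s : A ⊗[ℂ] B ≃⋆ₐ[ℂ] C) (π : A →⋆ₐ[ℂ] D) (ρ : B →⋆ₐ[ℂ] D)
    (h : ∀ a b, Commute (π a) (ρ b)) (a : A) (b : B) :
    tensorDesc s π ρ h (s (a ⊗ₜ b)) = π a * ρ b := by
  change MaxTensor.lift π ρ h (MaxTensor.ι (s.symm (s (a ⊗ₜ b)))) = _
  rw [StarAlgEquiv.symm_apply_apply]
  exact MaxTensor.lift_tmul π ρ h a b

/-- The inclusion of the first factor of a tensor decomposition. -/
def tensorLeft (s : A ⊗[ℂ] B ≃⋆ₐ[ℂ] C) : A →⋆ₐ[ℂ] C := s.toStarAlgHom.comp (tensorInl A B)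

/-- The inclusion of the second factor of a tensor decomposition. -/
def tensorRight (s : A ⊗[ℂ] B ≃⋆ₐ[ℂ] C) : B →⋆ₐ[ℂ] C := s.toStarAlgHom.comp (tensorInr A B)

theorem tensorLeft_mul_tensorRight (s : A ⊗[ℂ] B ≃⋆ₐ[ℂ] C) (a : A) (b : B) :
    tensorLeft s a * tensorRight s b = s (a ⊗ₜ b) := by
  change s (a ⊗ₜ 1) * s (1 ⊗ₜ b) = _
  rw [← map_mul, Algebra.TensorProduct.tmul_mul_tmul, mul_one, one_mul]

theorem tensorRight_mul_tensorLeft (s : A ⊗[ℂ] B ≃⋆ₐ[ℂ] C) (a : A) (b : B) :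
    tensorRight s b * tensorLeft s a = s (a ⊗ₜ b) := by
  change s (1 ⊗ₜ b) * s (a ⊗ₜ 1) = _
  rw [← map_mul, Algebra.TensorProduct.tmul_mul_tmul, mul_one, one_mul]

theorem linearMap_ext_tensor (s : A ⊗[ℂ] B ≃⋆ₐ[ℂ] C) {V : Type*} [AddCommGroup V] [Module ℂ V]
    {f g : C →ₗ[ℂ] V} (h : ∀ a b, f (s (a ⊗ₜ b)) = g (s (a ⊗ₜ b))) : f = g := by
  refine LinearMap.ext fun x => ?_
  obtain ⟨t, rfl⟩ := s.surjective x
  induction t using TensorProduct.induction_on with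
  | zero => rw [map_zero, map_zero, map_zero]
  | tmul a b => exact h a b
  | add x y hx hy => rw [map_add, map_add, map_add, hx, hy]

end TensorDecomposition

/-! ### Stacking quasi-local algebras -/

section Stacking

variable {Γ : Type*} {X Y Z X' Y' : HilbFin}

open CategoryTheory MonoidalCategoryStruct ManyBody MaxTensor

/-- The tensor product, formed in the category: iterated tensor products then carry the Hilbert
space structure of the object, and no other. -/
local notation X:70 " ⊠ " Y:71 => tensorObj (C := HilbFin) X Y
/-- The trivial system `ℂ`, as an object of the category. -/
local notation "𝕀" => tensorUnit HilbFin

namespace LocalAlgebra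

variable (X Y) in
/-- The identification of `𝔄_Λ(X) ⊗ 𝔄_Λ(Y)` with `𝔄_Λ(X ⊗ Y)`. -/
def stackEquiv (Λ : Finset Γ) :
    LocalAlgebra X Λ ⊗[ℂ] LocalAlgebra Y Λ ≃⋆ₐ[ℂ] LocalAlgebra (X ⊠ Y) Λ :=
  ManyBody.stack (ι := Λ) (H := X) (K := Y)

/-- The observable `A ⊗ B` of the stacked system. -/
def tensor {Λ : Finset Γ} (A : LocalAlgebra X Λ) (B : LocalAlgebra Y Λ) :
    LocalAlgebra (X ⊠ Y) Λ := stackOp (H := X) (K := Y) A B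

theorem tensor_incl {Λ Λ' : Finset Γ} (h : Λ ≤ Λ') (A : LocalAlgebra X Λ)
    (B : LocalAlgebra Y Λ) :
    tensor (incl X h A) (incl Y h B) = incl (X ⊠ Y) h (tensor A B) := by
  classical
  exact stackOp_embed (H := X) (K := Y) _ A B

theorem tensor_map {Λ : Finset Γ} (a : Λ → (X →L[ℂ] X)) (b : Λ → (Y →L[ℂ] Y)) :
    tensor (Λ := Λ) (ManyBody.map a) (ManyBody.map b) =
      ManyBody.map (H := X ⊠ Y) (K := X ⊠ Y)
        fun v => TensorProduct.mapL (a v) (b v) :=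
  stackOp_map a b

theorem compress_tensor (f : X ⟶ X') (g : Y ⟶ Y') {Λ : Finset Γ}
    (A : LocalAlgebra X' Λ) (B : LocalAlgebra Y' Λ) :
    compress Λ (tensorHom f g) (tensor A B) = tensor (compress Λ f A) (compress Λ g B) :=
  stackOp_compress (H := X) (K := Y) (H' := X') (K' := Y') f g A B

theorem compress_associator_inv {Λ : Finset Γ} (A : LocalAlgebra X Λ) (B : LocalAlgebra Y Λ)
    (C : LocalAlgebra Z Λ) :
    compress Λ (associator X Y Z).inv (tensor (tensor A B) C) = tensor A (tensor B C) :=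
  stackOp_assoc (H := X) (K := Y) (L := Z) A B C

theorem compress_leftUnitor_inv {Λ : Finset Γ} (A : LocalAlgebra X Λ) :
    compress Λ (leftUnitor X).inv (tensor (X := 𝕀) 1 A) = A :=
  stackOp_lid (H := X) A

theorem compress_rightUnitor_inv {Λ : Finset Γ} (A : LocalAlgebra X Λ) :
    compress Λ (rightUnitor X).inv (tensor (Y := 𝕀) A 1) = A :=
  stackOp_rid (H := X) A

variable (X Y) in
/-- The ⋆-homomorphism `A ↦ A ⊗ 1` of local algebras. -/
def stackInl (Λ : Finset Γ) : LocalAlgebra X Λ →⋆ₐ[ℂ] LocalAlgebra (X ⊠ Y) Λ :=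
  tensorLeft (stackEquiv X Y Λ)

variable (X Y) in
/-- The ⋆-homomorphism `B ↦ 1 ⊗ B` of local algebras. -/
def stackInr (Λ : Finset Γ) : LocalAlgebra Y Λ →⋆ₐ[ℂ] LocalAlgebra (X ⊠ Y) Λ :=
  tensorRight (stackEquiv X Y Λ)

theorem stackInl_mul_stackInr {Λ : Finset Γ} (A : LocalAlgebra X Λ) (B : LocalAlgebra Y Λ) :
    stackInl X Y Λ A * stackInr X Y Λ B = tensor A B :=
  tensorLeft_mul_tensorRight (stackEquiv X Y Λ) A B

theorem stackInr_mul_stackInl {Λ : Finset Γ} (A : LocalAlgebra X Λ) (B : LocalAlgebra Y Λ) :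
    stackInr X Y Λ B * stackInl X Y Λ A = tensor A B :=
  tensorRight_mul_tensorLeft (stackEquiv X Y Λ) A B

/-- The observables `A ⊗ B` span the local algebra of the stacked system. -/
theorem linearMap_ext_tensor {Λ : Finset Γ} {V : Type*} [AddCommGroup V]
    [Module ℂ V] {f g : LocalAlgebra (X ⊠ Y) Λ →ₗ[ℂ] V}
    (h : ∀ (A : LocalAlgebra X Λ) (B : LocalAlgebra Y Λ), f (tensor A B) = g (tensor A B)) :
    f = g :=
  _root_.linearMap_ext_tensor (stackEquiv X Y Λ) h

end LocalAlgebra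

namespace QuasiLocal

variable (Γ X Y) in
/-- The ⋆-homomorphism `a ↦ a ⊗ 1` into the quasi-local algebra of the stacked system. -/
def stackInl : QuasiLocal Γ X →⋆ₐ[ℂ] QuasiLocal Γ (X ⊠ Y) :=
  lift (fun Λ => (of Λ).comp (LocalAlgebra.stackInl X Y Λ)) fun Λ Λ' h A => by
    change of Λ' (LocalAlgebra.tensor (LocalAlgebra.incl X h A) 1) = of Λ (LocalAlgebra.tensor A 1)
    rw [← map_one (LocalAlgebra.incl Y h), LocalAlgebra.tensor_incl, of_incl]

variable (Γ X Y) in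
/-- The ⋆-homomorphism `b ↦ 1 ⊗ b` into the quasi-local algebra of the stacked system. -/
def stackInr : QuasiLocal Γ Y →⋆ₐ[ℂ] QuasiLocal Γ (X ⊠ Y) :=
  lift (fun Λ => (of Λ).comp (LocalAlgebra.stackInr X Y Λ)) fun Λ Λ' h B => by
    change of Λ' (LocalAlgebra.tensor 1 (LocalAlgebra.incl Y h B)) = of Λ (LocalAlgebra.tensor 1 B)
    rw [← map_one (LocalAlgebra.incl X h), LocalAlgebra.tensor_incl, of_incl]

theorem stackInl_of (Λ : Finset Γ) (A : LocalAlgebra X Λ) :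
    stackInl Γ X Y (of Λ A) = of Λ (LocalAlgebra.stackInl X Y Λ A) := lift_of _ _ _ _

theorem stackInr_of (Λ : Finset Γ) (B : LocalAlgebra Y Λ) :
    stackInr Γ X Y (of Λ B) = of Λ (LocalAlgebra.stackInr X Y Λ B) := lift_of _ _ _ _

/-- On observables localised in a common finite set both products are `A ⊗ B`; the rest is
continuity. -/
theorem commute_stackInl_stackInr (a : QuasiLocal Γ X) (b : QuasiLocal Γ Y) :
    Commute (stackInl Γ X Y a) (stackInr Γ X Y b) := by
  classical
  have hl := map_continuous (stackInl Γ X Y)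
  have hr := map_continuous (stackInr Γ X Y)
  refine QuasiLocal.induction (P := fun a => Commute (stackInl Γ X Y a) (stackInr Γ X Y b))
    (isClosed_eq (by fun_prop) (by fun_prop)) (fun Λ A => ?_) a
  refine QuasiLocal.induction
    (P := fun b => Commute (stackInl Γ X Y (of Λ A)) (stackInr Γ X Y b))
    (isClosed_eq (by fun_prop) (by fun_prop)) (fun Λ' B => ?_) b
  rw [← of_incl (Finset.subset_union_left : Λ ⊆ Λ ∪ Λ') A,
    ← of_incl (Finset.subset_union_right : Λ' ⊆ Λ ∪ Λ') B, stackInl_of, stackInr_of, Commute,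
    SemiconjBy, ← map_mul, ← map_mul, LocalAlgebra.stackInl_mul_stackInr,
    LocalAlgebra.stackInr_mul_stackInl]

variable (Γ X Y) in
/-- The canonical ⋆-homomorphism from external to internal stacking. -/
def stackHom : MaxTensor (QuasiLocal Γ X) (QuasiLocal Γ Y) →⋆ₐ[ℂ] QuasiLocal Γ (X ⊠ Y) :=
  MaxTensor.lift (stackInl Γ X Y) (stackInr Γ X Y) commute_stackInl_stackInr

@[simp] theorem stackHom_of (Λ : Finset Γ) (A : LocalAlgebra X Λ) (B : LocalAlgebra Y Λ) :
    stackHom Γ X Y (tmul (of Λ A) (of Λ B)) = of Λ (LocalAlgebra.tensor A B) := by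
  rw [stackHom, lift_tmul, stackInl_of, stackInr_of, ← map_mul, LocalAlgebra.stackInl_mul_stackInr]

variable (X Y) in
/-- The ⋆-homomorphism `A ⊗ B ↦ A ⊗ B` from the local algebra of the stacked system to the tensor
product of the quasi-local algebras. -/
def unstackLocal (Λ : Finset Γ) : LocalAlgebra (X ⊠ Y) Λ →⋆ₐ[ℂ]
    MaxTensor (QuasiLocal Γ X) (QuasiLocal Γ Y) :=
  tensorDesc (LocalAlgebra.stackEquiv X Y Λ) ((inl _ _).comp (of Λ)) ((inr _ _).comp (of Λ))
    fun A B => commute_inl_inr (of Λ A) (of Λ B)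

theorem unstackLocal_tensor (Λ : Finset Γ) (A : LocalAlgebra X Λ) (B : LocalAlgebra Y Λ) :
    unstackLocal X Y Λ (LocalAlgebra.tensor A B) = tmul (of Λ A) (of Λ B) :=
  (tensorDesc_apply (LocalAlgebra.stackEquiv X Y Λ) _ _ _ A B).trans (tmul_eq _ _).symm

theorem unstackLocal_incl {Λ Λ' : Finset Γ} (h : Λ ≤ Λ') (T : LocalAlgebra (X ⊠ Y) Λ) :
    unstackLocal X Y Λ' (LocalAlgebra.incl (X ⊠ Y) h T) = unstackLocal X Y Λ T := by
  have : (unstackLocal X Y Λ').toAlgHom.toLinearMap ∘ₗ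
      (LocalAlgebra.incl (X ⊠ Y) h).toAlgHom.toLinearMap =
      (unstackLocal X Y Λ).toAlgHom.toLinearMap :=
    LocalAlgebra.linearMap_ext_tensor fun A B => by
      change unstackLocal X Y Λ' (LocalAlgebra.incl (X ⊠ Y) h (LocalAlgebra.tensor A B)) =
        unstackLocal X Y Λ (LocalAlgebra.tensor A B)
      rw [← LocalAlgebra.tensor_incl, unstackLocal_tensor, unstackLocal_tensor, of_incl,
        of_incl]
  exact LinearMap.congr_fun this T

variable (Γ X Y) in
/-- The inverse of `stackHom`. On the observables localised in `Λ` it is a ⋆-homomorphism on a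
C⋆-algebra, hence contractive whatever the norm of the tensor product. -/
def unstackHom : QuasiLocal Γ (X ⊠ Y) →⋆ₐ[ℂ] MaxTensor (QuasiLocal Γ X) (QuasiLocal Γ Y) :=
  lift (unstackLocal X Y) fun _ _ h T => unstackLocal_incl h T

@[simp] theorem unstackHom_of (Λ : Finset Γ) (A : LocalAlgebra X Λ) (B : LocalAlgebra Y Λ) :
    unstackHom Γ X Y (of Λ (LocalAlgebra.tensor A B)) = tmul (of Λ A) (of Λ B) := by
  rw [unstackHom, lift_of, unstackLocal_tensor]

variable (Γ X Y) in
theorem unstackHom_comp_stackHom :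
    (UCPMap.ofStarAlgHom (unstackHom Γ X Y)).comp (UCPMap.ofStarAlgHom (stackHom Γ X Y)) =
      UCPMap.id _ :=
  ucp_ext₂ fun Λ A B => by
    simp only [UCPMap.comp_apply, UCPMap.ofStarAlgHom_apply, UCPMap.id_apply, stackHom_of,
      unstackHom_of]

variable (Γ X Y) in
theorem stackHom_comp_unstackHom :
    (UCPMap.ofStarAlgHom (stackHom Γ X Y)).comp (UCPMap.ofStarAlgHom (unstackHom Γ X Y)) =
      UCPMap.id _ :=
  ucp_ext fun Λ T => by
    have : (stackHom Γ X Y).toAlgHom.toLinearMap ∘ₗ (unstackHom Γ X Y).toAlgHom.toLinearMap ∘ₗ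
        (of (H := X ⊠ Y) Λ).toAlgHom.toLinearMap =
        (of (H := X ⊠ Y) Λ).toAlgHom.toLinearMap :=
      LocalAlgebra.linearMap_ext_tensor fun A B => by
        change stackHom Γ X Y (unstackHom Γ X Y (of Λ (LocalAlgebra.tensor A B))) =
          of Λ (LocalAlgebra.tensor A B)
        rw [unstackHom_of, stackHom_of]
    exact LinearMap.congr_fun this T

variable (Γ X Y) in
/-- The canonical ⋆-isomorphism between external and internal stacking. -/
def stackEquiv : MaxTensor (QuasiLocal Γ X) (QuasiLocal Γ Y) ≃⋆ₐ[ℂ] QuasiLocal Γ (X ⊠ Y) :=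
  StarAlgEquiv.ofBijective (stackHom Γ X Y)
    ⟨Function.LeftInverse.injective (g := unstackHom Γ X Y) fun x =>
      DFunLike.congr_fun (unstackHom_comp_stackHom Γ X Y) x,
     Function.RightInverse.surjective (g := unstackHom Γ X Y) fun x =>
      DFunLike.congr_fun (stackHom_comp_unstackHom Γ X Y) x⟩

theorem stackHom_natural (f : X ⟶ X') (g : Y ⟶ Y') :
    (UCPMap.ofStarAlgHom (stackHom Γ X Y)).comp (MaxTensor.map (pullback Γ f) (pullback Γ g)) =
      (pullback Γ (tensorHom f g)).comp (UCPMap.ofStarAlgHom (stackHom Γ X' Y')) :=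
  ucp_ext₂ fun Λ A B => by
    rw [UCPMap.comp_apply, map_tmul, pullback_of, pullback_of, UCPMap.ofStarAlgHom_apply,
      stackHom_of, UCPMap.comp_apply, UCPMap.ofStarAlgHom_apply, stackHom_of, pullback_of,
      LocalAlgebra.compress_tensor]

theorem stackHom_associator :
    ((pullback Γ (associator X Y Z).inv).comp
      (UCPMap.ofStarAlgHom (stackHom Γ (X ⊠ Y) Z))).comp
      (MaxTensor.map (UCPMap.ofStarAlgHom (stackHom Γ X Y)) (UCPMap.id _)) =
    ((UCPMap.ofStarAlgHom (stackHom Γ X (Y ⊠ Z))).comp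
      (MaxTensor.map (UCPMap.id _) (UCPMap.ofStarAlgHom (stackHom Γ Y Z)))).comp
      (UCPMap.ofStarAlgHom (assocHom _ _ _)) :=
  ucp_ext₃ fun Λ A B C => by
    rw [UCPMap.comp_apply, map_tmul, UCPMap.ofStarAlgHom_apply, stackHom_of, UCPMap.id_apply,
      UCPMap.comp_apply, UCPMap.ofStarAlgHom_apply, stackHom_of, pullback_of,
      LocalAlgebra.compress_associator_inv,
      UCPMap.comp_apply, UCPMap.ofStarAlgHom_apply, assocHom_tmul, UCPMap.comp_apply, map_tmul,
      UCPMap.ofStarAlgHom_apply, UCPMap.id_apply, UCPMap.ofStarAlgHom_apply, stackHom_of,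
      stackHom_of]

/-- Left unitality. By linearity the scalar may be taken to be `1`, which is local. -/
theorem stackHom_leftUnitor :
    ((pullback Γ (leftUnitor X).inv).comp
      (UCPMap.ofStarAlgHom (stackHom Γ 𝕀 X))).comp
      (MaxTensor.map (UCPMap.ofStarAlgHom (unitHom _)) (UCPMap.id _)) =
    UCPMap.ofStarAlgHom (lidHom (QuasiLocal Γ X)) := by
  refine MaxTensor.ucp_ext fun c a => ?_
  rw [← mul_one c, ← smul_eq_mul, smul_tmul, map_smul, map_smul]
  refine congrArg (c • ·) ?_
  refine QuasiLocal.induction (isClosed_eq ((UCPMap.continuous _).comp (continuous_tmul_right _))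
    ((UCPMap.continuous _).comp (continuous_tmul_right _))) (fun Λ A => ?_) a
  simp only [Function.comp_apply, UCPMap.comp_apply, UCPMap.ofStarAlgHom_apply, map_tmul,
    UCPMap.id_apply,
    map_one, lidHom_tmul, one_smul]
  rw [← map_one (of Λ), stackHom_of, pullback_of, LocalAlgebra.compress_leftUnitor_inv]

/-- Right unitality. By linearity the scalar may be taken to be `1`, which is local. -/
theorem stackHom_rightUnitor :
    ((pullback Γ (rightUnitor X).inv).comp
      (UCPMap.ofStarAlgHom (stackHom Γ X 𝕀))).comp
      (MaxTensor.map (UCPMap.id _) (UCPMap.ofStarAlgHom (unitHom _))) =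
    UCPMap.ofStarAlgHom (ridHom (QuasiLocal Γ X)) := by
  refine MaxTensor.ucp_ext fun a c => ?_
  rw [← mul_one c, ← smul_eq_mul, tmul_smul, map_smul, map_smul]
  refine congrArg (c • ·) ?_
  refine QuasiLocal.induction (isClosed_eq ((UCPMap.continuous _).comp (continuous_tmul_left _))
    ((UCPMap.continuous _).comp (continuous_tmul_left _))) (fun Λ A => ?_) a
  simp only [Function.comp_apply, UCPMap.comp_apply, UCPMap.ofStarAlgHom_apply, map_tmul,
    UCPMap.id_apply,
    map_one, ridHom_tmul, one_smul]
  rw [← map_one (of Λ), stackHom_of, pullback_of, LocalAlgebra.compress_rightUnitor_inv]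

variable (Γ) in
/-- Every local algebra of the trivial system consists of scalars, and the scalars are closed. -/
theorem unitHom_bijective : Function.Bijective (unitHom (QuasiLocal Γ ℂ)) := by
  have : Nontrivial (QuasiLocal Γ ℂ) := by
    have h := QuasiLocal.norm_of (H := ℂ) (∅ : Finset Γ) 1
    exact ⟨of ∅ 1, 0, norm_ne_zero_iff.mp (h.trans_ne (norm_ne_zero_iff.mpr one_ne_zero))⟩
  have hinj : Function.Injective (unitHom (QuasiLocal Γ ℂ)) :=
    (algebraMap ℂ (QuasiLocal Γ ℂ)).injective
  refine ⟨hinj, fun x => ?_⟩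
  have hiso : Isometry (unitHom (QuasiLocal Γ ℂ)) :=
    AddMonoidHomClass.isometry_of_norm _ (NonUnitalStarAlgHom.norm_map _ hinj)
  refine QuasiLocal.induction (P := fun x => x ∈ Set.range (unitHom (QuasiLocal Γ ℂ)))
    hiso.isClosedEmbedding.isClosed_range (fun Λ A => ?_) x
  obtain ⟨c, rfl⟩ := exists_eq_algebraMap A
  exact ⟨c, (AlgHomClass.commutes (of Λ) c).symm⟩

end QuasiLocal
end Stacking

/-! ### Uniqueness of the norm of a C⋆-algebra -/

section UniqueNorm

variable {C : Type*} [NonUnitalCStarAlgebra C]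

namespace Unitization

/-- The action of the unitization on the ideal `C` by left multiplication. -/
def mulLeft (u : Unitization ℂ C) (c : C) : C := u.fst • c + u.snd * c

theorem inr_mulLeft (u : Unitization ℂ C) (c : C) :
    ((mulLeft u c : C) : Unitization ℂ C) = u * (c : Unitization ℂ C) := by
  ext <;> simp [mulLeft]

end Unitization

namespace CStarSeminorm

variable (p : CStarSeminorm C)

open Unitization

/-- Unitaries of the unitization act isometrically, since `(uc)⋆(uc) = c⋆c`. -/
theorem apply_mulLeft_unitary (u : unitary (Unitization ℂ C)) (c : C) :
    p (mulLeft (u : Unitization ℂ C) c) = p c := by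
  have h : star (mulLeft (u : Unitization ℂ C) c) * mulLeft (u : Unitization ℂ C) c =
      star c * c := by
    apply Unitization.inr_injective (R := ℂ)
    rw [inr_mul, inr_star, inr_mulLeft, star_mul, mul_assoc,
      ← mul_assoc (star (u : Unitization ℂ C)),
      Unitary.coe_star_mul_self, one_mul, inr_mul, inr_star]
  have h2 := p.star_mul_self (mulLeft (u : Unitization ℂ C) c)
  rw [h, p.star_mul_self] at h2
  exact (mul_self_inj (apply_nonneg p _) (apply_nonneg p _)).mp h2.symm

theorem apply_mul_le_of_isSelfAdjoint {h : C} (hh : IsSelfAdjoint h) (hn : ‖h‖ ≤ 1) (c : C) :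
    p (h * c) ≤ p c := by
  -- `h` is the mean of a unitary of the unitization and its adjoint
  let a : selfAdjoint (Unitization ℂ C) := ⟨(h : Unitization ℂ C), hh.inr ℂ⟩
  have ha : ‖a‖ ≤ 1 := (Unitization.norm_inr (𝕜 := ℂ) h).trans_le hn
  let u := selfAdjoint.unitarySelfAddISMul a ha
  have hu : h * c = (2 : ℂ)⁻¹ • (mulLeft (u : Unitization ℂ C) c +
      mulLeft ((star u : unitary (Unitization ℂ C)) : Unitization ℂ C) c) := by
    apply Unitization.inr_injective (R := ℂ)
    rw [inr_smul, inr_add, inr_mulLeft, inr_mulLeft, ← add_mul, ← smul_mul_assoc, inr_mul]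
    congr 1
    have h1 := congrArg Subtype.val (selfAdjoint.realPart_unitarySelfAddISMul a ha)
    rw [realPart_apply_coe] at h1
    refine h1.symm.trans ?_
    rw [← Complex.coe_smul, Complex.ofReal_inv, Complex.ofReal_ofNat]
    rfl
  rw [hu, map_smul_eq_mul]
  refine (mul_le_mul_of_nonneg_left (map_add_le_add p _ _) (norm_nonneg _)).trans ?_
  rw [apply_mulLeft_unitary, apply_mulLeft_unitary]
  norm_num
  linarith

/-- No continuity of the C⋆-seminorm is assumed. For self-adjoint `h` it follows from
`p (h * h) ≤ ‖h‖ * p h`. -/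
theorem apply_le_norm (c : C) : p c ≤ ‖c‖ := by
  have key : ∀ h : C, IsSelfAdjoint h → p h ≤ ‖h‖ := by
    intro h hh
    rcases (norm_nonneg h).eq_or_lt with h0 | h0
    · rw [norm_eq_zero.mp h0.symm, map_zero, norm_zero]
    rcases (apply_nonneg p h).eq_or_lt with h1 | h1
    · rw [← h1]; exact h0.le
    have hs : IsSelfAdjoint ((‖h‖⁻¹ : ℂ) • h) := by
      refine IsSelfAdjoint.smul ?_ hh
      simp [isSelfAdjoint_iff]
    have h2 := p.apply_mul_le_of_isSelfAdjoint hs (by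
      rw [norm_smul, norm_inv, Complex.norm_real, norm_norm, inv_mul_cancel₀ h0.ne']) h
    rw [smul_mul_assoc, map_smul_eq_mul, norm_inv, Complex.norm_real, norm_norm] at h2
    have h3 := p.star_mul_self h
    rw [hh.star_eq] at h3
    rw [h3, inv_mul_le_iff₀ h0] at h2
    exact le_of_mul_le_mul_right h2 h1
  have h := key _ (IsSelfAdjoint.star_mul_self c)
  rw [p.star_mul_self, CStarRing.norm_star_mul_self] at h
  exact abs_le_of_sq_le_sq' (by nlinarith) (norm_nonneg c) |>.2

/-- If `0 < r < ‖h‖`, functional calculus gives `g ≠ 0` and `‖u‖ ≤ r⁻¹` with `u * h * g = g`, whence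
`p g ≤ r⁻¹ * p h * p g` and `r ≤ p h`. -/
theorem norm_le_apply_of_isSelfAdjoint (hp : ∀ x, p x = 0 → x = 0) {h : C}
    (hh : IsSelfAdjoint h) : ‖h‖ ≤ p h := by
  refine le_of_forall_lt_imp_le_of_dense fun r hr => ?_
  rcases le_or_gt r 0 with hr0 | hr0
  · exact hr0.trans (apply_nonneg p h)
  -- `g` is supported where `|t| > r`, and `u` inverts `t` there
  let g : ℝ → ℝ := fun t => max 0 (|t| - r)
  let u : ℝ → ℝ := fun t => t / (max |t| r) ^ 2
  have hmax : ∀ t : ℝ, 0 < max |t| r := fun t => lt_max_of_lt_right hr0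
  have hgc : Continuous g := by fun_prop
  have huc : Continuous u := by
    refine continuous_id.div (by fun_prop) fun t => (pow_pos (hmax t) 2).ne'
  have hg0 : g 0 = 0 := by simp [g, hr0.le]
  have hu0 : u 0 = 0 := by simp [u]
  have hmul : cfcₙ u h * h * cfcₙ g h = cfcₙ g h := by
    have h1 : cfcₙ u h * h = cfcₙ (fun t => u t * t) h := by
      rw [cfcₙ_mul u (fun t => t) h huc.continuousOn hu0 continuousOn_id rfl, cfcₙ_id' ℝ h]
    rw [h1, ← cfcₙ_mul (fun t => u t * t) g h (huc.mul continuous_id).continuousOn (by simp)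
      hgc.continuousOn hg0]
    refine congrArg (cfcₙ · h) (funext fun t => ?_)
    rcases le_or_gt |t| r with ht | ht
    · have : g t = 0 := max_eq_left (by linarith)
      rw [this, mul_zero]
    · have ht0 : t ≠ 0 := fun h0 => by simp [h0] at ht; linarith
      have : u t * t = 1 := by
        simp only [u, max_eq_left ht.le, sq_abs]
        field_simp
      rw [this, one_mul]
  have hun : ‖cfcₙ u h‖ ≤ r⁻¹ := norm_cfcₙ_le fun t _ => by
    simp only [u, Real.norm_eq_abs, abs_div, abs_pow, abs_of_pos (hmax t)]
    rw [div_le_iff₀ (pow_pos (hmax t) 2), sq, ← mul_assoc]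
    refine (le_max_left |t| r).trans (le_mul_of_one_le_left (hmax t).le ?_)
    rw [← inv_mul_cancel₀ hr0.ne']
    exact mul_le_mul_of_nonneg_left (le_max_right _ _) (inv_pos.mpr hr0).le
  have hgn : cfcₙ g h ≠ 0 := by
    obtain ⟨t, ht, htn⟩ :=
      (NonUnitalIsometricContinuousFunctionalCalculus.isGreatest_norm_quasispectrum
      (𝕜 := ℝ) h hh).1
    have h1 := norm_apply_le_norm_cfcₙ g h ht hgc.continuousOn hg0 hh
    have h2 : 0 < g t := lt_max_of_lt_right (by
      rw [← Real.norm_eq_abs]; simp only at htn; rw [htn]; linarith)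
    exact norm_pos_iff.mp ((norm_pos_iff.mpr h2.ne').trans_le h1)
  have hpg : 0 < p (cfcₙ g h) :=
    (apply_nonneg p _).lt_of_ne fun h0 => hgn (hp _ h0.symm)
  have h1 : p (cfcₙ g h) ≤ r⁻¹ * p h * p (cfcₙ g h) := calc
    p (cfcₙ g h) = p (cfcₙ u h * h * cfcₙ g h) := by rw [hmul]
    _ ≤ p (cfcₙ u h) * p h * p (cfcₙ g h) := (p.mul_le _ _).trans
      (mul_le_mul_of_nonneg_right (p.mul_le _ _) hpg.le)
    _ ≤ r⁻¹ * p h * p (cfcₙ g h) := by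
      gcongr
      exact (p.apply_le_norm _).trans hun
  have h2 := le_of_mul_le_mul_right ((one_mul _).trans_le h1) hpg
  rwa [← div_eq_inv_mul, le_div_iff₀ hr0, one_mul] at h2

/-- A C⋆-algebra has only one C⋆-norm. -/
theorem apply_eq_norm (hp : ∀ x, p x = 0 → x = 0) (c : C) : p c = ‖c‖ := by
  refine le_antisymm (p.apply_le_norm c) ?_
  have h := p.norm_le_apply_of_isSelfAdjoint hp (IsSelfAdjoint.star_mul_self c)
  rw [p.star_mul_self, CStarRing.norm_star_mul_self] at h
  exact abs_le_of_sq_le_sq' (by nlinarith) (apply_nonneg p c) |>.2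

end CStarSeminorm
end UniqueNorm

/-! ### Tensor products with matrix algebras -/

section MatrixTensor

variable {A B n : Type*} [Fintype n] [DecidableEq n]

namespace CStarSeminorm

/-- The pullback of a C⋆-seminorm along a linear map that preserves products and adjoints. -/
def pullback {D E : Type*} [NonUnitalRing D] [Star D] [Module ℂ D] [NonUnitalRing E] [Star E]
    [Module ℂ E] (p : CStarSeminorm E) (φ : D →ₗ[ℂ] E) (hmul : ∀ x y, φ (x * y) = φ x * φ y)
    (hstar : ∀ x, φ (star x) = star (φ x)) : CStarSeminorm D where
  __ := p.toSeminorm.comp φ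
  mul_le' x y := (congrArg p (hmul x y)).trans_le (p.mul_le _ _)
  star_mul_self' x := by
    change p (φ (star x * x)) = p (φ x) * p (φ x)
    rw [hmul, hstar, p.star_mul_self]

theorem pullback_apply {D E : Type*} [NonUnitalRing D] [Star D] [Module ℂ D] [NonUnitalRing E]
    [Star E] [Module ℂ E] (p : CStarSeminorm E) (φ : D →ₗ[ℂ] E)
    (hmul : ∀ x y, φ (x * y) = φ x * φ y) (hstar : ∀ x, φ (star x) = star (φ x)) (x : D) :
    p.pullback φ hmul hstar x = p (φ x) := rfl

end CStarSeminorm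

section

variable [CStarAlgebra A] [NonUnitalCStarAlgebra B] (e : A ≃⋆ₐ[ℂ] Matrix n n ℂ)

/-- The linear map `a ⊗ b ↦ (aᵢⱼ b)ᵢⱼ` for a matrix algebra `A`. -/
def matrixTensorLin : A ⊗[ℂ] B →ₗ[ℂ] CStarMatrix n n B :=
  TensorProduct.lift (LinearMap.mk₂ ℂ (fun a b => CStarMatrix.ofMatrix fun i j => e a i j • b)
    (fun a a' b => by
      ext i j
      change e (a + a') i j • b = e a i j • b + e a' i j • b
      rw [map_add, Matrix.add_apply, add_smul])
    (fun c a b => by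
      ext i j
      change e (c • a) i j • b = c • e a i j • b
      rw [map_smul, Matrix.smul_apply, smul_assoc])
    (fun a b b' => by
      ext i j
      exact smul_add (e a i j) b b')
    (fun c a b => by
      ext i j
      exact smul_comm (e a i j) c b))

theorem matrixTensorLin_tmul (a : A) (b : B) (i j : n) :
    matrixTensorLin e (a ⊗ₜ b) i j = e a i j • b := rfl

/-- If `A` is a matrix algebra, the algebraic tensor product of `A` and `B` is the algebra of
matrices over `B`. -/
def matrixTensor : A ⊗[ℂ] B ≃ₗ[ℂ] CStarMatrix n n B :=
  LinearEquiv.ofLinearMap (matrixTensorLin e)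
    { toFun := fun M => ∑ i, ∑ j, e.symm (Matrix.single i j 1) ⊗ₜ M i j
      map_add' := fun M N => by
        simp only [CStarMatrix.add_apply, TensorProduct.tmul_add, Finset.sum_add_distrib]
      map_smul' := fun c M => by
        simp only [CStarMatrix.smul_apply, TensorProduct.tmul_smul, Finset.smul_sum,
          RingHom.id_apply] }
    (by
      refine LinearMap.ext fun M => ?_
      ext i j
      simp only [LinearMap.comp_apply, LinearMap.coe_mk, AddHom.coe_mk, map_sum,
        CStarMatrix.sum_entry, matrixTensorLin_tmul, StarAlgEquiv.apply_symm_apply,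
        LinearMap.id_apply]
      rw [Finset.sum_eq_single i, Finset.sum_eq_single j]
      · rw [Matrix.single_apply_same, one_smul]
      · intro k _ hk
        rw [Matrix.single_apply, if_neg fun h => hk h.2, zero_smul]
      · exact fun h => (h (Finset.mem_univ j)).elim
      · intro k _ hk
        refine Finset.sum_eq_zero fun l _ => ?_
        rw [Matrix.single_apply_of_row_ne hk, zero_smul]
      · exact fun h => (h (Finset.mem_univ i)).elim)
    (by
      refine TensorProduct.ext' fun a b => ?_
      simp only [LinearMap.comp_apply, LinearMap.coe_mk, AddHom.coe_mk, matrixTensorLin_tmul,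
        LinearMap.id_apply, ← TensorProduct.smul_tmul, ← TensorProduct.sum_tmul, ← map_smul,
        ← map_sum, Matrix.smul_single, smul_eq_mul, mul_one]
      rw [← Matrix.matrix_eq_sum_single, StarAlgEquiv.symm_apply_apply])

theorem matrixTensor_tmul (a : A) (b : B) (i j : n) :
    matrixTensor e (a ⊗ₜ b) i j = e a i j • b := rfl

theorem matrixTensor_mul (x y : A ⊗[ℂ] B) :
    matrixTensor e (x * y) = matrixTensor e x * matrixTensor e y := by
  induction x using TensorProduct.induction_on with
  | zero => simp
  | add x x' hx hx' => rw [add_mul, map_add, hx, hx', map_add, add_mul]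
  | tmul a b =>
    induction y using TensorProduct.induction_on with
    | zero => simp
    | add y y' hy hy' => rw [mul_add, map_add, hy, hy', map_add, mul_add]
    | tmul a' b' =>
      ext i j
      rw [Algebra.TensorProduct.tmul_mul_tmul, CStarMatrix.mul_apply, matrixTensor_tmul, map_mul,
        Matrix.mul_apply, Finset.sum_smul]
      exact Finset.sum_congr rfl fun k _ => (smul_mul_smul_comm _ _ _ _).symm

theorem matrixTensor_star (x : A ⊗[ℂ] B) :
    matrixTensor e (star x) = star (matrixTensor e x) := by
  induction x using TensorProduct.induction_on with
  | zero => simp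
  | add x x' hx hx' => rw [star_add, map_add, hx, hx', map_add, star_add]
  | tmul a b =>
    ext i j
    rw [TensorProduct.star_tmul, matrixTensor_tmul, CStarMatrix.star_apply, matrixTensor_tmul,
      star_smul, StarHomClass.map_star]
    rfl

attribute [local instance] CStarAlgebra.spectralOrder CStarAlgebra.spectralOrderedRing in
/-- The tensor product of a matrix algebra and a C⋆-algebra is complete in a C⋆-norm, which is
therefore the only one. -/
theorem CStarSeminorm.eq_of_matrix (e : A ≃⋆ₐ[ℂ] Matrix n n ℂ) (p q : CStarSeminorm (A ⊗[ℂ] B))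
    (hp : ∀ x, p x = 0 → x = 0) (hq : ∀ x, q x = 0 → x = 0) (x : A ⊗[ℂ] B) : p x = q x := by
  have hmul : ∀ M N, (matrixTensor (B := B) e).symm (M * N) =
      (matrixTensor e).symm M * (matrixTensor e).symm N := fun M N => by
    rw [LinearEquiv.symm_apply_eq, matrixTensor_mul, LinearEquiv.apply_symm_apply,
      LinearEquiv.apply_symm_apply]
  have hstar : ∀ M, (matrixTensor (B := B) e).symm (star M) =
      star ((matrixTensor e).symm M) := fun M => by
    rw [LinearEquiv.symm_apply_eq, matrixTensor_star, LinearEquiv.apply_symm_apply]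
  have key : ∀ p : CStarSeminorm (A ⊗[ℂ] B), (∀ x, p x = 0 → x = 0) →
      p x = ‖matrixTensor e x‖ := fun p hp => by
    have h := (p.pullback (matrixTensor e).symm.toLinearMap hmul hstar).apply_eq_norm
      (fun M hM => (LinearEquiv.map_eq_zero_iff _).mp (hp _ hM)) (matrixTensor e x)
    rw [← h, pullback_apply]
    exact congrArg p (LinearEquiv.symm_apply_apply _ x).symm
  rw [key p hp, key q hq]

end

/-- The operators on a finite-dimensional Hilbert space form a matrix algebra. -/
def operatorMatrix (V : Type*) [NormedAddCommGroup V] [InnerProductSpace ℂ V]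
    [FiniteDimensional ℂ V] : (V →L[ℂ] V) ≃⋆ₐ[ℂ]
      Matrix (Fin (Module.finrank ℂ V)) (Fin (Module.finrank ℂ V)) ℂ :=
  (stdOrthonormalBasis ℂ V).repr.conjStarAlgEquiv.trans Matrix.toEuclideanCLM.symm

end MatrixTensor

/-! ### Nuclearity -/

section Nuclear

variable {A B : Type*} [CStarAlgebra A] [NonUnitalCStarAlgebra B]

/-- Every element of `A` is a combination of four unitaries `u`, and `p (u ⊗ b) = p (1 ⊗ b)`. -/
theorem CStarSeminorm.apply_tmul_le (p : CStarSeminorm (A ⊗[ℂ] B)) (a : A) (b : B) :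
    p (a ⊗ₜ b) ≤ 2 * ‖a‖ * p (1 ⊗ₜ b) := by
  have hu : ∀ u : unitary A, p ((u : A) ⊗ₜ b) = p (1 ⊗ₜ b) := fun u => by
    have h : star ((u : A) ⊗ₜ[ℂ] b) * ((u : A) ⊗ₜ b) = star ((1 : A) ⊗ₜ[ℂ] b) * (1 ⊗ₜ b) := by
      rw [TensorProduct.star_tmul, TensorProduct.star_tmul, Algebra.TensorProduct.tmul_mul_tmul,
        Algebra.TensorProduct.tmul_mul_tmul, Unitary.coe_star_mul_self, star_one, one_mul]
    have h2 := p.star_mul_self ((u : A) ⊗ₜ b)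
    rw [h, p.star_mul_self] at h2
    exact (mul_self_inj (apply_nonneg p _) (apply_nonneg p _)).mp h2.symm
  obtain ⟨u, c, ha, hc⟩ := CStarAlgebra.exists_sum_four_unitary a
  calc p (a ⊗ₜ b) = p (∑ i, c i • ((u i : A) ⊗ₜ[ℂ] b)) := by
        conv_lhs => rw [ha, TensorProduct.sum_tmul]
        rfl
    _ ≤ ∑ i, p (c i • ((u i : A) ⊗ₜ[ℂ] b)) :=
        Finset.le_sum_of_subadditive p (map_zero p).le (map_add_le_add p) _ _
    _ ≤ ∑ _ : Fin 4, ‖a‖ / 2 * p (1 ⊗ₜ b) := Finset.sum_le_sum fun i _ => by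
        rw [map_smul_eq_mul, hu]
        exact mul_le_mul_of_nonneg_right (hc i) (apply_nonneg p _)
    _ = 2 * ‖a‖ * p (1 ⊗ₜ b) := by
        rw [Finset.sum_const, Finset.card_univ, Fintype.card_fin, nsmul_eq_mul]
        push_cast
        ring

section

variable {A' : Type*} [CStarAlgebra A'] (π : A →⋆ₐ[ℂ] A')

theorem rTensor_starAlgHom_mul (x y : A ⊗[ℂ] B) :
    LinearMap.rTensor B π.toAlgHom.toLinearMap (x * y) =
      LinearMap.rTensor B π.toAlgHom.toLinearMap x *
        LinearMap.rTensor B π.toAlgHom.toLinearMap y := by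
  induction x using TensorProduct.induction_on with
  | zero => simp
  | add x x' hx hx' => rw [add_mul, map_add, hx, hx', map_add, add_mul]
  | tmul a b =>
    induction y using TensorProduct.induction_on with
    | zero => simp
    | add y y' hy hy' => rw [mul_add, map_add, hy, hy', map_add, mul_add]
    | tmul a' b' =>
      simp only [Algebra.TensorProduct.tmul_mul_tmul, LinearMap.rTensor_tmul]
      exact congrArg (· ⊗ₜ[ℂ] (b * b')) (map_mul π a a')

theorem rTensor_starAlgHom_star (x : A ⊗[ℂ] B) :
    LinearMap.rTensor B π.toAlgHom.toLinearMap (star x) =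
      star (LinearMap.rTensor B π.toAlgHom.toLinearMap x) := by
  induction x using TensorProduct.induction_on with
  | zero => simp
  | add x x' hx hx' => rw [star_add, map_add, hx, hx', map_add, star_add]
  | tmul a b =>
    simp only [TensorProduct.star_tmul, LinearMap.rTensor_tmul]
    exact congrArg (· ⊗ₜ[ℂ] star b) (StarHomClass.map_star π a)

end

variable {Γ : Type*} {H : Type*} [NormedAddCommGroup H] [InnerProductSpace ℂ H]
  [FiniteDimensional ℂ H] [Nontrivial H]

namespace QuasiLocal

variable (B H) in
/-- The inclusion of the tensor product of a local algebra and `B`. -/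
def ofTensor (Λ : Finset Γ) : LocalAlgebra H Λ ⊗[ℂ] B →ₗ[ℂ] QuasiLocal Γ H ⊗[ℂ] B :=
  LinearMap.rTensor B (of Λ).toAlgHom.toLinearMap

theorem ofTensor_tmul (Λ : Finset Γ) (a : LocalAlgebra H Λ) (b : B) :
    ofTensor B H Λ (a ⊗ₜ b) = of Λ a ⊗ₜ b := rfl

theorem ofTensor_injective (Λ : Finset Γ) : Function.Injective (ofTensor B H Λ) := by
  refine Module.Flat.rTensor_preserves_injective_linearMap _ fun a a' h => ?_
  rw [← sub_eq_zero, ← norm_eq_zero, ← norm_of (H := H) Λ, map_sub, norm_eq_zero, sub_eq_zero]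
  exact h

theorem ofTensor_mul (Λ : Finset Γ) (x y : LocalAlgebra H Λ ⊗[ℂ] B) :
    ofTensor B H Λ (x * y) = ofTensor B H Λ x * ofTensor B H Λ y :=
  rTensor_starAlgHom_mul (of Λ) x y

theorem ofTensor_star (Λ : Finset Γ) (x : LocalAlgebra H Λ ⊗[ℂ] B) :
    ofTensor B H Λ (star x) = star (ofTensor B H Λ x) :=
  rTensor_starAlgHom_star (of Λ) x

theorem exists_ofTensor_of_le {Λ Λ' : Finset Γ} (h : Λ ≤ Λ') (x : LocalAlgebra H Λ ⊗[ℂ] B) :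
    ∃ y, ofTensor B H Λ' y = ofTensor B H Λ x := by
  refine ⟨LinearMap.rTensor B (LocalAlgebra.incl H h).toAlgHom.toLinearMap x, ?_⟩
  rw [ofTensor, ofTensor, ← LinearMap.comp_apply, ← LinearMap.rTensor_comp]
  congr 2
  exact LinearMap.ext fun a => of_incl h a

theorem exists_norm_sub_of_lt (a : QuasiLocal Γ H) {ε : ℝ} (hε : 0 < ε) :
    ∃ (Λ : Finset Γ) (A : LocalAlgebra H Λ), ‖a - of Λ A‖ < ε := by
  obtain ⟨x, hx⟩ := (localNorm Γ H).denseRange_toCompletion.exists_dist_lt a hε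
  obtain ⟨Λ, A, rfl⟩ := LocalObs.exists_of x
  exact ⟨Λ, A, (dist_eq_norm _ _).symm.trans_lt hx⟩

/-- Elements of the algebraic tensor product are approximated by local ones simultaneously in any
two C⋆-seminorms. -/
theorem exists_apply_sub_ofTensor_lt (p q : CStarSeminorm (QuasiLocal Γ H ⊗[ℂ] B))
    (x : QuasiLocal Γ H ⊗[ℂ] B) : ∀ ε > 0, ∃ (Λ : Finset Γ) (y : LocalAlgebra H Λ ⊗[ℂ] B),
      p (x - ofTensor B H Λ y) < ε ∧ q (x - ofTensor B H Λ y) < ε := by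
  classical
  induction x using TensorProduct.induction_on with
  | zero => exact fun ε hε => ⟨∅, 0, by simpa using hε⟩
  | tmul a b =>
    intro ε hε
    -- one constant serves for both seminorms; the summand `1` keeps it positive
    let c := 1 + p (1 ⊗ₜ b) + q (1 ⊗ₜ b)
    have hp := apply_nonneg p (1 ⊗ₜ b)
    have hq := apply_nonneg q (1 ⊗ₜ b)
    have hc : 0 < 2 * c := by positivity
    obtain ⟨Λ, A, hA⟩ := exists_norm_sub_of_lt a (div_pos hε hc)
    rw [lt_div_iff₀ hc] at hA
    have h0 := norm_nonneg (a - of Λ A)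
    refine ⟨Λ, A ⊗ₜ b, ?_, ?_⟩ <;> rw [ofTensor_tmul, ← TensorProduct.sub_tmul]
    · refine (p.apply_tmul_le _ b).trans_lt (lt_of_le_of_lt ?_ hA)
      rw [mul_comm 2, mul_assoc]
      gcongr
      simp only [c]; linarith
    · refine (q.apply_tmul_le _ b).trans_lt (lt_of_le_of_lt ?_ hA)
      rw [mul_comm 2, mul_assoc]
      gcongr
      simp only [c]; linarith
  | add x x' hx hx' =>
    intro ε hε
    obtain ⟨Λ, y, hp, hq⟩ := hx (ε / 2) (half_pos hε)
    obtain ⟨Λ', y', hp', hq'⟩ := hx' (ε / 2) (half_pos hε)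
    obtain ⟨z, hz⟩ := exists_ofTensor_of_le (Finset.subset_union_left : Λ ⊆ Λ ∪ Λ') y
    obtain ⟨z', hz'⟩ := exists_ofTensor_of_le (Finset.subset_union_right : Λ' ⊆ Λ ∪ Λ') y'
    refine ⟨Λ ∪ Λ', z + z', ?_, ?_⟩ <;> rw [map_add, hz, hz', add_sub_add_comm]
    · exact (map_add_le_add p _ _).trans_lt (by linarith)
    · exact (map_add_le_add q _ _).trans_lt (by linarith)

theorem apply_ofTensor_eq (p q : CStarSeminorm (QuasiLocal Γ H ⊗[ℂ] B))
    (hp : ∀ x, p x = 0 → x = 0) (hq : ∀ x, q x = 0 → x = 0) (Λ : Finset Γ)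
    (y : LocalAlgebra H Λ ⊗[ℂ] B) : p (ofTensor B H Λ y) = q (ofTensor B H Λ y) := by
  have hinj : ∀ x, ofTensor B H Λ x = 0 → x = 0 := fun x hx =>
    ofTensor_injective Λ (hx.trans (map_zero _).symm)
  exact CStarSeminorm.eq_of_matrix (operatorMatrix (ManyBody Λ H))
    (p.pullback (ofTensor B H Λ) (ofTensor_mul Λ) (ofTensor_star Λ))
    (q.pullback (ofTensor B H Λ) (ofTensor_mul Λ) (ofTensor_star Λ))
    (fun x hx => hinj x (hp _ hx)) (fun x hx => hinj x (hq _ hx)) y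

/-- On the tensor product of a local algebra with `B` any two C⋆-norms agree, and these subalgebras
are dense in both norms. -/
theorem isNuclear : IsNuclear.{v} (QuasiLocal Γ H) := by
  intro B _ p q hp hq
  have key : ∀ p q : CStarSeminorm (QuasiLocal Γ H ⊗[ℂ] B), (∀ x, p x = 0 → x = 0) →
      (∀ x, q x = 0 → x = 0) → ∀ x, p x ≤ q x := fun p q hp hq x => by
    refine le_of_forall_pos_lt_add fun ε hε => ?_
    obtain ⟨Λ, y, h1, h2⟩ := exists_apply_sub_ofTensor_lt p q x (ε / 2) (half_pos hε)
    have h3 := map_add_le_add p (x - ofTensor B H Λ y) (ofTensor B H Λ y)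
    have h4 := map_sub_le_add q x (x - ofTensor B H Λ y)
    rw [sub_add_cancel] at h3
    rw [sub_sub_cancel] at h4
    rw [apply_ofTensor_eq p q hp hq] at h3
    linarith
  exact DFunLike.ext _ _ fun x => (key p q hp hq x).antisymm (key q p hq hp x)

end QuasiLocal
end Nuclear

/-! ### The monoidal structure -/

section Monoidal

open CategoryTheory Opposite MonoidalCategory QuasiLocal

variable (Γ : Type)

/-- The canonical isomorphism between `ℂ` and the quasi-local algebra of the trivial system. -/
def unitIso : 𝟙_ CStarUCP ≅ (quasiLocal Γ).obj (𝟙_ HilbFinᵒᵖ) :=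
  let e : ℂ ≃⋆ₐ[ℂ] QuasiLocal Γ (𝟙_ HilbFin) :=
    StarAlgEquiv.ofBijective (MaxTensor.unitHom (QuasiLocal Γ (𝟙_ HilbFin))) (unitHom_bijective Γ)
  CStarUCP.isoOfStarAlgHom (A := ⟨ℂ⟩) (B := ⟨QuasiLocal Γ (𝟙_ HilbFin)⟩) e.toStarAlgHom
    e.symm.toStarAlgHom (UCPMap.ext e.symm_apply_apply) (UCPMap.ext e.apply_symm_apply)

/-- The canonical isomorphism between external and internal stacking, as an isomorphism of the
category of unital completely positive maps. -/
def stackIso (X Y : HilbFin) :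
    (⟨MaxTensor (QuasiLocal Γ X) (QuasiLocal Γ Y)⟩ : CStarUCP) ≅
      ⟨QuasiLocal Γ (MonoidalCategoryStruct.tensorObj (C := HilbFin) X Y)⟩ :=
  CStarUCP.isoOfStarAlgHom (A := ⟨MaxTensor (QuasiLocal Γ X) (QuasiLocal Γ Y)⟩)
    (B := ⟨QuasiLocal Γ (MonoidalCategoryStruct.tensorObj (C := HilbFin) X Y)⟩) (stackHom Γ X Y)
    (unstackHom Γ X Y) (unstackHom_comp_stackHom Γ X Y) (stackHom_comp_unstackHom Γ X Y)

theorem stackIso_hom_natural {X X' Y Y' : HilbFin} (f : X ⟶ X') (g : Y ⟶ Y') :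
    MonoidalCategoryStruct.tensorHom ((quasiLocal Γ).map f.op) ((quasiLocal Γ).map g.op) ≫
      (stackIso Γ X Y).hom =
    (stackIso Γ X' Y').hom ≫ (quasiLocal Γ).map (MonoidalCategoryStruct.tensorHom f g).op :=
  stackHom_natural f g

theorem stackIso_hom_natural_left {X X' : HilbFin} (f : X ⟶ X') (Y : HilbFin) :
    (quasiLocal Γ).map f.op ▷ (quasiLocal Γ).obj (op Y) ≫ (stackIso Γ X Y).hom =
      (stackIso Γ X' Y).hom ≫ (quasiLocal Γ).map (f ▷ Y).op := by
  have := stackIso_hom_natural Γ f (𝟙 Y)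
  rwa [op_id, CategoryTheory.Functor.map_id, tensorHom_id, tensorHom_id] at this

theorem stackIso_hom_natural_right (X : HilbFin) {Y Y' : HilbFin} (g : Y ⟶ Y') :
    (quasiLocal Γ).obj (op X) ◁ (quasiLocal Γ).map g.op ≫ (stackIso Γ X Y).hom =
      (stackIso Γ X Y').hom ≫ (quasiLocal Γ).map (X ◁ g).op := by
  have := stackIso_hom_natural Γ (𝟙 X) g
  rwa [op_id, CategoryTheory.Functor.map_id, id_tensorHom, id_tensorHom] at this

/-- In the opposite category the associator is the one of `HilbFin` reversed; hence the inverse,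
here and for the unitors. -/
theorem stackIso_associativity (X Y Z : HilbFin) :
    (stackIso Γ X Y).hom ▷ (⟨QuasiLocal Γ Z⟩ : CStarUCP) ≫ (stackIso Γ (X ⊗ Y) Z).hom ≫
        (quasiLocal Γ).map (α_ X Y Z).inv.op =
      (α_ (⟨QuasiLocal Γ X⟩ : CStarUCP) ⟨QuasiLocal Γ Y⟩ ⟨QuasiLocal Γ Z⟩).hom ≫
        (⟨QuasiLocal Γ X⟩ : CStarUCP) ◁ (stackIso Γ Y Z).hom ≫ (stackIso Γ X (Y ⊗ Z)).hom :=
  stackHom_associator (X := X) (Y := Y) (Z := Z)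

theorem stackIso_left_unitality (X : HilbFin) :
    (λ_ ((quasiLocal Γ).obj (op X))).hom = (unitIso Γ).hom ▷ (quasiLocal Γ).obj (op X) ≫
      (stackIso Γ (𝟙_ HilbFin) X).hom ≫ (quasiLocal Γ).map (λ_ X).inv.op :=
  (stackHom_leftUnitor (X := X)).symm

theorem stackIso_right_unitality (X : HilbFin) :
    (ρ_ ((quasiLocal Γ).obj (op X))).hom = (quasiLocal Γ).obj (op X) ◁ (unitIso Γ).hom ≫
      (stackIso Γ X (𝟙_ HilbFin)).hom ≫ (quasiLocal Γ).map (ρ_ X).inv.op :=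
  (stackHom_rightUnitor (X := X)).symm

/-- The functor `quasiLocal Γ` is strong monoidal, with tensorator given by stacking. -/
def quasiLocalCoreMonoidal : (quasiLocal Γ).CoreMonoidal where
  εIso := unitIso Γ
  μIso X Y := stackIso Γ X.unop Y.unop
  μIso_hom_natural_left f X' := stackIso_hom_natural_left Γ f.unop X'.unop
  μIso_hom_natural_right X' f := stackIso_hom_natural_right Γ X'.unop f.unop
  associativity X Y Z := stackIso_associativity Γ X.unop Y.unop Z.unop
  left_unitality X := stackIso_left_unitality Γ X.unop
  right_unitality X := stackIso_right_unitality Γ X.unop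

theorem stackEquiv_map (X Y : HilbFin) (Λ : Finset Γ) (a : Λ → (X →L[ℂ] X)) (b : Λ → (Y →L[ℂ] Y)) :
    stackEquiv Γ X Y
      (MaxTensor.tmul (QuasiLocal.of Λ (ManyBody.map a)) (QuasiLocal.of Λ (ManyBody.map b))) =
    QuasiLocal.of Λ (ManyBody.map fun v => TensorProduct.mapL (a v) (b v)) :=
  (stackHom_of Λ _ _).trans (congrArg (QuasiLocal.of Λ) (LocalAlgebra.tensor_map a b))

end Monoidal
end

theorem mainTheorem11 (Γ : Type) [Countable Γ] :
    (∀ H : HilbFin, IsNuclear.{v} (QuasiLocal Γ H)) ∧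
    ∃ M : (quasiLocal Γ).Monoidal, ∀ H₁ H₂ : HilbFin,
      ∃ e : MaxTensor (QuasiLocal Γ H₁) (QuasiLocal Γ H₂) ≃⋆ₐ[ℂ] QuasiLocal Γ (H₁ ⊗[ℂ] H₂),
        (∀ x : MaxTensor (QuasiLocal Γ H₁) (QuasiLocal Γ H₂),
          M.μ (Opposite.op H₁) (Opposite.op H₂) x = e x) ∧
        ∀ (Λ : Finset Γ) (a : Λ → (H₁ →L[ℂ] H₁)) (b : Λ → (H₂ →L[ℂ] H₂)),
          e (MaxTensor.tmul (QuasiLocal.of Λ (ManyBody.map a)) (QuasiLocal.of Λ (ManyBody.map b))) =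
            QuasiLocal.of Λ (ManyBody.map fun v => TensorProduct.mapL (a v) (b v)) := by
  refine ⟨fun H => QuasiLocal.isNuclear, (quasiLocalCoreMonoidal Γ).toMonoidal, fun H₁ H₂ =>
    ⟨QuasiLocal.stackEquiv Γ H₁ H₂, fun x => rfl, fun Λ a b => stackEquiv_map Γ H₁ H₂ Λ a b⟩⟩
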